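/- Let $n\ge 1$ and $\mathbb T=\mathbb R/\mathbb Z$. **Opers.** A $\mathsf{PSL}_n(\mathbb R)$-oper is a differential operator $D\psi=\psi^{(n)}+q_2\psi^{(n-2)}+\dots+q_n\psi$ with $q_i\in C^\infty(\mathbb T)$; the space of opers carries the $C^\infty$ topology of the coefficients. $D$ has trivial holonomy if its holonomy is trivial in $\mathsf{PSL}_n(\mathbb R)$, that is, if there is $\varepsilon\in\{1,-1\}$ with $\psi(t+1)=\varepsilon\,\psi(t)$ for all solutions $\psi:\mathbb R\to\mathbb R$ of $D\psi=0$. The trivial oper is the one whose solutions are spanned by $\cos^{n-1-i}(\pi t)\sin^{i}(\pi t)$, $0\le i\le n-1$ (it is $d^n/dx^n$, acting on $-\frac{n-1}{2}$-densities, in the projective coordinate $x=\tan(\pi t)$ on $\mathbb T$). An oper is Hitchin if it has trivial holonomy and can be joined to the trivial oper by a continuous path of opers with trivial holonomy. **Curves.** The Veronese embedding is $t\mapsto[\cos^{n-1}(\pi t),\cos^{n-2}(\pi t)\sin(\pi t),\dots,\sin^{n-1}(\pi t)]\in\mathbb P(\mathbb R^n)$. A curve $\xi:\mathbb T\to\mathbb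 P(\mathbb R^n)$ is Frenet if there is a curve $x\mapsto(\xi^1(x)\subset\dots\subset\xi^n(x)=\mathbb R^n)$ of complete flags, $\dim\xi^p(x)=p$, with $\xi^1=\xi$, such that for all positive integers $n_1,\dots,n_l$ with $p=\sum_i n_i\le n$: (i) for pairwise distinct $x_1,\dots,x_l$ the sum $\xi^{n_1}(x_1)+\dots+\xi^{n_l}(x_l)$ is direct; (ii) for every $x$, $\bigoplus_i\xi^{n_i}(y_i)\to\xi^p(x)$ as $(y_1,\dots,y_l)\to (x,\dots,x)$ with the $y_i$ pairwise distinct. A smooth Frenet curve is a $C^\infty$ Frenet curve which is nondegenerate: a local smooth lift $\eta$ to $\mathbb R^n\setminus\{0\}$ has $\eta,\eta',\dots,\eta^{(n-1)}$ linearly independent everywhere. A smooth Frenet curve is Hitchin if it can be joined to the Veronese embedding by a path of smooth Frenet curves that is continuous for the $C^\infty$ topology. The space of Hitchin Frenet curves up to $\mathsf{PSL}_n(\mathbb R)$ carries the quotient of the $C^\infty$ topology. **Associated curve.** A curve associated to an oper $D$ with trivial holonomy is $\xi=[v_1,\dots,v_n]$, where $v_1,\dots,v_n$ is a basis of the solutions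 of $D\psi=0$ whose (constant) Wronskian is positive; such a $\xi$ exists and is unique up to the action of $\mathsf{PSL}_n(\mathbb R)$. **Theorem.** Every curve associated to a Hitchin oper is a Hitchin Frenet curve, and the map which sends a Hitchin oper to the class of its associated curves is a homeomorphism from the space of Hitchin opers onto the space of Hitchin Frenet curves up to the action of $\mathsf{PSL}_n(\mathbb R)$. -/

import Mathlib

open scoped ContDiff Topology

noncomputable section

namespace OperCurve

/-- `ℝⁿ` with its Euclidean structure. -/
abbrev E (n : ℕ) : Type := EuclideanSpace ℝ (Fin n)

/-- The sequence of all derivatives of a smooth map on the line, each one seen as a point of the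
space of continuous maps with the topology of uniform convergence on compact sets. The `C^∞`
topologies below are induced by this map. -/
def jets {V : Type*} [NormedAddCommGroup V] [NormedSpace ℝ V] (f : ℝ → V) (hf : ContDiff ℝ ∞ f) :
    ℕ → C(ℝ, V) :=
  fun k => ⟨iteratedDeriv k f, hf.continuous_iteratedDeriv k (by exact_mod_cast le_top)⟩

/-! ### Opers -/

/-- A `PSL_n(ℝ)`-oper on the circle `ℝ/ℤ`, that is a differential operator
`ψ ↦ ψ⁽ⁿ⁾ + q₂ ψ⁽ⁿ⁻²⁾ + ⋯ + qₙ ψ` with smooth coefficients on the circle.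
Here `coeff j` is the coefficient `q_{n-j}` of `ψ⁽ʲ⁾`, for `0 ≤ j ≤ n - 2`. -/
structure Oper (n : ℕ) where
  coeff : Fin (n - 1) → UnitAddCircle → ℝ
  smooth : ∀ j, ContDiff ℝ ∞ (fun t : ℝ => coeff j (t : UnitAddCircle))

namespace Oper

variable {n : ℕ}

/-- The `C^∞` topology on opers: uniform convergence of all the derivatives of all the
coefficients. -/
instance : TopologicalSpace (Oper n) :=
  TopologicalSpace.induced
    (fun D : Oper n => fun j : Fin (n - 1) => jets _ (D.smooth j)) inferInstance

/-- The value `D ψ` of the differential operator, for a function `ψ` on the line. -/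
def apply (D : Oper n) (ψ : ℝ → ℝ) (t : ℝ) : ℝ :=
  iteratedDeriv n ψ t + ∑ j : Fin (n - 1), D.coeff j (t : UnitAddCircle) * iteratedDeriv j ψ t

/-- `ψ` is a solution, on the line, of the equation `D ψ = 0`. -/
def IsSolution (D : Oper n) (ψ : ℝ → ℝ) : Prop :=
  ContDiff ℝ ∞ ψ ∧ ∀ t, D.apply ψ t = 0

/-- The holonomy of `D` is trivial in `PSL_n(ℝ)`: the translation by the period `1` acts on the
space of solutions as `1` or as `-1`. -/
def HasTrivialHolonomy (D : Oper n) : Prop :=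
  ∃ ε : ℝ, (ε = 1 ∨ ε = -1) ∧ ∀ ψ, D.IsSolution ψ → ∀ t, ψ (t + 1) = ε * ψ t

end Oper

/-! ### Smooth curves in the projective space -/

/-- The orthogonal projection onto a line of `ℝⁿ`. It embeds the projective space as a closed
submanifold of the space of endomorphisms, which is how smoothness and the `C^∞` topology for
curves in the projective space are expressed below. -/
def lineProj {n : ℕ} (ℓ : Projectivization ℝ (E n)) : E n →L[ℝ] E n :=
  ℓ.submodule.starProjection

/-- A smooth curve from the circle to the projective space of `ℝⁿ`. -/
structure SmoothCurve (n : ℕ) where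
  toFun : UnitAddCircle → Projectivization ℝ (E n)
  smooth : ContDiff ℝ ∞ (fun t : ℝ => lineProj (toFun (t : UnitAddCircle)))

/-- `η` is a smooth lift, with values in `ℝⁿ ∖ {0}` and defined on the line, of the curve `ξ`. -/
def IsLift {n : ℕ} (ξ : UnitAddCircle → Projectivization ℝ (E n)) (η : ℝ → E n) : Prop :=
  ContDiff ℝ ∞ η ∧ ∀ t : ℝ, ∃ h : η t ≠ 0, ξ (t : UnitAddCircle) = Projectivization.mk ℝ (η t) h

/-- The Wronskian of the coordinates of `v`. -/
def wronskian {n : ℕ} (v : ℝ → E n) (t : ℝ) : ℝ :=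
  Matrix.det (Matrix.of fun i j : Fin n => iteratedDeriv (i : ℕ) (fun s => v s j) t)

/-- The curve `ξ` is associated to the oper `D`: in projective coordinates `ξ = [v₁, …, vₙ]`, where
`v₁, …, vₙ` are independent solutions of `D ψ = 0`, ordered so that their (constant, nonzero)
Wronskian is positive. -/
def Oper.IsAssociated {n : ℕ} (D : Oper n) (ξ : UnitAddCircle → Projectivization ℝ (E n)) : Prop :=
  ∃ v : ℝ → E n, (∀ i, D.IsSolution (fun t => v t i)) ∧ (∀ t, 0 < wronskian v t) ∧ IsLift ξ v

/-- A flag-valued curve: `F x p`, for `p ≤ n`, is a `p`-dimensional subspace of `ℝⁿ`, increasing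
with `p`. (The values for `p > n` are irrelevant.) -/
def IsFlagCurve {n : ℕ} (F : UnitAddCircle → ℕ → Submodule ℝ (E n)) : Prop :=
  (∀ x, ∀ p ≤ n, Module.finrank ℝ (F x p) = p) ∧ ∀ x p q, p ≤ q → q ≤ n → F x p ≤ F x q

/-- Frenet curves. Convergence of subspaces is convergence of the orthogonal projections, that is
convergence in the Grassmannian. -/
def IsFrenet {n : ℕ} (ξ : UnitAddCircle → Projectivization ℝ (E n)) : Prop :=
  ∃ F : UnitAddCircle → ℕ → Submodule ℝ (E n), IsFlagCurve F ∧
    (∀ x, F x 1 = (ξ x).submodule) ∧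
    (∀ (l : ℕ) (x : Fin l → UnitAddCircle) (m : Fin l → ℕ), Function.Injective x →
      (∀ i, 0 < m i) → ∑ i, m i ≤ n → iSupIndep fun i => F (x i) (m i)) ∧
    ∀ (l : ℕ) (x : UnitAddCircle) (m : Fin l → ℕ), (∀ i, 0 < m i) → ∑ i, m i ≤ n →
      Filter.Tendsto
        (fun y : Fin l → UnitAddCircle => (⨆ i, F (y i) (m i)).starProjection)
        (𝓝[{y | Function.Injective y}] fun _ => x)
        (𝓝 (F x (∑ i, m i)).starProjection)

/-- Nondegeneracy of a smooth curve: a lift and its derivatives up to order `n - 1` are everywhere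
linearly independent. -/
def IsNondegenerate {n : ℕ} (ξ : UnitAddCircle → Projectivization ℝ (E n)) : Prop :=
  ∃ η : ℝ → E n, IsLift ξ η ∧ ∀ t, LinearIndependent ℝ fun k : Fin n => iteratedDeriv (k : ℕ) η t

/-! ### The Veronese embedding -/

/-- The Veronese embedding `[cosⁿ⁻¹, cosⁿ⁻² sin, …, sinⁿ⁻¹]` of the circle, at the angle `π t`. In
the coordinate `x = tan (π t)` it is `[1, x, …, xⁿ⁻¹]`. -/
def veroneseLift (n : ℕ) (t : ℝ) : E n :=
  WithLp.toLp 2 fun i : Fin n =>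
    Real.cos (Real.pi * t) ^ (n - 1 - (i : ℕ)) * Real.sin (Real.pi * t) ^ (i : ℕ)

theorem veroneseLift_contDiff (n : ℕ) : ContDiff ℝ ∞ (veroneseLift n) := by
  rw [contDiff_euclidean]
  intro i
  simp only [veroneseLift]
  fun_prop

theorem veroneseLift_ne_zero {n : ℕ} (hn : 1 ≤ n) (t : ℝ) : veroneseLift n t ≠ 0 := by
  intro h
  have h0 : veroneseLift n t ⟨0, hn⟩ = 0 := by rw [h]; rfl
  have h1 : veroneseLift n t ⟨n - 1, by omega⟩ = 0 := by rw [h]; rfl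
  simp only [veroneseLift, Nat.sub_zero, pow_zero, mul_one, Nat.sub_self, one_mul] at h0 h1
  have hc := eq_zero_of_pow_eq_zero h0
  have hs := eq_zero_of_pow_eq_zero h1
  have := Real.sin_sq_add_cos_sq (Real.pi * t)
  rw [hc, hs] at this
  norm_num at this

theorem veroneseLift_add_one (n : ℕ) (t : ℝ) :
    veroneseLift n (t + 1) = (-1 : ℝ) ^ (n - 1) • veroneseLift n t := by
  ext i
  have hi : n - 1 = (n - 1 - (i : ℕ)) + (i : ℕ) := by have := i.2; omega
  have h1 : (-1 : ℝ) ^ (n - 1) = (-1) ^ (n - 1 - (i : ℕ)) * (-1) ^ (i : ℕ) := by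
    rw [← pow_add, ← hi]
  simp only [veroneseLift, mul_add, mul_one, Real.cos_add_pi, Real.sin_add_pi, PiLp.smul_apply,
    smul_eq_mul, h1]
  rw [neg_pow (Real.cos _), neg_pow (Real.sin _)]
  ring

theorem lineProj_mk {n : ℕ} (v : E n) (hv : v ≠ 0) :
    lineProj (Projectivization.mk ℝ v hv) = (‖v‖ ^ 2)⁻¹ • (innerSL ℝ v).smulRight v := by
  ext1 w
  have : lineProj (Projectivization.mk ℝ v hv) w = (ℝ ∙ v).starProjection w := by
    simp only [lineProj, Projectivization.submodule_mk]
  rw [this, Submodule.starProjection_singleton]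
  simp [smul_smul, div_eq_inv_mul]

/-- The Veronese curve. -/
def veronese (n : ℕ) (hn : 1 ≤ n) : SmoothCurve n where
  toFun := Function.Periodic.lift (c := (1 : ℝ))
    (f := fun t => Projectivization.mk ℝ (veroneseLift n t) (veroneseLift_ne_zero hn t)) (by
      intro t
      rw [Projectivization.mk_eq_mk_iff']
      exact ⟨(-1 : ℝ) ^ (n - 1), (veroneseLift_add_one n t).symm⟩)
  smooth := by
    have h := veroneseLift_contDiff n
    have h0 : ∀ t, ‖veroneseLift n t‖ ^ 2 ≠ 0 := fun t =>
      pow_ne_zero 2 (norm_ne_zero_iff.2 (veroneseLift_ne_zero hn t))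
    have hs : ContDiff ℝ ∞ fun t => (‖veroneseLift n t‖ ^ 2)⁻¹ •
        (innerSL ℝ (veroneseLift n t)).smulRight (veroneseLift n t) := by
      refine ((h.norm_sq ℝ).inv h0).smul ?_
      exact (((innerSL ℝ : E n →L[ℝ] E n →L[ℝ] ℝ).contDiff).comp h).smulRight h
    have he : ∀ t, lineProj (Projectivization.mk ℝ (veroneseLift n t) (veroneseLift_ne_zero hn t)) =
        (‖veroneseLift n t‖ ^ 2)⁻¹ •
          (innerSL ℝ (veroneseLift n t)).smulRight (veroneseLift n t) := fun t => lineProj_mk _ _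
    rw [← funext he] at hs
    exact hs

/-! ### Hitchin opers -/

/-- The trivial oper, that is `dⁿ/dxⁿ` in the projective coordinate `x = tan (π t)` on the circle,
acting on `-(n-1)/2`-densities: it is the oper whose space of solutions is spanned by the
coordinates of the Veronese embedding. -/
def Oper.IsTrivial {n : ℕ} (D : Oper n) : Prop :=
  ∀ i, D.IsSolution fun t => veroneseLift n t i

/-- An oper is Hitchin if it has trivial holonomy and can be deformed, through opers with trivial
holonomy, to the trivial oper. -/
def Oper.IsHitchin {n : ℕ} (D : Oper n) : Prop :=
  ∃ D₀ : Oper n, D₀.IsTrivial ∧ JoinedIn {D' : Oper n | D'.HasTrivialHolonomy} D D₀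

/-- The space of Hitchin opers, a subspace of the space of opers. -/
abbrev HitchinOper (n : ℕ) : Type := {D : Oper n // D.IsHitchin}

/-! ### Hitchin Frenet curves -/

namespace SmoothCurve

variable {n : ℕ}

/-- The `C^∞` topology on smooth curves in the projective space. -/
instance : TopologicalSpace (SmoothCurve n) :=
  TopologicalSpace.induced (fun ξ : SmoothCurve n => jets _ ξ.smooth) inferInstance

/-- Smooth Frenet curves. -/
def IsSmoothFrenet (ξ : SmoothCurve n) : Prop :=
  IsFrenet ξ.toFun ∧ IsNondegenerate ξ.toFun

/-- A smooth Frenet curve is Hitchin if it can be deformed, through smooth Frenet curves, to the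
Veronese embedding. -/
def IsHitchinFrenet (hn : 1 ≤ n) (ξ : SmoothCurve n) : Prop :=
  JoinedIn {ζ : SmoothCurve n | ζ.IsSmoothFrenet} ξ (veronese n hn)

end SmoothCurve

/-- The space of Hitchin Frenet curves, a subspace of the space of smooth curves. -/
abbrev HitchinFrenetCurve (n : ℕ) (hn : 1 ≤ n) : Type := {ξ : SmoothCurve n // ξ.IsHitchinFrenet hn}

/-- Two curves are equivalent if they differ by the action of an element of `PSL_n(ℝ)`, that is by
a linear automorphism of `ℝⁿ` with determinant one. -/
def pslSetoid (n : ℕ) (hn : 1 ≤ n) : Setoid (HitchinFrenetCurve n hn) where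
  r ξ ζ := ∃ g : E n ≃ₗ[ℝ] E n, LinearMap.det (g : E n →ₗ[ℝ] E n) = 1 ∧
    ∀ x, ζ.1.toFun x = Projectivization.map (g : E n →ₗ[ℝ] E n) g.injective (ξ.1.toFun x)
  iseqv := by
    refine ⟨fun ξ => ⟨LinearEquiv.refl ℝ _, by simp, fun x => ?_⟩, ?_, ?_⟩
    · exact (congrFun Projectivization.map_id _).symm
    · rintro ξ ζ ⟨g, hg, h⟩
      refine ⟨g.symm, ?_, fun x => ?_⟩
      · have := LinearEquiv.det_mul_det_symm g
        rw [hg, one_mul] at this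
        exact this
      · rw [h x]
        induction ξ.1.toFun x using Projectivization.ind with
        | h v hv => simp [Projectivization.map_mk]
    · rintro ξ ζ χ ⟨g, hg, h⟩ ⟨g', hg', h'⟩
      refine ⟨g.trans g', ?_, fun x => ?_⟩
      · rw [LinearEquiv.coe_trans, LinearMap.det_comp, hg, hg', one_mul]
      · rw [h' x, h x]
        induction ξ.1.toFun x using Projectivization.ind with
        | h v hv => simp [Projectivization.map_mk]

/-- The space of Hitchin Frenet curves up to the action of `PSL_n(ℝ)`, with the quotient
topology. -/
abbrev HitchinFrenetSpace (n : ℕ) (hn : 1 ≤ n) : Type := Quotient (pslSetoid n hn)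

end OperCurve

end

open scoped ContDiff Topology

noncomputable section

namespace OperCurve

open Filter

/-! ### Spaces of functions with few sign changes -/

/-! Opers with trivial holonomy and nondegenerate closed projective curves are two descriptions of
the same object. A basis of solutions is a curve `v` in ℝⁿ with `v (t + 1) = ± v t`, and its
Wronskian is constant because the operator has no term of order n - 1. Conversely a nondegenerate
curve has a lift with Wronskian ±1, unique up to sign, and Cramer's rule applied to its n-th
derivative recovers periodic coefficients (`exists_oper`). Both passages are continuous: solutions
depend on the oper through a Picard series (`exists_vecSol`), and the coefficients are computed from
lifts that depend locally on the curve (`continuous_curveOper`). A path of smooth Frenet curves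
ending at the Veronese embedding therefore yields a path of opers with trivial holonomy ending at
the trivial oper.

The substance is the other direction: along a path of opers with trivial holonomy starting at the
trivial one, the associated curves stay Frenet. The property that is propagated is the absence of a
linear form with n sign changes along the curve within less than a period (`Alternates` is its
negation). Having n sign changes is an open condition. It is also closed: n sign changes give n
zeros, which in a limit may collide but still count n with multiplicity, by Rolle's theorem. If the
limit curve had no form with n sign changes, the limit form would vanish by `eq_zero_of_zeros`: in
an n-dimensional nondegenerate space without n sign changes, a nonzero function has at most n - 1
zeros with multiplicity. This last fact is proved by induction on n, dividing by `t - a` the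
functions that vanish at `a`. The Veronese curve does not alternate, by a Vandermonde determinant,
so connectedness of the interval excludes alternation along the whole path.

For a curve without alternation, the bound on zeros says that osculating spaces at distinct points
are in direct sum. Rolle's theorem and compactness give their convergence when the points merge
(`IsFrame.isFrenet`).

Two facts about orientation complete the argument. The path of curves must have prescribed
endpoints, which uses the connectedness of the group of matrices with positive determinant. The
requirement of a positive Wronskian is an open and closed condition on nondegenerate curves,
satisfied by the Veronese embedding. -/

open Polynomial in
-- Take a translate of `p = X (X - 1) ⋯ (X - N + 1)`, which alternates at the half-integers around
-- its roots. The coefficient `j` of the translate by `τ` is `p⁽ʲ⁾(τ) / j!`. By Rolle's theorem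
-- `p⁽ʲ⁾` has N - j ≥ 1 real roots, all simple, so it takes both signs and `τ` can be chosen to give
-- the wanted one.
theorem exists_alternating_polynomial (N j : ℕ) (hj : j < N) (σ : ℝ) (hσ : σ ≠ 0) :
    ∃ q : ℝ[X], q.natDegree ≤ N ∧ 0 < q.coeff j * σ ∧ ∃ s : Fin (N + 1) → ℝ, StrictMono s ∧
      ∀ i : Fin (N + 1), 0 < (-1) ^ (N - (i : ℕ)) * q.eval (s i) := by
  set p : ℝ[X] := ∏ i ∈ Finset.range N, (X - C (i : ℝ)) with hp
  have hpm : p.Monic := monic_prod_of_monic _ _ fun i _ => monic_X_sub_C _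
  have hpd : p.natDegree = N := by
    rw [hp, natDegree_prod_of_monic _ _ fun i _ => monic_X_sub_C _]
    simp only [natDegree_X_sub_C, Finset.sum_const, Finset.card_range, smul_eq_mul, mul_one]
  have hroots : ∀ k, k ≤ N → N - k ≤ (derivative^[k] p).roots.toFinset.card := by
    intro k hk
    induction k with
    | zero =>
      have h1 : p.roots = (Multiset.range N).map (fun i : ℕ => (i : ℝ)) := by
        have : p = (((Multiset.range N).map (fun i : ℕ => (i : ℝ))).map fun a => X - C a).prod := by
          rw [hp, Multiset.map_map]; rfl
        rw [this, roots_multiset_prod_X_sub_C]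
      have h2 : p.roots.toFinset = (Finset.range N).image (fun i : ℕ => (i : ℝ)) := by
        rw [h1, ← Finset.range_val, ← Finset.image_toFinset]; simp
      simp only [Function.iterate_zero, id]
      rw [h2, Finset.card_image_of_injective _ Nat.cast_injective]
      simp
    | succ k ih =>
      have := card_roots_toFinset_le_derivative (derivative^[k] p)
      rw [Function.iterate_succ_apply']
      have := ih (by omega)
      omega
  set d := derivative^[j] p with hd
  have hdeg : d.natDegree ≤ N - j := by
    rw [hd]; exact (natDegree_iterate_derivative p j).trans (by rw [hpd])
  have hcard := hroots j hj.le
  have hpos : 0 < d.roots.toFinset.card := by rw [← hd] at hcard; omega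
  obtain ⟨ρ, hρ⟩ := Finset.card_pos.1 hpos
  have hρ' : ρ ∈ d.roots := by simpa using hρ
  have hnodup : d.roots.Nodup := by
    have h1 : d.roots.card ≤ d.roots.toFinset.card := (card_roots' d).trans (hdeg.trans hcard)
    rw [← Multiset.dedup_eq_self]
    exact Multiset.eq_of_le_of_card_le (Multiset.dedup_le _) h1
  have hd0 : d ≠ 0 := ne_zero_of_mem_roots hρ'
  have hder : d.derivative.eval ρ ≠ 0 := by
    intro h0
    have h1 : 1 < d.rootMultiplicity ρ :=
      (one_lt_rootMultiplicity_iff_isRoot hd0).2 ⟨isRoot_of_mem_roots hρ', h0⟩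
    rw [← count_roots] at h1
    have := Multiset.nodup_iff_count_le_one.1 hnodup ρ
    omega
  -- Otherwise the simple root `ρ` would be a maximum of `d * σ`.
  obtain ⟨τ, hτ⟩ : ∃ τ, 0 < d.eval τ * σ := by
    by_contra! hneg
    have hmax : IsLocalMax (fun t => d.eval t * σ) ρ := by
      refine Filter.Eventually.of_forall fun t => ?_
      have : d.eval ρ = 0 := isRoot_of_mem_roots hρ'
      simp only [this, zero_mul]
      exact hneg t
    have := hmax.hasDerivAt_eq_zero ((d.hasDerivAt ρ).mul_const σ)
    exact (mul_ne_zero hder hσ) this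
  refine ⟨taylor τ p, by simp [hpd], ?_, fun i => (i : ℝ) - 1 / 2 - τ, ?_, ?_⟩
  · rw [taylor_coeff]
    have : d.eval τ = (j.factorial : ℝ) * (hasseDeriv j p).eval τ := by
      rw [hd, ← factorial_smul_hasseDeriv]; simp
    rw [this] at hτ
    have hf : (0 : ℝ) < j.factorial := by exact_mod_cast j.factorial_pos
    rw [mul_assoc] at hτ
    exact (mul_pos_iff_of_pos_left hf).1 hτ
  · intro a b hab
    have : (a : ℝ) < b := by exact_mod_cast hab
    simp only; linarith
  · intro i
    rw [taylor_eval, sub_add_cancel, hp, eval_prod]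
    have hiN : (i : ℕ) ≤ N := by omega
    rw [← Finset.prod_range_mul_prod_Ico _ hiN]
    have h1 : (-1 : ℝ) ^ (N - (i : ℕ)) = ∏ k ∈ Finset.Ico (i : ℕ) N, (-1 : ℝ) := by simp
    rw [h1, mul_left_comm, ← Finset.prod_mul_distrib]
    refine mul_pos (Finset.prod_pos fun k hk => ?_) (Finset.prod_pos fun k hk => ?_)
    · have : (k : ℝ) + 1 ≤ (i : ℕ) := by exact_mod_cast Finset.mem_range.1 hk
      simp only [eval_sub, eval_X, eval_C]; linarith
    · have : ((i : ℕ) : ℝ) ≤ k := by exact_mod_cast (Finset.mem_Ico.1 hk).1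
      simp only [eval_sub, eval_X, eval_C]; linarith

/-- The functions `e j` span `U`, and `e j` has a zero of order exactly `j` at `c`. -/
structure IsAdapted {m : ℕ} (U : Submodule ℝ (ℝ → ℝ)) (c : ℝ) (e h : Fin m → ℝ → ℝ) : Prop where
  span : Submodule.span ℝ (Set.range e) = U
  cont : ∀ j, ContinuousAt (h j) c
  ne_zero : ∀ j, h j c ≠ 0
  eq : ∀ j t, e j t = (t - c) ^ (j : ℕ) * h j t

/-- `U` has, at each point of `J`, a basis of functions vanishing to orders `0, …, m - 1`. -/
def Nondeg (J : Set ℝ) (m : ℕ) (U : Submodule ℝ (ℝ → ℝ)) : Prop :=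
  ∀ c ∈ J, ∃ e h : Fin m → ℝ → ℝ, IsAdapted U c e h

/-- No function of `U` has `m` sign changes on `J`. -/
def NoAlt (J : Set ℝ) (m : ℕ) (U : Submodule ℝ (ℝ → ℝ)) : Prop :=
  ∀ g ∈ U, ∀ s : Fin (m + 1) → ℝ, StrictMono s → (∀ i, s i ∈ J) →
    ¬ ∀ i : Fin (m + 1), 0 < (-1) ^ (i : ℕ) * g (s i)

namespace IsAdapted

variable {m : ℕ} {U : Submodule ℝ (ℝ → ℝ)} {c : ℝ} {e h : Fin m → ℝ → ℝ}

theorem mem (H : IsAdapted U c e h) (j : Fin m) : e j ∈ U :=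
  H.span ▸ Submodule.subset_span ⟨j, rfl⟩

theorem exists_repr (H : IsAdapted U c e h) {g : ℝ → ℝ} (hg : g ∈ U) :
    ∃ a : Fin m → ℝ, ∀ t, g t = ∑ j, a j * e j t := by
  rw [← H.span, Submodule.mem_span_range_iff_exists_fun] at hg
  obtain ⟨a, rfl⟩ := hg
  exact ⟨a, fun t => by simp⟩

theorem continuousAt (H : IsAdapted U c e h) {g : ℝ → ℝ} (hg : g ∈ U) : ContinuousAt g c := by
  obtain ⟨a, ha⟩ := H.exists_repr hg
  have : g = fun t => ∑ j, a j * ((t - c) ^ (j : ℕ) * h j t) := by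
    funext t; rw [ha]; simp_rw [H.eq]
  rw [this]
  have := H.cont
  fun_prop

end IsAdapted

theorem Nondeg.exists_apply_ne_zero {J : Set ℝ} {m : ℕ} {U : Submodule ℝ (ℝ → ℝ)}
    (hU : Nondeg J (m + 1) U) {x : ℝ} (hx : x ∈ J) : ∃ g ∈ U, g x ≠ 0 := by
  obtain ⟨e, h, H⟩ := hU x hx
  refine ⟨e 0, H.mem 0, ?_⟩
  rw [H.eq]
  simpa using H.ne_zero 0

/-- Rescaling at a point: a space with a flag of orders of vanishing contains approximations of
all polynomials. -/
theorem IsAdapted.tendsto_rescale {m : ℕ} {U : Submodule ℝ (ℝ → ℝ)} {c : ℝ} {e h : Fin m → ℝ → ℝ}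
    (H : IsAdapted U c e h) (b : Fin m → ℝ) (s : ℝ) :
    Tendsto (fun δ : ℝ => ∑ j, b j * (δ ^ (j : ℕ))⁻¹ / h j c * e j (c + δ * s)) (𝓝[>] 0)
      (𝓝 (∑ j, b j * s ^ (j : ℕ))) := by
  have h1 : Tendsto (fun δ : ℝ => ∑ j, b j * s ^ (j : ℕ) / h j c * h j (c + δ * s)) (𝓝 0)
      (𝓝 (∑ j, b j * s ^ (j : ℕ) / h j c * h j c)) := by
    refine tendsto_finsetSum _ fun j _ => Tendsto.const_mul _ ?_
    have : Tendsto (fun δ : ℝ => c + δ * s) (𝓝 0) (𝓝 c) := by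
      have : ContinuousAt (fun δ : ℝ => c + δ * s) 0 := by fun_prop
      simpa [ContinuousAt] using this
    exact (H.cont j).tendsto.comp this
  have h2 : (∑ j, b j * s ^ (j : ℕ) / h j c * h j c) = ∑ j, b j * s ^ (j : ℕ) :=
    Finset.sum_congr rfl fun j _ => div_mul_cancel₀ _ (H.ne_zero j)
  rw [h2] at h1
  refine (h1.mono_left nhdsWithin_le_nhds).congr' ?_
  filter_upwards [self_mem_nhdsWithin] with δ hδ
  refine Finset.sum_congr rfl fun j _ => ?_
  have hδ0 : δ ^ (j : ℕ) ≠ 0 := pow_ne_zero _ (ne_of_gt hδ)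
  rw [H.eq, add_sub_cancel_left, mul_pow]
  field_simp

/-- If the function vanishing to top order at `c` also vanished at `x`, an extra sign change could
be produced. Near `c`, functions of `U` imitate at a small scale `δ` any polynomial `q` of degree at
most m, in particular one with m sign changes. At `x` the value is governed by `q.coeff k * δ⁻ᵏ`,
where `k < m` is the largest index with `e k x ≠ 0`. The sign of that coefficient can be prescribed,
so `x` contributes one more change. -/
theorem IsAdapted.last_apply_ne_zero {J : Set ℝ} {m : ℕ} {U : Submodule ℝ (ℝ → ℝ)} (hJ : IsOpen J)
    (hU : Nondeg J (m + 1) U) (hN : NoAlt J (m + 1) U) {c x : ℝ} (hc : c ∈ J) (hx : x ∈ J)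
    (hcx : c ≠ x) {e h : Fin (m + 1) → ℝ → ℝ} (H : IsAdapted U c e h) :
    e (Fin.last m) x ≠ 0 := by
  intro h0
  have hne : ∃ j, e j x ≠ 0 := by
    obtain ⟨g, hg, hgx⟩ := hU.exists_apply_ne_zero hx
    by_contra! hall
    obtain ⟨a, ha⟩ := H.exists_repr hg
    exact hgx (by simp [ha, hall])
  obtain ⟨k, hk, hkmax⟩ : ∃ k, e k x ≠ 0 ∧ ∀ j, k < j → e j x = 0 := by
    obtain ⟨k, hk, hkm⟩ := (Finset.univ.filter fun j => e j x ≠ 0).exists_max_image (fun j => j)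
      (by obtain ⟨j, hj⟩ := hne; exact ⟨j, by simpa using hj⟩)
    refine ⟨k, by simpa using hk, fun j hj => ?_⟩
    by_contra hj0
    exact absurd (hkm j (by simpa using hj0)) (not_le.2 hj)
  have hkm : (k : ℕ) < m := by
    rcases Nat.lt_or_ge k m with h | h
    · exact h
    · have : k = Fin.last m := Fin.ext (by have := k.2; simp; omega)
      exact absurd h0 (this ▸ hk)
  set κ : Fin (m + 1) → ℝ := fun j => e j x / h j c with hκ
  have hκk : κ k ≠ 0 := div_ne_zero hk (H.ne_zero k)
  -- `w` is the sign of `q` at the rescaled point nearest to `x`: the last one, where `q` is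
  -- positive, if `c < x`, and the first one, of sign `(-1) ^ m`, otherwise. The value at `x` must
  -- have the opposite sign.
  set w : ℝ := if c < x then 1 else (-1) ^ m with hw
  have hw0 : w ≠ 0 := by rw [hw]; split_ifs <;> simp
  obtain ⟨q, hqd, hqk, s, hs, hqs⟩ := exists_alternating_polynomial m k hkm (-w * κ k)
    (mul_ne_zero (neg_ne_zero.2 hw0) hκk)
  have hqe : ∀ t, q.eval t = ∑ j : Fin (m + 1), q.coeff j * t ^ (j : ℕ) := fun t => by
    rw [Polynomial.eval_eq_sum_range' (Nat.lt_succ_of_le hqd), Finset.sum_range]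
  set G : ℝ → ℝ → ℝ := fun δ t => ∑ j : Fin (m + 1), q.coeff j * (δ ^ (j : ℕ))⁻¹ / h j c * e j t with hG
  have hGU : ∀ δ, G δ ∈ U := fun δ => by
    have : G δ = ∑ j : Fin (m + 1), (q.coeff j * (δ ^ (j : ℕ))⁻¹ / h j c) • e j := by
      funext t; simp [hG]
    rw [this]
    exact Submodule.sum_mem _ fun j _ => Submodule.smul_mem _ _ (H.mem j)
  have hsign : ∀ i : Fin (m + 1), ∀ᶠ δ in 𝓝[>] (0 : ℝ), 0 < (-1) ^ (m - (i : ℕ)) * G δ (c + δ * s i) := fun i => by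
    have := (H.tendsto_rescale (fun j => q.coeff j) (s i)).const_mul ((-1) ^ (m - (i : ℕ)))
    rw [← hqe] at this
    exact this.eventually (lt_mem_nhds (hqs i))
  have hx_sign : ∀ᶠ δ in 𝓝[>] (0 : ℝ), w * G δ x < 0 := by
    -- This sum is `δ ^ k * G δ x`; only its term of index `k` survives in the limit.
    have hcont : Tendsto (fun δ : ℝ => ∑ j : Fin (m + 1),
        if (j : ℕ) ≤ k then q.coeff j * κ j * δ ^ ((k : ℕ) - j) else 0) (𝓝[>] 0)
        (𝓝 (q.coeff k * κ k)) := by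
      have : Continuous fun δ : ℝ => ∑ j : Fin (m + 1),
          if (j : ℕ) ≤ k then q.coeff j * κ j * δ ^ ((k : ℕ) - j) else 0 := by
        refine continuous_finsetSum _ fun j _ => ?_
        split_ifs <;> fun_prop
      have h1 := this.tendsto 0
      have h2 : (∑ j : Fin (m + 1), if (j : ℕ) ≤ k then q.coeff j * κ j * (0 : ℝ) ^ ((k : ℕ) - j)
          else 0) = q.coeff k * κ k := by
        rw [Finset.sum_eq_single k]
        · simp
        · intro j _ hjk
          split_ifs with hle
          · have : (k : ℕ) - j ≠ 0 := by
              have : (j : ℕ) ≠ k := fun h => hjk (Fin.ext h)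
              omega
            simp [this]
          · rfl
        · simp
      rw [h2] at h1
      exact h1.mono_left nhdsWithin_le_nhds
    have hlt : w * (q.coeff k * κ k) < 0 := by nlinarith [hqk]
    filter_upwards [(hcont.const_mul w).eventually (gt_mem_nhds hlt), self_mem_nhdsWithin]
      with δ hδ hδ0
    have hδ0 : 0 < δ := hδ0
    have hmul : δ ^ (k : ℕ) * G δ x = ∑ j : Fin (m + 1),
        if (j : ℕ) ≤ k then q.coeff j * κ j * δ ^ ((k : ℕ) - j) else 0 := by
      rw [hG, Finset.mul_sum]
      refine Finset.sum_congr rfl fun j _ => ?_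
      split_ifs with hle
      · have hp : δ ^ (k : ℕ) = δ ^ ((k : ℕ) - j) * δ ^ (j : ℕ) := by rw [← pow_add]; congr 1; omega
        have : δ ^ (j : ℕ) ≠ 0 := pow_ne_zero _ hδ0.ne'
        rw [hp, hκ]; field_simp
      · rw [hkmax j (by rw [Fin.lt_def]; omega)]; simp
    rw [← hmul] at hδ
    have h3 : 0 < δ ^ (k : ℕ) := pow_pos hδ0 _
    by_contra hcon
    push Not at hcon
    nlinarith [mul_nonneg h3.le hcon]
  have htend : ∀ i, Tendsto (fun δ : ℝ => c + δ * s i) (𝓝[>] 0) (𝓝 c) := fun i => by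
    have : ContinuousAt (fun δ : ℝ => c + δ * s i) 0 := by fun_prop
    have h2 : Tendsto (fun δ : ℝ => c + δ * s i) (𝓝 0) (𝓝 c) := by simpa [ContinuousAt] using this
    exact h2.mono_left nhdsWithin_le_nhds
  have hmem : ∀ i, ∀ᶠ δ in 𝓝[>] (0 : ℝ), c + δ * s i ∈ J := fun i =>
    (htend i).eventually (hJ.mem_nhds hc)
  rcases lt_or_gt_of_ne hcx with hlt | hgt
  · have hbefore : ∀ i, ∀ᶠ δ in 𝓝[>] (0 : ℝ), c + δ * s i < x := fun i =>
      (htend i).eventually (gt_mem_nhds hlt)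
    obtain ⟨δ, h1, h2, h3, h4, h5⟩ := ((eventually_all.2 hsign).and (hx_sign.and
      ((eventually_all.2 hmem).and ((eventually_all.2 hbefore).and self_mem_nhdsWithin)))).exists
    have h5 : 0 < δ := h5
    have hw1 : w = 1 := by rw [hw, if_pos hlt]
    rw [hw1, one_mul] at h2
    refine hN ((-1 : ℝ) ^ m • G δ) (U.smul_mem _ (hGU δ))
      (Fin.snoc (α := fun _ => ℝ) (fun i => c + δ * s i) x) ?_ ?_ ?_
    · rw [Fin.strictMono_iff_lt_succ]
      intro i
      induction i using Fin.lastCases with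
      | last => simpa [Fin.succ_last] using h4 (Fin.last m)
      | cast i =>
        rw [Fin.snoc_castSucc, Fin.succ_castSucc, Fin.snoc_castSucc]
        have := hs (Fin.castSucc_lt_succ (i := i))
        nlinarith
    · intro i
      induction i using Fin.lastCases with
      | last => simpa using hx
      | cast i => simpa using h3 i
    · intro i
      induction i using Fin.lastCases with
      | last =>
        simp only [Fin.snoc_last, Fin.val_last, Pi.smul_apply, smul_eq_mul, ← mul_assoc, ← pow_add]
        have : (-1 : ℝ) ^ (m + 1 + m) = -1 := by rw [Odd.neg_one_pow]; exact ⟨m, by ring⟩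
        rw [this]; linarith
      | cast i =>
        simp only [Fin.snoc_castSucc, Fin.val_castSucc, Pi.smul_apply, smul_eq_mul, ← mul_assoc,
          ← pow_add]
        have : (-1 : ℝ) ^ ((i : ℕ) + m) = (-1) ^ (m - (i : ℕ)) := by
          have : (i : ℕ) + m = (m - (i : ℕ)) + 2 * i := by omega
          rw [this, pow_add]; simp
        rw [this]; exact h1 i
  · have hafter : ∀ i, ∀ᶠ δ in 𝓝[>] (0 : ℝ), x < c + δ * s i := fun i =>
      (htend i).eventually (lt_mem_nhds hgt)
    obtain ⟨δ, h1, h2, h3, h4, h5⟩ := ((eventually_all.2 hsign).and (hx_sign.and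
      ((eventually_all.2 hmem).and ((eventually_all.2 hafter).and self_mem_nhdsWithin)))).exists
    have h5 : 0 < δ := h5
    have hw1 : w = (-1) ^ m := by rw [hw, if_neg (not_lt.2 hgt.le)]
    rw [hw1] at h2
    refine hN (-(-1 : ℝ) ^ m • G δ) (U.smul_mem _ (hGU δ))
      (Fin.cons (α := fun _ => ℝ) x (fun i => c + δ * s i)) ?_ ?_ ?_
    · rw [Fin.strictMono_iff_lt_succ]
      intro i
      induction i using Fin.cases with
      | zero => simpa using h4 0
      | succ i =>
        rw [Fin.cons_succ, ← Fin.succ_castSucc, Fin.cons_succ]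
        have := hs (Fin.castSucc_lt_succ (i := i))
        nlinarith
    · intro i
      induction i using Fin.cases with
      | zero => simpa using hx
      | succ i => simpa using h3 i
    · intro i
      induction i using Fin.cases with
      | zero =>
        simp only [Fin.cons_zero, Fin.val_zero, Pi.smul_apply, smul_eq_mul, pow_zero, one_mul]
        linarith
      | succ i =>
        simp only [Fin.cons_succ, Fin.val_succ, Pi.smul_apply, smul_eq_mul]
        have h6 : (-1 : ℝ) ^ ((i : ℕ) + 1) * (-(-1) ^ m * G δ (c + δ * s i)) =
            (-1) ^ ((i : ℕ) + m) * G δ (c + δ * s i) := by ring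
        have : (-1 : ℝ) ^ ((i : ℕ) + m) = (-1) ^ (m - (i : ℕ)) := by
          have : (i : ℕ) + m = (m - (i : ℕ)) + 2 * i := by omega
          rw [this, pow_add]; simp
        rw [h6, this]; exact h1 i

/-! ### Division by `t - a` of the functions vanishing at `a` -/

theorem eq_of_continuousAt_of_mul_eq {f g : ℝ → ℝ} {a : ℝ} (hf : ContinuousAt f a)
    (hg : ContinuousAt g a) (h : ∀ t, (t - a) * f t = (t - a) * g t) : f = g := by
  have hne : ∀ t, t ≠ a → f t = g t := fun t ht => mul_left_cancel₀ (sub_ne_zero.2 ht) (h t)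
  funext t
  rcases eq_or_ne t a with rfl | ht
  · refine tendsto_nhds_unique (hf.tendsto.mono_left nhdsWithin_le_nhds : Tendsto f (𝓝[≠] t) _)
      ((hg.tendsto.mono_left nhdsWithin_le_nhds : Tendsto g (𝓝[≠] t) _).congr' ?_)
    filter_upwards [self_mem_nhdsWithin] with s hs using (hne s hs).symm
  · exact hne t ht

/-- The quotients by `t - a` of the functions of `U` vanishing at `a`. -/
def divAt (a : ℝ) (U : Submodule ℝ (ℝ → ℝ)) : Submodule ℝ (ℝ → ℝ) where
  carrier := {g | (fun t => (t - a) * g t) ∈ U ∧ ContinuousAt g a}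
  add_mem' := by
    rintro f g ⟨hf, hf'⟩ ⟨hg, hg'⟩
    refine ⟨?_, hf'.add hg'⟩
    have : (fun t => (t - a) * (f + g) t) = (fun t => (t - a) * f t) + fun t => (t - a) * g t := by
      funext t; simp [mul_add]
    rw [this]
    exact U.add_mem hf hg
  zero_mem' := by
    refine ⟨?_, continuousAt_const⟩
    have : (fun t => (t - a) * (0 : ℝ → ℝ) t) = 0 := by funext t; simp
    rw [this]; exact U.zero_mem
  smul_mem' := by
    rintro r g ⟨hg, hg'⟩
    refine ⟨?_, hg'.const_smul r⟩
    have : (fun t => (t - a) * (r • g) t) = r • fun t => (t - a) * g t := by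
      funext t; simp; ring
    rw [this]
    exact U.smul_mem _ hg

/-- Evaluation at `a` kills the coefficient of `e 0`, and every other `e j` is divisible by `t - a`.
-/
theorem IsAdapted.exists_div {m : ℕ} {U : Submodule ℝ (ℝ → ℝ)} {a : ℝ}
    {e h : Fin (m + 1) → ℝ → ℝ} (H : IsAdapted U a e h) {G : ℝ → ℝ} (hG : G ∈ U) (hGa : G a = 0) :
    ∃ b : Fin m → ℝ, (∀ t, G t = (t - a) * ∑ j, b j * ((t - a) ^ (j : ℕ) * h j.succ t)) ∧
      ∃ k ∈ divAt a U, ∀ t, G t = (t - a) * k t := by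
  obtain ⟨b, hb⟩ := H.exists_repr hG
  have hb0 : b 0 = 0 := by
    have := hb a
    rw [hGa, Fin.sum_univ_succ] at this
    simp only [H.eq, sub_self, Fin.val_zero, pow_zero, one_mul, Fin.val_succ, pow_succ, mul_zero,
      zero_mul, Finset.sum_const_zero, add_zero] at this
    exact (mul_eq_zero.1 this.symm).resolve_right (H.ne_zero 0)
  have hGe : ∀ t, G t = (t - a) * ∑ j : Fin m, b j.succ * ((t - a) ^ (j : ℕ) * h j.succ t) := by
    intro t
    rw [hb t, Fin.sum_univ_succ, hb0, zero_mul, zero_add, Finset.mul_sum]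
    refine Finset.sum_congr rfl fun j _ => ?_
    rw [H.eq, Fin.val_succ]; ring
  refine ⟨fun j => b j.succ, hGe, _, ⟨?_, ?_⟩, hGe⟩
  · rw [← funext hGe]; exact hG
  · have := fun j : Fin m => H.cont j.succ
    fun_prop

theorem span_eq_divAt {a : ℝ} {U : Submodule ℝ (ℝ → ℝ)} {m : ℕ} {k : Fin m → ℝ → ℝ}
    (hk : ∀ j, k j ∈ divAt a U)
    (h : ∀ g ∈ divAt a U, ∃ b : Fin m → ℝ, ∀ t, (t - a) * g t = ∑ j, b j * ((t - a) * k j t)) :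
    Submodule.span ℝ (Set.range k) = divAt a U := by
  refine le_antisymm (Submodule.span_le.2 ?_) fun g hg => ?_
  · rintro _ ⟨j, rfl⟩; exact hk j
  · obtain ⟨b, hb⟩ := h g hg
    have hmem : ∑ j, b j • k j ∈ divAt a U :=
      Submodule.sum_mem _ fun j _ => Submodule.smul_mem _ _ (hk j)
    have : g = ∑ j, b j • k j := by
      refine eq_of_continuousAt_of_mul_eq hg.2 hmem.2 fun t => ?_
      rw [hb t, Finset.sum_apply, Finset.mul_sum]
      refine Finset.sum_congr rfl fun j _ => ?_
      simp only [Pi.smul_apply, smul_eq_mul]; ring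
    rw [this]
    exact Submodule.sum_mem _ fun j _ => Submodule.smul_mem _ _ (Submodule.subset_span ⟨j, rfl⟩)

/-- At `a` itself the orders of vanishing simply drop by one. At another point `c`, the function `e
m` of top order does not vanish at `a` (`IsAdapted.last_apply_ne_zero`). Subtracting multiples of it
makes the other `e j` vanish at `a` without changing their orders at `c`, since `j < m`. -/
theorem Nondeg.divAt {J : Set ℝ} {m : ℕ} {U : Submodule ℝ (ℝ → ℝ)} (hJ : IsOpen J)
    (hU : Nondeg J (m + 1) U) (hN : NoAlt J (m + 1) U) {a : ℝ} (ha : a ∈ J) :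
    Nondeg J m (divAt a U) := by
  obtain ⟨ea, ha', Ha⟩ := hU a ha
  intro c hc
  rcases eq_or_ne c a with rfl | hca
  · refine ⟨fun j t => (t - c) ^ (j : ℕ) * ha' j.succ t, fun j => ha' j.succ, ?_,
      fun j => Ha.cont _, fun j => Ha.ne_zero _, fun j t => rfl⟩
    refine span_eq_divAt (fun j => ⟨?_, ?_⟩) fun g hg => ?_
    · have : (fun t => (t - c) * ((t - c) ^ (j : ℕ) * ha' j.succ t)) = ea j.succ := by
        funext t; rw [Ha.eq, Fin.val_succ]; ring
      rw [this]; exact Ha.mem _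
    · have := Ha.cont j.succ
      fun_prop
    · obtain ⟨b, hb, -⟩ := Ha.exists_div hg.1 (by simp)
      refine ⟨b, fun t => ?_⟩
      rw [hb t, Finset.mul_sum]
      exact Finset.sum_congr rfl fun j _ => by ring
  · obtain ⟨e, h, H⟩ := hU c hc
    have hlast : e (Fin.last m) a ≠ 0 := H.last_apply_ne_zero hJ hU hN hc ha hca
    set l : Fin m → ℝ := fun j => e j.castSucc a / e (Fin.last m) a with hl
    have hk : ∀ j : Fin m, ∃ k ∈ OperCurve.divAt a U,
        ∀ t, e j.castSucc t - l j * e (Fin.last m) t = (t - a) * k t := fun j => by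
      have hmem : (fun t => e j.castSucc t - l j * e (Fin.last m) t) ∈ U :=
        U.sub_mem (H.mem _) (U.smul_mem (l j) (H.mem (Fin.last m)))
      exact (Ha.exists_div hmem (by rw [hl, div_mul_cancel₀ _ hlast, sub_self])).choose_spec.2
    choose k hkU hk using hk
    -- Near `c` the cofactor is given by the second formula. Its value at `a` only has to be
    -- compatible with the factorization of `k j`.
    refine ⟨k, fun j t => if t = a then k j a / (a - c) ^ (j : ℕ) else
      (h j.castSucc t - l j * ((t - c) ^ (m - (j : ℕ)) * h (Fin.last m) t)) / (t - a), ?_, fun j => ?_,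
      fun j => ?_, fun j t => ?_⟩
    · refine span_eq_divAt hkU fun g hg => ?_
      obtain ⟨b, hb⟩ := H.exists_repr hg.1
      refine ⟨fun j => b j.castSucc, fun t => ?_⟩
      have h0 := hb a
      rw [sub_self, zero_mul, Fin.sum_univ_castSucc] at h0
      have hbl : b (Fin.last m) = -∑ j : Fin m, b j.castSucc * l j := by
        have : b (Fin.last m) * e (Fin.last m) a =
            (-∑ j : Fin m, b j.castSucc * l j) * e (Fin.last m) a := by
          rw [neg_mul, Finset.sum_mul]
          have : ∀ j : Fin m, b j.castSucc * l j * e (Fin.last m) a =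
              b j.castSucc * e j.castSucc a := fun j => by simp only [hl]; field_simp
          simp_rw [this]; linarith
        exact mul_right_cancel₀ hlast this
      have hbt := hb t
      rw [hbt, Fin.sum_univ_castSucc, hbl]
      simp_rw [← hk, mul_sub, Finset.sum_sub_distrib, neg_mul, Finset.sum_mul, mul_assoc]
      ring
    · have hev : (fun t => (h j.castSucc t - l j * ((t - c) ^ (m - (j : ℕ)) * h (Fin.last m) t)) /
          (t - a)) =ᶠ[𝓝 c] fun t => if t = a then k j a / (a - c) ^ (j : ℕ) else
          (h j.castSucc t - l j * ((t - c) ^ (m - (j : ℕ)) * h (Fin.last m) t)) / (t - a) := by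
        filter_upwards [isOpen_ne.mem_nhds hca] with t ht
        rw [if_neg ht]
      refine ContinuousAt.congr ?_ hev
      have h1 := H.cont j.castSucc
      have h2 := H.cont (Fin.last m)
      have h3 : c - a ≠ 0 := sub_ne_zero.2 hca
      fun_prop (disch := assumption)
    · have : m - (j : ℕ) ≠ 0 := by have := j.2; omega
      simp only [if_neg hca, sub_self, ne_eq, this, not_false_eq_true, zero_pow, zero_mul, mul_zero,
        sub_zero]
      exact div_ne_zero (H.ne_zero _) (sub_ne_zero.2 hca)
    · rcases eq_or_ne t a with rfl | hta
      · have : (t - c) ^ (j : ℕ) ≠ 0 := pow_ne_zero _ (sub_ne_zero.2 hca.symm)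
        simp only [if_true]; field_simp
      · have h1 : t - a ≠ 0 := sub_ne_zero.2 hta
        have h2 := hk j t
        have hp : (t - c) ^ m = (t - c) ^ (j : ℕ) * (t - c) ^ (m - (j : ℕ)) := by
          rw [← pow_add]; congr 1; have := j.2; omega
        rw [H.eq, H.eq, Fin.val_castSucc, Fin.val_last, hp] at h2
        simp only [if_neg hta]
        field_simp
        linarith

theorem exists_fin_cut {m : ℕ} {s : Fin m → ℝ} (hs : StrictMono s) (a : ℝ) :
    ∃ k : Fin (m + 1), ∀ i : Fin m, s i < a ↔ i.castSucc < k := by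
  by_cases hall : ∀ i, s i < a
  · exact ⟨Fin.last m, fun i => ⟨fun _ => Fin.castSucc_lt_last i, fun _ => hall i⟩⟩
  · push Not at hall
    obtain ⟨i₀, hi₀, hmin⟩ := (Finset.univ.filter fun i => a ≤ s i).exists_min_image (fun j => j)
      (by obtain ⟨j, hj⟩ := hall; exact ⟨j, by simpa using hj⟩)
    have hi₀' : a ≤ s i₀ := by simpa using hi₀
    refine ⟨i₀.castSucc, fun i => ?_⟩
    rw [Fin.castSucc_lt_castSucc_iff]
    constructor
    · intro h
      by_contra hcon
      exact absurd (hs.monotone (not_lt.1 hcon)) (by linarith)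
    · intro h
      by_contra hcon
      exact absurd (hmin i (by simpa using hcon)) (not_le.2 h)

/-- Multiplying `g` by `-(t - a)` keeps its signs before `a` and reverses them after `a`, which
leaves room for one more sign at `a`. The product vanishes there, and a small multiple of a function
`p` with `p a ≠ 0` supplies that sign. -/
theorem NoAlt.divAt {J : Set ℝ} {m : ℕ} {U : Submodule ℝ (ℝ → ℝ)} (hJ : IsOpen J)
    (hU : Nondeg J (m + 1) U) (hN : NoAlt J (m + 1) U) {a : ℝ} (ha : a ∈ J) :
    NoAlt J m (divAt a U) := by
  intro g hg s₀ hs₀ hsJ₀ halt₀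
  have hgc : ∀ c ∈ J, ContinuousAt g c := by
    intro c hc
    rcases eq_or_ne c a with rfl | hca
    · exact hg.2
    · obtain ⟨e, h, H⟩ := hU c hc
      have h1 := H.continuousAt hg.1
      have h2 : ContinuousAt (fun t => (t - a) * g t / (t - a)) c := by
        have h3 : c - a ≠ 0 := sub_ne_zero.2 hca
        exact h1.div (by fun_prop) h3
      refine h2.congr ?_
      filter_upwards [isOpen_ne.mem_nhds hca] with t ht
      rw [mul_div_cancel_left₀ _ (sub_ne_zero.2 ht)]
  -- A small common translation moves all the points off `a` without changing the signs.
  obtain ⟨s, hs, hsJ, halt, hsa⟩ : ∃ s : Fin (m + 1) → ℝ, StrictMono s ∧ (∀ i, s i ∈ J) ∧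
      (∀ i : Fin (m + 1), 0 < (-1) ^ (i : ℕ) * g (s i)) ∧ ∀ i, s i ≠ a := by
    have htend : ∀ i, Tendsto (fun δ : ℝ => s₀ i + δ) (𝓝[>] 0) (𝓝 (s₀ i)) := fun i => by
      have : ContinuousAt (fun δ : ℝ => s₀ i + δ) 0 := by fun_prop
      have h2 : Tendsto (fun δ : ℝ => s₀ i + δ) (𝓝 0) (𝓝 (s₀ i)) := by
        simpa [ContinuousAt] using this
      exact h2.mono_left nhdsWithin_le_nhds
    have h1 : ∀ i, ∀ᶠ δ in 𝓝[>] (0 : ℝ), s₀ i + δ ∈ J := fun i =>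
      (htend i).eventually (hJ.mem_nhds (hsJ₀ i))
    have h2 : ∀ i : Fin (m + 1), ∀ᶠ δ in 𝓝[>] (0 : ℝ), 0 < (-1) ^ (i : ℕ) * g (s₀ i + δ) := fun i =>
      (((hgc _ (hsJ₀ i)).tendsto.comp (htend i)).const_mul _).eventually (lt_mem_nhds (halt₀ i))
    have h3 : ∀ i, ∀ᶠ δ in 𝓝[>] (0 : ℝ), s₀ i + δ ≠ a := fun i => by
      rcases eq_or_ne (s₀ i) a with h | h
      · filter_upwards [self_mem_nhdsWithin] with δ hδ
        have : (0 : ℝ) < δ := hδ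
        rw [h]; simpa using this.ne'
      · exact (htend i).eventually (isOpen_ne.mem_nhds h)
    obtain ⟨δ, h1, h2, h3⟩ := ((eventually_all.2 h1).and ((eventually_all.2 h2).and
      (eventually_all.2 h3))).exists
    exact ⟨fun i => s₀ i + δ, fun i j hij => by simpa using hs₀ hij, h1, h2, h3⟩
  obtain ⟨p, hp, hpa⟩ := hU.exists_apply_ne_zero ha
  -- `k` is the position of `a` among the points, hence the index it receives in the enlarged
  -- sequence. The sign required there is `(-1) ^ k`.
  obtain ⟨k, hk⟩ := exists_fin_cut hs a
  set F : ℝ → ℝ → ℝ := fun ε t => -((t - a) * g t) + ε * ((-1) ^ (k : ℕ) * p a * p t) with hF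
  have hFU : ∀ ε, F ε ∈ U := fun ε => by
    have : F ε = -(fun t => (t - a) * g t) + (ε * ((-1) ^ (k : ℕ) * p a)) • p := by
      funext t; simp [hF]; ring
    rw [this]
    exact U.add_mem (U.neg_mem hg.1) (U.smul_mem _ hp)
  have hFs : ∀ i : Fin (m + 1), ∀ᶠ ε in 𝓝[>] (0 : ℝ),
      0 < (-1) ^ ((k.succAbove i : Fin (m + 2)) : ℕ) * F ε (s i) := fun i => by
    have hc : Continuous fun ε => (-1) ^ ((k.succAbove i : Fin (m + 2)) : ℕ) * F ε (s i) := by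
      simp only [hF]; fun_prop
    refine ((hc.tendsto 0).mono_left nhdsWithin_le_nhds).eventually (lt_mem_nhds ?_)
    simp only [hF, zero_mul, add_zero]
    by_cases hik : i.castSucc < k
    · rw [Fin.succAbove_of_castSucc_lt _ _ hik, Fin.val_castSucc]
      have h1 := (hk i).2 hik
      have := halt i
      nlinarith [mul_pos (sub_pos.2 h1) this]
    · rw [Fin.succAbove_of_le_castSucc _ _ (not_lt.1 hik), Fin.val_succ, pow_succ]
      have h1 : a < s i := lt_of_le_of_ne (not_lt.1 fun h => hik ((hk i).1 h)) (hsa i).symm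
      have := halt i
      nlinarith [mul_pos (sub_pos.2 h1) this]
  obtain ⟨ε, hε, hε0⟩ := ((eventually_all.2 hFs).and self_mem_nhdsWithin).exists
  have hε0 : 0 < ε := hε0
  refine hN (F ε) (hFU ε) (k.insertNth a s) ?_ ?_ ?_
  · intro i j hij
    induction i using k.succAboveCases with
    | x =>
      induction j using k.succAboveCases with
      | x => exact absurd hij (lt_irrefl _)
      | p j =>
        rw [Fin.insertNth_apply_same, Fin.insertNth_apply_succAbove]
        rw [Fin.lt_succAbove_iff_le_castSucc] at hij
        exact lt_of_le_of_ne (not_lt.1 fun h => absurd ((hk j).1 h) (not_lt.2 hij)) (hsa j).symm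
    | p i =>
      induction j using k.succAboveCases with
      | x =>
        rw [Fin.insertNth_apply_same, Fin.insertNth_apply_succAbove]
        rw [Fin.succAbove_lt_iff_castSucc_lt] at hij
        exact (hk i).2 hij
      | p j =>
        rw [Fin.insertNth_apply_succAbove, Fin.insertNth_apply_succAbove]
        exact hs (by simpa using hij)
  · intro i
    induction i using k.succAboveCases with
    | x => simpa using ha
    | p i => simpa using hsJ i
  · intro i
    induction i using k.succAboveCases with
    | x =>
      rw [Fin.insertNth_apply_same]
      simp only [hF, sub_self, zero_mul, neg_zero, zero_add]
      have h1 : (-1 : ℝ) ^ (k : ℕ) * (ε * ((-1) ^ (k : ℕ) * p a * p a)) =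
          ((-1) ^ (k : ℕ) * (-1) ^ (k : ℕ)) * (ε * (p a * p a)) := by ring
      rw [h1, ← mul_pow]
      have := mul_self_pos.2 hpa
      simp only [mul_neg, mul_one, neg_neg, one_pow, one_mul]
      positivity
    | p i => rw [Fin.insertNth_apply_succAbove]; exact hε i

/-- `f` vanishes at `c` to order at least `p`. -/
def HasZeroOrder (f : ℝ → ℝ) (c : ℝ) (p : ℕ) : Prop :=
  ∃ h : ℝ → ℝ, ContinuousAt h c ∧ ∀ t, f t = (t - c) ^ p * h t

/-- A nonzero function in an `m`-dimensional nondegenerate space without `m` sign changes has at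
most `m - 1` zeros, counted with multiplicities. -/
theorem eq_zero_of_zeros {J : Set ℝ} (hJ : IsOpen J) (hJn : J.Nonempty) {m : ℕ}
    {U : Submodule ℝ (ℝ → ℝ)} (hU : Nondeg J m U) (hN : NoAlt J m U) {f : ℝ → ℝ} (hf : f ∈ U)
    {S : Finset ℝ} {μ : ℝ → ℕ} (hS : ∀ y ∈ S, y ∈ J) (hz : ∀ y ∈ S, HasZeroOrder f y (μ y))
    (hm : m ≤ ∑ y ∈ S, μ y) : f = 0 := by
  induction m generalizing U f μ with
  | zero =>
    obtain ⟨c, hc⟩ := hJn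
    obtain ⟨e, h, H⟩ := hU c hc
    rw [← H.span, Set.range_eq_empty, Submodule.span_empty, Submodule.mem_bot] at hf
    exact hf
  | succ m ih =>
    obtain ⟨a, haS, haμ⟩ : ∃ a ∈ S, μ a ≠ 0 := by
      by_contra! hall
      rw [Finset.sum_eq_zero hall] at hm
      omega
    obtain ⟨r, hr⟩ := Nat.exists_eq_succ_of_ne_zero haμ
    obtain ⟨ea, ha', Ha⟩ := hU a (hS a haS)
    obtain ⟨h, hh, hfh⟩ := hz a haS
    obtain ⟨-, -, k, hk, hfk⟩ := (Ha.exists_div hf (by rw [hfh, hr]; simp))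
    -- The quotient by `t - a` loses one unit of multiplicity at `a` and none at the other zeros.
    have hk0 : k = 0 := by
      refine ih (hU.divAt hJ hN (hS a haS)) (hN.divAt hJ hU (hS a haS)) hk
        (μ := Function.update μ a r) (fun y hy => ?_) ?_
      · rcases eq_or_ne y a with rfl | hya
        · refine ⟨h, hh, fun t => ?_⟩
          have : k = fun t => (t - y) ^ r * h t := by
            refine eq_of_continuousAt_of_mul_eq hk.2 (by fun_prop) fun t => ?_
            rw [← hfk, hfh, hr, pow_succ]; ring
          rw [Function.update_self]; exact congrFun this t
        · obtain ⟨h', hh', hfh'⟩ := hz y hy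
          rw [Function.update_of_ne hya]
          refine ⟨fun t => if t = a then k a / (a - y) ^ μ y else h' t / (t - a), ?_, fun t => ?_⟩
          · refine ContinuousAt.congr (f := fun t => h' t / (t - a)) ?_ ?_
            · exact hh'.div (by fun_prop) (sub_ne_zero.2 hya)
            · filter_upwards [isOpen_ne.mem_nhds hya] with t ht
              rw [if_neg ht]
          · rcases eq_or_ne t a with rfl | hta
            · have : (t - y) ^ μ y ≠ 0 := pow_ne_zero _ (sub_ne_zero.2 hya.symm)
              simp only [if_true]; field_simp
            · have h1 : t - a ≠ 0 := sub_ne_zero.2 hta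
              have h2 := hfk t
              rw [hfh'] at h2
              simp only [if_neg hta]
              field_simp
              linarith
      · rw [Finset.sum_update_of_mem haS]
        rw [← Finset.add_sum_erase _ _ haS, hr, ← Finset.sdiff_singleton_eq_erase] at hm
        omega
    funext t
    rw [hfk, hk0]; simp

/-! ### Zeros of smooth functions -/

section Derivatives

variable {V W : Type*} [NormedAddCommGroup V] [NormedSpace ℝ V] [NormedAddCommGroup W]
  [NormedSpace ℝ W]

theorem iteratedDeriv_comp_add (f : ℝ → V) (a : ℝ) (k : ℕ) (t : ℝ) :
    iteratedDeriv k (fun s => f (s + a)) t = iteratedDeriv k f (t + a) := by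
  induction k generalizing t with
  | zero => simp
  | succ k ih => rw [iteratedDeriv_succ, iteratedDeriv_succ, funext ih, deriv_comp_add_const]

theorem hasDerivAt_iteratedDeriv {f : ℝ → V} (hf : ContDiff ℝ ∞ f) (k : ℕ) (t : ℝ) :
    HasDerivAt (iteratedDeriv k f) (iteratedDeriv (k + 1) f t) t := by
  rw [iteratedDeriv_succ]
  exact ((hf.differentiable_iteratedDeriv k (by exact_mod_cast WithTop.coe_lt_top _)) t).hasDerivAt

theorem continuous_iteratedDeriv {f : ℝ → V} (hf : ContDiff ℝ ∞ f) (k : ℕ) :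
    Continuous (iteratedDeriv k f) :=
  hf.continuous_iteratedDeriv k (by exact_mod_cast le_top)

theorem iteratedDeriv_clm_comp (L : V →L[ℝ] W) {f : ℝ → V} (hf : ContDiff ℝ ∞ f) (k : ℕ) (t : ℝ) :
    iteratedDeriv k (fun s => L (f s)) t = L (iteratedDeriv k f t) := by
  induction k generalizing t with
  | zero => simp
  | succ k ih =>
    rw [iteratedDeriv_succ, funext ih]
    exact (L.hasFDerivAt.comp_hasDerivAt t (hasDerivAt_iteratedDeriv hf k t)).deriv

theorem iteratedDeriv_inner {n : ℕ} (l : E n) {f : ℝ → E n} (hf : ContDiff ℝ ∞ f) (k : ℕ) (t : ℝ) :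
    iteratedDeriv k (fun s => inner ℝ l (f s)) t = inner ℝ l (iteratedDeriv k f t) :=
  iteratedDeriv_clm_comp (innerSL ℝ l) hf k t

theorem iteratedDeriv_coord {n : ℕ} {f : ℝ → E n} (hf : ContDiff ℝ ∞ f) (k : ℕ) (t : ℝ)
    (i : Fin n) : iteratedDeriv k (fun s => f s i) t = iteratedDeriv k f t i :=
  iteratedDeriv_clm_comp (EuclideanSpace.proj i : E n →L[ℝ] ℝ) hf k t

theorem contDiff_deriv {f : ℝ → V} (hf : ContDiff ℝ ∞ f) : ContDiff ℝ ∞ (deriv f) :=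
  (contDiff_infty_iff_deriv.1 hf).2

end Derivatives

/-- The quotient is extended to `c` by the Taylor coefficient. Taylor's formula with remainder `o((t
- c) ^ p)` makes it continuous there, and continuity at that single point is all that `IsAdapted`
and `HasZeroOrder` require. -/
theorem exists_eq_pow_mul {f : ℝ → ℝ} (hf : ContDiff ℝ ∞ f) {c : ℝ} {p : ℕ}
    (h0 : ∀ k < p, iteratedDeriv k f c = 0) :
    ∃ h : ℝ → ℝ, ContinuousAt h c ∧ h c = iteratedDeriv p f c / p.factorial ∧
      ∀ t, f t = (t - c) ^ p * h t := by
  set A := iteratedDeriv p f c / p.factorial with hA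
  have htay : ∀ t, taylorWithinEval f p Set.univ c t = (t - c) ^ p * A := by
    intro t
    rw [taylor_within_apply, Finset.sum_range_succ, Finset.sum_eq_zero, zero_add]
    · rw [iteratedDerivWithin_univ, smul_eq_mul, hA]; ring
    · intro k hk
      rw [iteratedDerivWithin_univ, h0 k (Finset.mem_range.1 hk), smul_zero]
  have hlim := Real.taylor_tendsto (f := f) (n := p) convex_univ (Set.mem_univ c)
    (hf.of_le (by exact_mod_cast le_top)).contDiffOn
  rw [nhdsWithin_univ] at hlim
  have hfc : 0 < p → f c = 0 := fun hp => by simpa using h0 0 hp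
  refine ⟨fun t => if t = c then A else f t / (t - c) ^ p, ?_, by simp, fun t => ?_⟩
  · rw [continuousAt_iff_punctured_nhds]
    simp only [if_true]
    have h1 : Tendsto (fun t => (f t - taylorWithinEval f p Set.univ c t) / (t - c) ^ p + A)
        (𝓝[≠] c) (𝓝 A) := by
      simpa using (hlim.mono_left nhdsWithin_le_nhds).add_const A
    refine h1.congr' ?_
    filter_upwards [self_mem_nhdsWithin] with t ht
    have ht' : t ≠ c := ht
    have hp : (t - c) ^ p ≠ 0 := pow_ne_zero _ (sub_ne_zero.2 ht')
    rw [if_neg ht', htay]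
    field_simp
    ring
  · rcases eq_or_ne t c with rfl | ht
    · rcases Nat.eq_zero_or_pos p with rfl | hp
      · simp [hA]
      · simp [hfc hp, hp.ne']
    · have hp : (t - c) ^ p ≠ 0 := pow_ne_zero _ (sub_ne_zero.2 ht)
      simp only [if_neg ht]; field_simp

/-- One zero of the derivative is taken in each gap between consecutive points of `S`. The last
clause, that `R` lies below every strict upper bound of `S`, is what keeps the new zero distinct
from the earlier ones when a maximum is added. -/
theorem exists_rolle_finset {f : ℝ → ℝ} (hf : Continuous f) {α β : ℝ} (S : Finset ℝ)
    (hne : S.Nonempty) (hS : ∀ y ∈ S, y ∈ Set.Icc α β) (hz : ∀ y ∈ S, f y = 0) :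
    ∃ R : Finset ℝ, (∀ y ∈ R, y ∈ Set.Icc α β ∧ deriv f y = 0) ∧ Disjoint S R ∧
      R.card + 1 = S.card ∧ ∀ M, (∀ y ∈ S, y < M) → ∀ y ∈ R, y < M := by
  induction S using Finset.induction_on_max with
  | empty => exact absurd hne Finset.not_nonempty_empty
  | insert a S hmax ih =>
    have haS : a ∉ S := fun h => lt_irrefl _ (hmax a h)
    rcases S.eq_empty_or_nonempty with rfl | hSne
    · exact ⟨∅, by simp, by simp, by simp, by simp⟩
    obtain ⟨R, hR, hdis, hcard, hlt⟩ := ih hSne (fun y hy => hS y (Finset.mem_insert_of_mem hy))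
      (fun y hy => hz y (Finset.mem_insert_of_mem hy))
    set b := S.max' hSne with hb
    have hbS : b ∈ S := S.max'_mem hSne
    have hba : b < a := hmax b hbS
    obtain ⟨c, hc, hc0⟩ := exists_deriv_eq_zero hba hf.continuousOn
      (by rw [hz b (Finset.mem_insert_of_mem hbS), hz a (Finset.mem_insert_self _ _)])
    have hRb : ∀ y ∈ R, y ≤ b := fun y hy => by
      by_contra hcon
      rw [not_le] at hcon
      exact lt_irrefl _ (hlt y (fun z hz' => lt_of_le_of_lt (S.le_max' z hz') hcon) y hy)
    have hcR : c ∉ R := fun h => absurd (hRb c h) (not_le.2 hc.1)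
    have hcS : c ∉ S := fun h => absurd (S.le_max' c h) (not_le.2 hc.1)
    refine ⟨insert c R, ?_, ?_, ?_, ?_⟩
    · intro y hy
      rcases Finset.mem_insert.1 hy with rfl | hy
      · have h1 := hS b (Finset.mem_insert_of_mem hbS)
        have h2 := hS a (Finset.mem_insert_self _ _)
        exact ⟨⟨h1.1.trans hc.1.le, hc.2.le.trans h2.2⟩, hc0⟩
      · exact hR y hy
    · rw [Finset.disjoint_insert_right, Finset.disjoint_insert_left, Finset.mem_insert]
      refine ⟨not_or.2 ⟨hc.2.ne, hcS⟩, fun h => ?_, hdis⟩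
      exact absurd (hRb a h) (not_le.2 hba)
    · rw [Finset.card_insert_of_notMem hcR, Finset.card_insert_of_notMem haS, hcard]
    · intro M hM y hy
      rcases Finset.mem_insert.1 hy with rfl | hy
      · exact hc.2.trans (hM a (Finset.mem_insert_self _ _))
      · exact hlt M (fun z hz' => hM z (Finset.mem_insert_of_mem hz')) y hy

/-- Rolle's theorem with multiplicities: the derivatives of order less than the number of zeros
have a zero as well. -/
theorem exists_iteratedDeriv_eq_zero {α β : ℝ} (j : ℕ) {f : ℝ → ℝ} (hf : ContDiff ℝ ∞ f)
    {S : Finset ℝ} {μ : ℝ → ℕ} (hS : ∀ y ∈ S, y ∈ Set.Icc α β)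
    (hz : ∀ y ∈ S, ∀ k < μ y, iteratedDeriv k f y = 0) (hj : j < ∑ y ∈ S, μ y) :
    ∃ ζ ∈ Set.Icc α β, iteratedDeriv j f ζ = 0 := by
  induction j generalizing f S μ with
  | zero =>
    obtain ⟨y, hy, hμ⟩ : ∃ y ∈ S, μ y ≠ 0 := by
      by_contra! hall
      rw [Finset.sum_eq_zero hall] at hj
      omega
    exact ⟨y, hS y hy, hz y hy 0 (Nat.pos_of_ne_zero hμ)⟩
  | succ j ih =>
    set S₁ := S.filter fun y => μ y ≠ 0 with hS₁
    have hsum : ∑ y ∈ S₁, μ y = ∑ y ∈ S, μ y := Finset.sum_filter_ne_zero S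
    have hS₁S : ∀ y ∈ S₁, y ∈ S ∧ μ y ≠ 0 := fun y hy => by simpa [hS₁] using hy
    have hne : S₁.Nonempty := by
      rw [Finset.nonempty_iff_ne_empty]
      intro h
      rw [h, Finset.sum_empty] at hsum
      omega
    obtain ⟨R, hR, hdis, hcard, -⟩ := exists_rolle_finset hf.continuous S₁ hne
      (fun y hy => hS y (hS₁S y hy).1)
      (fun y hy => by simpa using hz y (hS₁S y hy).1 0 (Nat.pos_of_ne_zero (hS₁S y hy).2))
    have hnotR : ∀ y ∈ S₁, y ∉ R := fun y hy hyR => Finset.disjoint_left.1 hdis hy hyR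
    rw [iteratedDeriv_succ']
    refine ih (f := deriv f) (contDiff_deriv hf) (S := S₁ ∪ R)
      (μ := fun y => if y ∈ R then 1 else μ y - 1) ?_ ?_ ?_
    · intro y hy
      rcases Finset.mem_union.1 hy with hy | hy
      · exact hS y (hS₁S y hy).1
      · exact (hR y hy).1
    · intro y hy k hk
      rcases Finset.mem_union.1 hy with hy | hy
      · simp only [if_neg (hnotR y hy)] at hk
        rw [← iteratedDeriv_succ']
        exact hz y (hS₁S y hy).1 _ (by omega)
      · simp only [if_pos hy, Nat.lt_one_iff] at hk
        subst hk
        simpa using (hR y hy).2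
    -- Each of the old zeros loses one unit of multiplicity and the gaps give back one fewer than
    -- the number of zeros, so the total drops by exactly one.
    · rw [Finset.sum_union hdis, Finset.sum_congr rfl (g := fun y => μ y - 1)
        (fun y hy => by rw [if_neg (hnotR y hy)]), Finset.sum_congr (s₁ := R) rfl (g := fun _ => 1)
        (fun y hy => by rw [if_pos hy]), Finset.sum_const, smul_eq_mul, mul_one]
      have h1 : ∑ y ∈ S₁, (μ y - 1) + S₁.card = ∑ y ∈ S₁, μ y := by
        rw [Finset.card_eq_sum_ones, ← Finset.sum_add_distrib]
        exact Finset.sum_congr rfl fun y hy => by have := (hS₁S y hy).2; omega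
      omega

/-! ### Frames -/

/-- A nondegenerate smooth curve in `ℝⁿ`, which is invariant up to sign under the translation by
the period. -/
structure IsFrame {n : ℕ} (v : ℝ → E n) : Prop where
  smooth : ContDiff ℝ ∞ v
  nondeg : ∀ t, LinearIndependent ℝ fun k : Fin n => iteratedDeriv (k : ℕ) v t
  period : ∃ ε : ℝ, (ε = 1 ∨ ε = -1) ∧ ∀ t, v (t + 1) = ε • v t

/-- Some linear form on the curve has `n` sign changes on an interval shorter than the period. -/
def Alternates {n : ℕ} (v : ℝ → E n) : Prop :=
  ∃ (l : E n) (t : Fin (n + 1) → ℝ), StrictMono t ∧ t (Fin.last n) < t 0 + 1 ∧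
    ∀ i : Fin (n + 1), 0 < (-1) ^ (i : ℕ) * inner ℝ l (v (t i))

/-- The linear forms on a curve. -/
def formSpace {n : ℕ} (v : ℝ → E n) : Submodule ℝ (ℝ → ℝ) :=
  LinearMap.range
    ({ toFun := fun l t => inner ℝ l (v t)
       map_add' := fun x y => by funext t; simp [inner_add_left]
       map_smul' := fun r x => by funext t; simp [inner_smul_left] } : E n →ₗ[ℝ] (ℝ → ℝ))

namespace IsFrame

variable {n : ℕ} {v : ℝ → E n}

theorem exists_basis (hv : IsFrame v) (c : ℝ) :
    ∃ B : Module.Basis (Fin n) ℝ (E n), ∀ k : Fin n, B k = iteratedDeriv (k : ℕ) v c :=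
  ⟨Module.Basis.mk (hv.nondeg c)
    ((hv.nondeg c).span_eq_top_of_card_eq_finrank' (by simp)).ge, fun k => by simp⟩

/-- The adapted functions at `c` come from the basis of forms dual to the derivatives of `v` at `c`:
the derivatives of the j-th one vanish at `c` in orders below j, and the j-th derivative is 1. -/
theorem nondeg_formSpace (hv : IsFrame v) (J : Set ℝ) : Nondeg J n (formSpace v) := by
  intro c _
  obtain ⟨B, hBk⟩ := hv.exists_basis c
  set l : Fin n → E n := fun j =>
    (InnerProductSpace.toDual ℝ (E n)).symm (LinearMap.toContinuousLinearMap (B.coord j)) with hl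
  have hlk : ∀ j k : Fin n, inner ℝ (l j) (iteratedDeriv (k : ℕ) v c) = if k = j then 1 else 0 := by
    intro j k
    rw [hl, InnerProductSpace.toDual_symm_apply, ← hBk]
    simp [Finsupp.single_apply]
  have hex : ∀ j : Fin n, ∃ h : ℝ → ℝ, ContinuousAt h c ∧
      h c = iteratedDeriv (j : ℕ) (fun t => inner ℝ (l j) (v t)) c / (j : ℕ).factorial ∧
      ∀ t, (fun t => inner ℝ (l j) (v t)) t = (t - c) ^ (j : ℕ) * h t := fun j => by
    refine exists_eq_pow_mul (contDiff_const.inner ℝ hv.smooth) fun k hk => ?_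
    have := hlk j ⟨k, hk.trans j.2⟩
    rw [iteratedDeriv_inner _ hv.smooth]
    rw [if_neg (fun h => by simp [Fin.ext_iff] at h; omega)] at this
    exact this
  choose h hc hc' he using hex
  refine ⟨fun j t => inner ℝ (l j) (v t), h, le_antisymm (Submodule.span_le.2 ?_) ?_, hc,
    fun j => ?_, he⟩
  · rintro _ ⟨j, rfl⟩
    exact ⟨l j, rfl⟩
  · rintro _ ⟨x, rfl⟩
    have hx : x = ∑ j : Fin n, inner ℝ x (iteratedDeriv (j : ℕ) v c) • l j := by
      refine InnerProductSpace.ext_inner_right_basis B fun k => ?_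
      rw [hBk, sum_inner]
      simp_rw [inner_smul_left, hlk]
      simp
    have : (fun t => inner ℝ x (v t)) =
        ∑ j : Fin n, inner ℝ x (iteratedDeriv (j : ℕ) v c) • fun t => inner ℝ (l j) (v t) := by
      funext t
      conv_lhs => rw [hx]
      rw [sum_inner, Finset.sum_apply]
      simp [inner_smul_left]
    change (fun t => inner ℝ x (v t)) ∈ _
    rw [this]
    exact Submodule.sum_mem _ fun j _ => Submodule.smul_mem _ _ (Submodule.subset_span ⟨j, rfl⟩)
  · rw [hc', iteratedDeriv_inner _ hv.smooth, hlk, if_pos rfl]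
    positivity

theorem eq_zero_of_zeros (hn : 1 ≤ n) (hv : IsFrame v) (ha : ¬ Alternates v) {l : E n}
    {S : Finset ℝ} {μ : ℝ → ℕ} (hS : ∀ y ∈ S, y ∈ Set.Ico (0 : ℝ) 1)
    (hz : ∀ y ∈ S, ∀ k < μ y, inner ℝ l (iteratedDeriv k v y) = 0) (hm : n ≤ ∑ y ∈ S, μ y) :
    l = 0 := by
  have hSne : S.Nonempty := by
    rw [Finset.nonempty_iff_ne_empty]; rintro rfl; simp at hm; omega
  set M := S.max' hSne with hM
  have hM1 : M < 1 := (hS M (S.max'_mem hSne)).2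
  have hf : (fun t => inner ℝ l (v t)) = 0 := by
    -- The zeros are finitely many in `[0, 1)`, with maximum `M < 1`, so an open interval of length
    -- exactly 1 contains them all. Points of such an interval span less than a period, as
    -- `Alternates` demands.
    refine OperCurve.eq_zero_of_zeros (J := Set.Ioo (-(1 - M) / 2) (1 - (1 - M) / 2)) isOpen_Ioo
      ⟨0, by constructor <;> linarith [(hS M (S.max'_mem hSne)).1]⟩ (hv.nondeg_formSpace _) ?_
      ⟨l, rfl⟩ (S := S) (μ := μ) ?_ ?_ hm
    · rintro _ ⟨l', rfl⟩ s hs hsJ halt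
      refine ha ⟨l', s, hs, ?_, halt⟩
      have h1 := (hsJ (Fin.last n)).2
      have h2 := (hsJ 0).1
      linarith
    · intro y hy
      have h1 := S.le_max' y hy
      have h2 := (hS y hy).1
      constructor <;> linarith
    · intro y hy
      obtain ⟨h, h1, -, h3⟩ := exists_eq_pow_mul (f := fun t => inner ℝ l (v t))
        (contDiff_const.inner ℝ hv.smooth) (c := y) (p := μ y)
        fun k hk => by rw [iteratedDeriv_inner _ hv.smooth]; exact hz y hy k hk
      exact ⟨h, h1, h3⟩
  obtain ⟨B, hB⟩ := hv.exists_basis 0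
  refine InnerProductSpace.ext_inner_right_basis B fun k => ?_
  rw [inner_zero_left, hB, ← iteratedDeriv_inner _ hv.smooth, hf]
  change iteratedDeriv _ (fun _ => (0 : ℝ)) _ = 0
  simp

end IsFrame

/-! ### The Frenet property -/

/-- The osculating subspaces of a smooth curve. -/
def osc {n : ℕ} (v : ℝ → E n) (t : ℝ) (p : ℕ) : Submodule ℝ (E n) :=
  Submodule.span ℝ (Set.range fun k : Fin p => iteratedDeriv (k : ℕ) v t)

theorem osc_mono {n : ℕ} (v : ℝ → E n) (t : ℝ) {p q : ℕ} (h : p ≤ q) : osc v t p ≤ osc v t q := by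
  refine Submodule.span_mono ?_
  rintro _ ⟨k, rfl⟩
  exact ⟨Fin.castLE h k, rfl⟩

theorem trace_starProjection {n : ℕ} (W : Submodule ℝ (E n)) :
    LinearMap.trace ℝ (E n) (W.starProjection : E n →ₗ[ℝ] E n) = Module.finrank ℝ W := by
  refine LinearMap.IsProj.trace ⟨fun x => by simp, fun x hx => ?_⟩
  exact Submodule.starProjection_eq_self_iff.2 hx

/-- A limit of orthogonal projections of rank `dim V` which fixes `V` is the projection to `V`. -/
theorem eq_starProjection_of_tendsto {n : ℕ} {ι : Type*} {G : Filter ι} [G.NeBot]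
    {W : ι → Submodule ℝ (E n)} {V : Submodule ℝ (E n)} {A : E n →L[ℝ] E n}
    (hA : Tendsto (fun y => (W y).starProjection) G (𝓝 A))
    (hW : ∀ᶠ y in G, Module.finrank ℝ (W y) = Module.finrank ℝ V)
    (hV : ∀ u, u - A u ∈ Vᗮ) : A = V.starProjection := by
  have happ : ∀ u, Tendsto (fun y => (W y).starProjection u) G (𝓝 (A u)) := fun u =>
    ((ContinuousLinearMap.apply ℝ (E n) u).continuous.tendsto A).comp hA
  -- Symmetry, idempotence and trace pass to the limit. Symmetry turns `u - A u ∈ Vᗮ` into `A = id`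
  -- on `V`, and the trace shows that the range of `A` is no larger than `V`.
  have hsymm : ∀ u w, inner ℝ (A u) w = inner ℝ u (A w) := fun u w => by
    refine tendsto_nhds_unique ((happ u).inner tendsto_const_nhds) ?_
    refine (Tendsto.inner tendsto_const_nhds (happ w)).congr fun y => ?_
    exact ((W y).inner_starProjection_left_eq_right u w).symm
  have hidem : A * A = A := by
    refine tendsto_nhds_unique (hA.mul hA) (hA.congr fun y => ?_)
    exact ((W y).isIdempotentElem_starProjection).symm
  have htr : LinearMap.trace ℝ (E n) (A : E n →ₗ[ℝ] E n) = Module.finrank ℝ V := by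
    have hc : Continuous fun B : E n →L[ℝ] E n => LinearMap.trace ℝ (E n) (B : E n →ₗ[ℝ] E n) :=
      LinearMap.continuous_of_finiteDimensional
        ((LinearMap.trace ℝ (E n)).comp (ContinuousLinearMap.coeLM ℝ))
    refine tendsto_nhds_unique ((hc.tendsto A).comp hA) (tendsto_const_nhds.congr' ?_)
    filter_upwards [hW] with y hy
    simp only [Function.comp]
    rw [trace_starProjection, hy]
  have hfix : ∀ w ∈ V, A w = w := fun w hw => by
    refine ext_inner_left ℝ fun u => ?_
    have := (Submodule.mem_orthogonal' _ _).1 (hV u) w hw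
    rw [inner_sub_left, hsymm] at this
    linarith
  have hle : V ≤ LinearMap.range (A : E n →ₗ[ℝ] E n) := fun w hw => ⟨w, hfix w hw⟩
  have hidem' : ∀ u, A (A u) = A u := fun u => by
    simpa using congrArg (fun B : E n →L[ℝ] E n => B u) hidem
  have hproj : LinearMap.IsProj (LinearMap.range (A : E n →ₗ[ℝ] E n)) (A : E n →ₗ[ℝ] E n) :=
    ⟨fun x => ⟨x, rfl⟩, by rintro _ ⟨x, rfl⟩; exact hidem' x⟩
  have hdim : Module.finrank ℝ V = Module.finrank ℝ (LinearMap.range (A : E n →ₗ[ℝ] E n)) := by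
    have := hproj.trace
    rw [htr] at this
    exact_mod_cast this
  have hrange := Submodule.eq_of_le_of_finrank_eq hle hdim
  ext1 u
  refine (Submodule.eq_starProjection_of_mem_orthogonal ?_ (hV u)).symm
  rw [hrange]
  exact ⟨u, rfl⟩

/-- A representative in `[0, 1)`. -/
def rep (x : UnitAddCircle) : ℝ := AddCircle.equivIco 1 0 x

theorem coe_rep (x : UnitAddCircle) : (rep x : UnitAddCircle) = x := AddCircle.coe_equivIco

theorem rep_mem (x : UnitAddCircle) : rep x ∈ Set.Ico (0 : ℝ) 1 := by
  simpa [rep] using (AddCircle.equivIco 1 0 x).2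

theorem rep_injective : Function.Injective rep := fun x y h => by
  rw [← coe_rep x, h, coe_rep]

namespace IsFrame

variable {n : ℕ} {v : ℝ → E n}

open Pointwise in
theorem osc_add_one (hv : IsFrame v) (t : ℝ) (p : ℕ) : osc v (t + 1) p = osc v t p := by
  obtain ⟨ε, hε, hp⟩ := hv.period
  have hε0 : IsUnit ε := by rcases hε with rfl | rfl <;> simp
  have : ∀ k, iteratedDeriv k v (t + 1) = ε • iteratedDeriv k v t := fun k => by
    rw [← iteratedDeriv_comp_add, funext hp, iteratedDeriv_fun_const_smul_field]
  unfold osc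
  simp_rw [this]
  have hr : (Set.range fun k : Fin p => ε • iteratedDeriv (k : ℕ) v t) =
      ε • Set.range fun k : Fin p => iteratedDeriv (k : ℕ) v t := by
    rw [← Set.image_smul, ← Set.range_comp]; rfl
  rw [hr, Submodule.span_smul_eq_of_isUnit _ _ hε0]

/-- The osculating flag curve on the circle. -/
def flag (hv : IsFrame v) (x : UnitAddCircle) (p : ℕ) : Submodule ℝ (E n) :=
  Function.Periodic.lift (c := (1 : ℝ)) (f := fun t => osc v t p) (fun t => hv.osc_add_one t p) x

theorem flag_coe (hv : IsFrame v) (t : ℝ) (p : ℕ) : hv.flag (t : UnitAddCircle) p = osc v t p :=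
  Function.Periodic.lift_coe _ t

theorem finrank_osc (hv : IsFrame v) (t : ℝ) {p : ℕ} (hp : p ≤ n) :
    Module.finrank ℝ (osc v t p) = p := by
  have h : LinearIndependent ℝ fun k : Fin p => iteratedDeriv (k : ℕ) v t :=
    (hv.nondeg t).comp (Fin.castLE hp) (Fin.castLE_injective hp)
  exact (finrank_span_eq_card h).trans (by simp)

theorem flag_eq_rep (hv : IsFrame v) (x : UnitAddCircle) (p : ℕ) :
    hv.flag x p = osc v (rep x) p := by rw [← hv.flag_coe, coe_rep]

theorem isFlagCurve (hv : IsFrame v) : IsFlagCurve hv.flag := by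
  refine ⟨fun x p hp => ?_, fun x p q hpq _ => ?_⟩
  · rw [hv.flag_eq_rep]; exact hv.finrank_osc _ hp
  · rw [hv.flag_eq_rep, hv.flag_eq_rep]; exact osc_mono v _ hpq

/-- When the multiplicities add up to n, a vector orthogonal to all these derivatives is a form with
n zeros counted with multiplicity, hence zero. So the derivatives span, and there are n of them. -/
theorem linearIndependent_sigma (hn : 1 ≤ n) (hv : IsFrame v) (ha : ¬ Alternates v) {ι : Type}
    [Fintype ι] {y : ι → ℝ} (hy : Function.Injective y) (hy01 : ∀ i, y i ∈ Set.Ico (0 : ℝ) 1)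
    {m : ι → ℕ} (hm : ∑ i, m i ≤ n) :
    LinearIndependent ℝ fun σ : Σ i, Fin (m i) => iteratedDeriv (σ.2 : ℕ) v (y σ.1) := by
  classical
  have key : ∀ m : ι → ℕ, ∑ i, m i = n →
      LinearIndependent ℝ fun σ : Σ i, Fin (m i) => iteratedDeriv (σ.2 : ℕ) v (y σ.1) := by
    intro m hm
    refine linearIndependent_of_top_le_span_of_card_eq_finrank ?_ (by simp [hm])
    rw [top_le_iff, ← Submodule.orthogonal_eq_bot_iff, Submodule.eq_bot_iff]
    intro l hl
    rw [Submodule.mem_orthogonal'] at hl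
    refine hv.eq_zero_of_zeros hn ha (S := Finset.univ.image y) (μ := Function.extend y m 0)
      ?_ ?_ ?_
    · intro t ht
      obtain ⟨i, -, rfl⟩ := Finset.mem_image.1 ht
      exact hy01 i
    · intro t ht k hk
      obtain ⟨i, -, rfl⟩ := Finset.mem_image.1 ht
      rw [hy.extend_apply] at hk
      exact hl _ (Submodule.subset_span ⟨⟨i, ⟨k, hk⟩⟩, rfl⟩)
    · rw [Finset.sum_image hy.injOn]
      simp_rw [hy.extend_apply]
      exact hm.ge
  rcases isEmpty_or_nonempty ι with h | ⟨⟨i₀⟩⟩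
  · exact linearIndependent_empty_type
  -- Smaller families are completed by raising the multiplicity at one point until the total is n.
  set m' := Function.update m i₀ (m i₀ + (n - ∑ i, m i)) with hm'
  have hle : ∀ i, m i ≤ m' i := fun i => by
    rcases eq_or_ne i i₀ with rfl | hi
    · rw [hm', Function.update_self]; omega
    · rw [hm', Function.update_of_ne hi]
  have hsum : ∑ i, m' i = n := by
    rw [hm', Finset.sum_update_of_mem (Finset.mem_univ _)]
    have := Finset.add_sum_erase Finset.univ m (Finset.mem_univ i₀)
    rw [← Finset.sdiff_singleton_eq_erase] at this
    omega
  refine (key m' hsum).comp (fun σ : Σ i, Fin (m i) => ⟨σ.1, Fin.castLE (hle σ.1) σ.2⟩) ?_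
  rintro ⟨i, k⟩ ⟨j, k'⟩ h
  simp only [Sigma.mk.injEq] at h
  obtain ⟨rfl, h⟩ := h
  simpa using h

theorem iSup_osc {ι : Type} (y : ι → ℝ) (m : ι → ℕ) :
    ⨆ i, osc v (y i) (m i) = Submodule.span ℝ (Set.range
      fun σ : Σ i, Fin (m i) => iteratedDeriv (σ.2 : ℕ) v (y σ.1)) := by
  refine le_antisymm (iSup_le fun i => Submodule.span_mono ?_) (Submodule.span_le.2 ?_)
  · rintro _ ⟨k, rfl⟩; exact ⟨⟨i, k⟩, rfl⟩
  · rintro _ ⟨⟨i, k⟩, rfl⟩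
    exact Submodule.mem_iSup_of_mem i (Submodule.subset_span ⟨k, rfl⟩)

theorem iSupIndep_osc (hn : 1 ≤ n) (hv : IsFrame v) (ha : ¬ Alternates v) {ι : Type}
    [Fintype ι] {y : ι → ℝ} (hy : Function.Injective y) (hy01 : ∀ i, y i ∈ Set.Ico (0 : ℝ) 1)
    {m : ι → ℕ} (hm : ∑ i, m i ≤ n) : iSupIndep fun i => osc v (y i) (m i) := by
  have hli := hv.linearIndependent_sigma hn ha hy hy01 hm
  intro i
  have hd := hli.disjoint_span_image (s := {σ | σ.1 = i}) (t := {σ | σ.1 ≠ i})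
    (Set.disjoint_left.2 fun σ h h' => h' h)
  refine hd.mono (Submodule.span_mono ?_) (iSup₂_le fun j hj => Submodule.span_mono ?_)
  · rintro _ ⟨k, rfl⟩; exact ⟨⟨i, k⟩, rfl, rfl⟩
  · rintro _ ⟨k, rfl⟩; exact ⟨⟨j, k⟩, hj, rfl⟩

theorem finrank_iSup_osc (hn : 1 ≤ n) (hv : IsFrame v) (ha : ¬ Alternates v) {ι : Type}
    [Fintype ι] {y : ι → ℝ} (hy : Function.Injective y) (hy01 : ∀ i, y i ∈ Set.Ico (0 : ℝ) 1)
    {m : ι → ℕ} (hm : ∑ i, m i ≤ n) :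
    Module.finrank ℝ (⨆ i, osc v (y i) (m i) : Submodule ℝ (E n)) = ∑ i, m i := by
  rw [iSup_osc, finrank_span_eq_card (hv.linearIndependent_sigma hn ha hy hy01 hm)]
  simp

set_option maxHeartbeats 400000 in
-- Projections lie in a compact ball, so along an ultrafilter they have a limit `B`, to be
-- identified by `eq_starProjection_of_tendsto`. The form `u - A y u` vanishes along the curve to
-- order `m i` at each `y i`. By Rolle's theorem its derivatives of order less than `∑ i, m i`
-- vanish somewhere near `x`, and in the limit `u - B u` is orthogonal to the osculating space at
-- `x`.
theorem tendsto_flag (hn : 1 ≤ n) (hv : IsFrame v) (ha : ¬ Alternates v) (l : ℕ)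
    (x : UnitAddCircle) (m : Fin l → ℕ) (hm : ∑ i, m i ≤ n) :
    Tendsto (fun y : Fin l → UnitAddCircle => (⨆ i, hv.flag (y i) (m i)).starProjection)
      (𝓝[{y | Function.Injective y}] fun _ => x) (𝓝 (hv.flag x (∑ i, m i)).starProjection) := by
  rw [tendsto_iff_ultrafilter]
  intro G hG
  have hinj : ∀ᶠ y : Fin l → UnitAddCircle in G, Function.Injective y :=
    hG (eventually_mem_nhdsWithin (s := {y : Fin l → UnitAddCircle | Function.Injective y}))
  have hGx : (G : Filter _) ≤ 𝓝 fun _ : Fin l => x := hG.trans nhdsWithin_le_nhds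
  set A : (Fin l → UnitAddCircle) → E n →L[ℝ] E n :=
    fun y => (⨆ i, hv.flag (y i) (m i)).starProjection with hA
  have hball : ∀ y, A y ∈ Metric.closedBall (0 : E n →L[ℝ] E n) 1 := fun y => by
    rw [mem_closedBall_zero_iff]
    exact Submodule.starProjection_norm_le _
  have hprin : Tendsto A G (𝓟 (Metric.closedBall (0 : E n →L[ℝ] E n) 1)) :=
    tendsto_principal.2 (Eventually.of_forall hball)
  obtain ⟨B, -, hB⟩ := (isCompact_closedBall (0 : E n →L[ℝ] E n) 1).ultrafilter_le_nhds (G.map A)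
    hprin
  have hAB : Tendsto A G (𝓝 B) := hB
  suffices h : B = (hv.flag x (∑ i, m i)).starProjection by rw [← h]; exact hAB
  set t₀ := rep x with ht₀
  -- Representatives are taken in an interval centred at `t₀`, so that the choice is continuous at
  -- `x`, even when `x` is the class of 0.
  set r : UnitAddCircle → ℝ := fun y => AddCircle.equivIco 1 (t₀ - 1 / 2) y with hr
  have hrc : ∀ y, (r y : UnitAddCircle) = y := fun y => AddCircle.coe_equivIco
  have hrx : r x = t₀ := by
    have : t₀ ∈ Set.Ico (t₀ - 1 / 2) (t₀ - 1 / 2 + 1) := by constructor <;> linarith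
    have h := AddCircle.equivIco_coe_of_mem (p := (1 : ℝ)) (a := t₀ - 1 / 2) this
    rw [ht₀, coe_rep, ← ht₀] at h
    simp only [hr, h]
  have hrcont : ContinuousAt r x := by
    refine continuous_subtype_val.continuousAt.comp (AddCircle.continuousAt_equivIco 1 _ ?_)
    intro h
    have h2 : (t₀ : UnitAddCircle) = ((t₀ - 1 / 2 : ℝ) : UnitAddCircle) := by
      rw [← h, ht₀, coe_rep]
    have h3 : r (t₀ : UnitAddCircle) = t₀ - 1 / 2 := by
      rw [h2]
      have : t₀ - 1 / 2 ∈ Set.Ico (t₀ - 1 / 2) (t₀ - 1 / 2 + 1) := by constructor <;> linarith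
      simp only [hr, AddCircle.equivIco_coe_of_mem (p := (1 : ℝ)) this]
    have h4 : (t₀ : UnitAddCircle) = x := by rw [ht₀, coe_rep]
    rw [h4, hrx] at h3
    linarith
  have hrinj : Function.Injective r := fun a b h => by rw [← hrc a, h, hrc]
  have hflag : ∀ y p, hv.flag y p = osc v (r y) p := fun y p => by rw [← hv.flag_coe, hrc]
  refine eq_starProjection_of_tendsto hAB ?_ fun u => ?_
  · filter_upwards [hinj] with y hy
    have h1 : ∀ i, hv.flag (y i) (m i) = osc v (rep (y i)) (m i) := fun i => hv.flag_eq_rep _ _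
    rw [hv.isFlagCurve.1 x _ hm, iSup_congr h1]
    exact hv.finrank_iSup_osc hn ha (rep_injective.comp hy) (fun i => rep_mem _) hm
  · rw [hflag, hrx, Submodule.mem_orthogonal']
    intro w hw
    induction hw using Submodule.span_induction with
    | zero => simp
    | add a b _ _ ha hb => rw [inner_add_right, ha, hb, add_zero]
    | smul c a _ ha => rw [inner_smul_right, ha, mul_zero]
    | mem w hw =>
      obtain ⟨j, rfl⟩ := hw
      by_contra hne
      have hcont : ContinuousAt (fun q : (E n →L[ℝ] E n) × ℝ =>
          inner ℝ (u - q.1 u) (iteratedDeriv (j : ℕ) v q.2)) (B, t₀) := by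
        have := continuous_iteratedDeriv hv.smooth j
        fun_prop
      have hev := hcont.eventually_ne hne
      rw [nhds_prod_eq, eventually_prod_iff] at hev
      obtain ⟨pa, hpa, pb, hpb, hab⟩ := hev
      obtain ⟨δ, hδ, hδb⟩ := Metric.eventually_nhds_iff.1 hpb
      have hnear : ∀ᶠ y : Fin l → UnitAddCircle in G,
          ∀ i, r (y i) ∈ Set.Icc (t₀ - δ / 2) (t₀ + δ / 2) := by
        refine hGx (eventually_all.2 fun i => ?_)
        have h1 : Tendsto (fun y : Fin l → UnitAddCircle => r (y i)) (𝓝 fun _ => x) (𝓝 t₀) := by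
          rw [← hrx]
          exact hrcont.tendsto.comp (continuous_apply i).continuousAt.tendsto
        exact h1.eventually (Icc_mem_nhds (by linarith) (by linarith))
      obtain ⟨y, hy, hypa, hynear⟩ := (hinj.and ((hAB.eventually hpa).and hnear)).exists
      have hri : Function.Injective fun i => r (y i) := hrinj.comp hy
      obtain ⟨ζ, hζ, hζ0⟩ := exists_iteratedDeriv_eq_zero (j : ℕ)
        (f := fun t => inner ℝ (u - A y u) (v t)) (contDiff_const.inner ℝ hv.smooth)
        (S := Finset.univ.image fun i => r (y i))
        (μ := Function.extend (fun i => r (y i)) m 0) (α := t₀ - δ / 2) (β := t₀ + δ / 2)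
        (by
          intro t ht
          obtain ⟨i, -, rfl⟩ := Finset.mem_image.1 ht
          exact hynear i)
        (by
          intro t ht k hk
          obtain ⟨i, -, rfl⟩ := Finset.mem_image.1 ht
          rw [hri.extend_apply] at hk
          rw [iteratedDeriv_inner _ hv.smooth]
          rw [hA]
          refine Submodule.starProjection_inner_eq_zero _ _
            (Submodule.mem_iSup_of_mem i ?_)
          rw [hflag]
          exact Submodule.subset_span ⟨⟨k, hk⟩, rfl⟩)
        (by
          rw [Finset.sum_image hri.injOn]
          simp_rw [hri.extend_apply]
          exact j.2)
      rw [iteratedDeriv_inner _ hv.smooth] at hζ0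
      refine hab hypa (hδb ?_) hζ0
      rw [Real.dist_eq, abs_lt]
      constructor <;> linarith [hζ.1, hζ.2]

theorem isFrenet (hn : 1 ≤ n) (hv : IsFrame v) (ha : ¬ Alternates v)
    {ξ : UnitAddCircle → Projectivization ℝ (E n)} (hξ : IsLift ξ v) : IsFrenet ξ := by
  refine ⟨hv.flag, hv.isFlagCurve, fun x => ?_, fun l x m hx _ hm => ?_, fun l x m _ hm =>
    hv.tendsto_flag hn ha l x m hm⟩
  · obtain ⟨h0, h⟩ := hξ.2 (rep x)
    rw [coe_rep] at h
    rw [hv.flag_eq_rep, h, Projectivization.submodule_mk, osc]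
    simp
  · simp_rw [hv.flag_eq_rep]
    exact hv.iSupIndep_osc hn ha (rep_injective.comp hx) (fun i => rep_mem _) hm

end IsFrame

open Filter Set

/-! ### Jointly continuous jets -/

section JetCont

variable {X Y : Type*} [TopologicalSpace X] [TopologicalSpace Y]
variable {V W Z : Type*} [NormedAddCommGroup V] [NormedSpace ℝ V] [NormedAddCommGroup W]
  [NormedSpace ℝ W] [NormedAddCommGroup Z] [NormedSpace ℝ Z]

/-- The derivatives of order at most `k` of the functions `f x` of one real variable exist and are
jointly continuous on `U`. -/
def JetCont : ℕ → (X → ℝ → V) → Set (X × ℝ) → Prop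
  | 0, f, U => ContinuousOn (fun p : X × ℝ => f p.1 p.2) U
  | k + 1, f, U => ContinuousOn (fun p : X × ℝ => f p.1 p.2) U ∧
      (∀ p ∈ U, DifferentiableAt ℝ (f p.1) p.2) ∧ JetCont k (fun x => deriv (f x)) U

/-- All derivatives of the functions `f x` exist and are jointly continuous on `U`. -/
def JetSmooth (f : X → ℝ → V) (U : Set (X × ℝ)) : Prop := ∀ k, JetCont k f U

variable {f g : X → ℝ → V} {U : Set (X × ℝ)} {k : ℕ}

theorem JetCont.continuousOn (h : JetCont k f U) : ContinuousOn (fun p : X × ℝ => f p.1 p.2) U := by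
  cases k with
  | zero => exact h
  | succ k => exact h.1

theorem JetCont.of_succ (h : JetCont (k + 1) f U) : JetCont k f U := by
  induction k generalizing f with
  | zero => exact h.1
  | succ k ih => exact ⟨h.1, h.2.1, ih h.2.2⟩

theorem JetCont.mono_set {U' : Set (X × ℝ)} (h : JetCont k f U) (hU : U' ⊆ U) : JetCont k f U' := by
  induction k generalizing f with
  | zero => exact ContinuousOn.mono h hU
  | succ k ih => exact ⟨h.1.mono hU, fun p hp => h.2.1 p (hU hp), ih h.2.2⟩

theorem eventually_slice (hU : IsOpen U) {p : X × ℝ} (hp : p ∈ U) : ∀ᶠ t in 𝓝 p.2, (p.1, t) ∈ U :=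
  (Continuous.prodMk_right p.1).continuousAt.eventually (hU.mem_nhds hp)

theorem JetCont.congr (hU : IsOpen U) (h : JetCont k f U) (he : ∀ p ∈ U, g p.1 p.2 = f p.1 p.2) :
    JetCont k g U := by
  induction k generalizing f g with
  | zero => exact ContinuousOn.congr h he
  | succ k ih =>
    have hev : ∀ p ∈ U, g p.1 =ᶠ[𝓝 p.2] f p.1 := fun p hp => by
      filter_upwards [eventually_slice hU hp] with t ht using he (p.1, t) ht
    exact ⟨h.1.congr he, fun p hp => (h.2.1 p hp).congr_of_eventuallyEq (hev p hp),
      ih h.2.2 fun p hp => (hev p hp).deriv_eq⟩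

/-- Needed because the normalized lifts of a family of curves are constructed only locally in the
parameter and in time. -/
theorem JetCont.of_locally (h : ∀ p : X × ℝ, ∃ U, IsOpen U ∧ p ∈ U ∧ JetCont k f U) :
    JetCont k f univ := by
  have hc : ContinuousOn (fun p : X × ℝ => f p.1 p.2) univ := fun p _ => by
    obtain ⟨U, hU, hp, hf⟩ := h p
    exact (hf.continuousOn.continuousAt (hU.mem_nhds hp)).continuousWithinAt
  induction k generalizing f with
  | zero => exact hc
  | succ k ih =>
    have h' : ∀ p : X × ℝ, ∃ U, IsOpen U ∧ p ∈ U ∧ JetCont k (fun x => deriv (f x)) U := fun p => by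
      obtain ⟨U, hU, hp, hf⟩ := h p
      exact ⟨U, hU, hp, hf.2.2⟩
    refine ⟨hc, fun p _ => ?_, ih h' fun p _ => ?_⟩
    · obtain ⟨U, hU, hp, hf⟩ := h p
      exact hf.2.1 p hp
    · obtain ⟨U, hU, hp, hf⟩ := h' p
      exact (hf.continuousOn.continuousAt (hU.mem_nhds hp)).continuousWithinAt

theorem JetCont.add (hU : IsOpen U) (hf : JetCont k f U) (hg : JetCont k g U) :
    JetCont k (fun x t => f x t + g x t) U := by
  induction k generalizing f g with
  | zero => exact ContinuousOn.add hf hg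
  | succ k ih =>
    exact ⟨hf.1.add hg.1, fun p hp => (hf.2.1 p hp).add (hg.2.1 p hp),
      (ih hf.2.2 hg.2.2).congr hU fun p hp => deriv_fun_add (hf.2.1 p hp) (hg.2.1 p hp)⟩

theorem JetCont.const (c : X → V) (hc : Continuous c) : JetCont k (fun x _ => c x) U := by
  induction k generalizing c with
  | zero => exact (hc.comp continuous_fst).continuousOn
  | succ k ih =>
    refine ⟨(hc.comp continuous_fst).continuousOn, fun p _ => differentiableAt_const _, ?_⟩
    simp only [deriv_const']
    exact ih _ continuous_const

theorem JetCont.sum (hU : IsOpen U) {ι : Type*} (s : Finset ι) {F : ι → X → ℝ → V}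
    (h : ∀ i ∈ s, JetCont k (F i) U) : JetCont k (fun x t => ∑ i ∈ s, F i x t) U := by
  classical
  induction s using Finset.induction_on with
  | empty => simpa using JetCont.const (fun _ : X => (0 : V)) continuous_const
  | insert a s ha ih =>
    simp only [Finset.sum_insert ha]
    exact (h a (by simp)).add hU (ih fun i hi => h i (by simp [hi]))

theorem JetCont.bilin (hU : IsOpen U) (B : V →L[ℝ] W →L[ℝ] Z) {g : X → ℝ → W} (hf : JetCont k f U)
    (hg : JetCont k g U) : JetCont k (fun x t => B (f x t) (g x t)) U := by
  induction k generalizing f g with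
  | zero => exact (B.continuous.comp_continuousOn hf).clm_apply hg
  | succ k ih =>
    refine ⟨(B.continuous.comp_continuousOn hf.1).clm_apply hg.1, fun p hp => ?_, ?_⟩
    · exact (B.hasDerivAt_of_bilinear (fun _ => (hf.2.1 p hp).hasDerivAt)
        fun _ => (hg.2.1 p hp).hasDerivAt).differentiableAt
    · exact ((ih hf.of_succ hg.2.2).add hU (ih hf.2.2 hg.of_succ)).congr hU fun p hp =>
        B.deriv_of_bilinear (fun _ => hf.2.1 p hp) fun _ => hg.2.1 p hp

theorem JetCont.clm (hU : IsOpen U) (L : V →L[ℝ] W) (hf : JetCont k f U) :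
    JetCont k (fun x t => L (f x t)) U := by
  induction k generalizing f with
  | zero => exact L.continuous.comp_continuousOn hf
  | succ k ih =>
    exact ⟨L.continuous.comp_continuousOn hf.1, fun p hp =>
      (L.hasFDerivAt.comp_hasDerivAt p.2 (hf.2.1 p hp).hasDerivAt).differentiableAt,
      (ih hf.2.2).congr hU fun p hp =>
        (L.hasFDerivAt.comp_hasDerivAt p.2 (hf.2.1 p hp).hasDerivAt).deriv⟩

theorem JetCont.smul (hU : IsOpen U) {a : X → ℝ → ℝ} (ha : JetCont k a U) (hf : JetCont k f U) :
    JetCont k (fun x t => a x t • f x t) U :=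
  ha.bilin hU (ContinuousLinearMap.lsmul ℝ ℝ) hf

theorem JetCont.mul (hU : IsOpen U) {a b : X → ℝ → ℝ} (ha : JetCont k a U) (hb : JetCont k b U) :
    JetCont k (fun x t => a x t * b x t) U := ha.smul hU hb

theorem JetCont.prod (hU : IsOpen U) {ι : Type*} (s : Finset ι) {F : ι → X → ℝ → ℝ}
    (h : ∀ i ∈ s, JetCont k (F i) U) : JetCont k (fun x t => ∏ i ∈ s, F i x t) U := by
  classical
  induction s using Finset.induction_on with
  | empty => simpa using JetCont.const (fun _ : X => (1 : ℝ)) continuous_const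
  | insert a s ha ih =>
    simp only [Finset.prod_insert ha]
    exact (h a (by simp)).mul hU (ih fun i hi => h i (by simp [hi]))

/-- The outer function is smooth only on an open set since it will be an inverse or a real power,
singular at 0. -/
theorem JetCont.comp (hU : IsOpen U) {S : Set ℝ} (hS : IsOpen S) {φ : ℝ → ℝ}
    (hφ : ContDiffOn ℝ ∞ φ S) {a : X → ℝ → ℝ} (ha : JetCont k a U) (hm : ∀ p ∈ U, a p.1 p.2 ∈ S) :
    JetCont k (fun x t => φ (a x t)) U := by
  induction k generalizing φ with
  | zero => exact hφ.continuousOn.comp ha hm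
  | succ k ih =>
    have hd : ∀ p ∈ U, HasDerivAt (fun t => φ (a p.1 t))
        (deriv φ (a p.1 p.2) * deriv (a p.1) p.2) p.2 := fun p hp => by
      have := ((hφ.differentiableOn (by simp)).differentiableAt
        (hS.mem_nhds (hm p hp))).hasDerivAt
      exact this.comp p.2 (ha.2.1 p hp).hasDerivAt
    refine ⟨hφ.continuousOn.comp ha.1 hm, fun p hp => (hd p hp).differentiableAt, ?_⟩
    exact ((ih (hφ.deriv_of_isOpen hS (by simp)) ha.of_succ).mul hU ha.2.2).congr hU
      fun p hp => (hd p hp).deriv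

theorem JetSmooth.deriv (h : JetSmooth f U) : JetSmooth (fun x => deriv (f x)) U :=
  fun k => (h (k + 1)).2.2

theorem JetSmooth.iteratedDeriv (h : JetSmooth f U) (i : ℕ) :
    JetSmooth (fun x => iteratedDeriv i (f x)) U := by
  induction i generalizing f with
  | zero => simpa only [iteratedDeriv_zero] using h
  | succ i ih => simpa only [iteratedDeriv_succ'] using ih h.deriv

theorem JetSmooth.contDiff (h : JetSmooth f univ) (x : X) : ContDiff ℝ ∞ (f x) := by
  rw [contDiff_infty]
  intro k
  induction k generalizing f with
  | zero =>
    exact contDiff_zero.2 (((h 0).continuousOn.comp_continuous (Continuous.prodMk_right x)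
      fun _ => mem_univ _))
  | succ k ih =>
    have : ((k + 1 : ℕ) : WithTop ℕ∞) = (k : WithTop ℕ∞) + 1 := by norm_cast
    rw [this, contDiff_succ_iff_deriv]
    exact ⟨fun t => (h 1).2.1 (x, t) (mem_univ _), by simp, ih h.deriv⟩

theorem JetSmooth.continuous_iteratedDeriv (h : JetSmooth f univ) (k : ℕ) :
    Continuous fun p : X × ℝ => _root_.iteratedDeriv k (f p.1) p.2 := by
  have := (h.iteratedDeriv k 0).continuousOn
  rwa [continuousOn_univ] at this

theorem jetSmooth_of_continuous (hf : ∀ x, ContDiff ℝ ∞ (f x))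
    (hc : ∀ k, Continuous fun p : X × ℝ => iteratedDeriv k (f p.1) p.2) : JetSmooth f univ := by
  intro k
  induction k generalizing f with
  | zero =>
    have h0 : Continuous fun p : X × ℝ => f p.1 p.2 := by
      simpa only [iteratedDeriv_zero] using hc 0
    exact h0.continuousOn
  | succ k ih =>
    have h0 : Continuous fun p : X × ℝ => f p.1 p.2 := by
      simpa only [iteratedDeriv_zero] using hc 0
    refine ⟨h0.continuousOn, fun p _ => ((hf p.1).differentiable (by simp)) _,
      ih (fun x => contDiff_deriv (hf x)) fun j => ?_⟩
    simpa only [iteratedDeriv_succ'] using hc (j + 1)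

theorem JetSmooth.comp_continuous {f : X → ℝ → V} (h : JetSmooth f univ) {φ : Y → X}
    (hφ : Continuous φ) : JetSmooth (fun y => f (φ y)) univ :=
  jetSmooth_of_continuous (fun _ => h.contDiff _) fun k =>
    (h.continuous_iteratedDeriv k).comp ((hφ.comp continuous_fst).prodMk continuous_snd)

theorem jetSmooth_const {f : ℝ → V} (hf : ContDiff ℝ ∞ f) : JetSmooth (fun _ : X => f) univ :=
  jetSmooth_of_continuous (fun _ => hf) fun k =>
    (OperCurve.continuous_iteratedDeriv hf k).comp continuous_snd

/-- Continuity for the `C^∞` topology is joint continuity of all derivatives. -/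
theorem continuous_jets_iff (hf : ∀ x, ContDiff ℝ ∞ (f x)) :
    Continuous (fun x => jets (f x) (hf x)) ↔ JetSmooth f univ := by
  rw [continuous_pi_iff]
  constructor
  · intro h
    exact jetSmooth_of_continuous hf fun k =>
      ContinuousMap.continuous_uncurry_of_continuous ⟨_, h k⟩
  · intro h k
    exact ContinuousMap.continuous_of_continuous_uncurry _ (h.continuous_iteratedDeriv k)

theorem continuous_oper_iff {n : ℕ} {Φ : X → Oper n} :
    Continuous Φ ↔ ∀ j, JetSmooth (fun x (t : ℝ) => (Φ x).coeff j (t : UnitAddCircle)) univ := by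
  rw [continuous_induced_rng, continuous_pi_iff]
  exact forall_congr' fun j => continuous_jets_iff fun x => (Φ x).smooth j

theorem continuous_smoothCurve_iff {n : ℕ} {Φ : X → SmoothCurve n} :
    Continuous Φ ↔
      JetSmooth (fun x (t : ℝ) => lineProj ((Φ x).toFun (t : UnitAddCircle))) univ := by
  rw [continuous_induced_rng]
  exact continuous_jets_iff fun x => (Φ x).smooth

end JetCont

open scoped Interval

/-! ### Linear differential equations -/

section ODE

variable {X : Type*} [TopologicalSpace X] {F : Type*} [NormedAddCommGroup F] [NormedSpace ℝ F]

/-- The terms of the Picard series of the linear equation `y' = A y`, `y 0 = y₀`. -/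
def picardTerm (A : X → ℝ → F →L[ℝ] F) (y₀ : F) : ℕ → X → ℝ → F
  | 0 => fun _ _ => y₀
  | m + 1 => fun x t => ∫ s in (0 : ℝ)..t, A x s (picardTerm A y₀ m x s)

variable {A : X → ℝ → F →L[ℝ] F} {y₀ : F}

theorem continuous_picardTerm (hA : Continuous fun p : X × ℝ => A p.1 p.2) (m : ℕ) :
    Continuous fun p : X × ℝ => picardTerm A y₀ m p.1 p.2 := by
  induction m with
  | zero => exact continuous_const
  | succ m ih =>
    exact intervalIntegral.continuous_parametric_primitive_of_continuous
      (f := fun x s => A x s (picardTerm A y₀ m x s)) (hA.clm_apply ih)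

theorem hasDerivAt_picardTerm [CompleteSpace F] (hA : Continuous fun p : X × ℝ => A p.1 p.2) (m : ℕ) (x : X) (t : ℝ) :
    HasDerivAt (picardTerm A y₀ (m + 1) x) (A x t (picardTerm A y₀ m x t)) t := by
  have hc : Continuous fun s => A x s (picardTerm A y₀ m x s) :=
    (hA.clm_apply (continuous_picardTerm hA m)).comp (Continuous.prodMk_right x)
  exact (hc.integral_hasStrictDerivAt 0 t).hasDerivAt

/-- Integrating `|s| ^ m` at each step produces the factorial that makes the series converge on
every bounded interval. -/
theorem norm_picardTerm_le [CompleteSpace F] (hA : Continuous fun p : X × ℝ => A p.1 p.2) {x : X} {T K : ℝ}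
    (hK0 : 0 ≤ K) (hK : ∀ t ∈ Icc (-T) T, ‖A x t‖ ≤ K) (m : ℕ) {t : ℝ} (ht : t ∈ Icc (-T) T) :
    ‖picardTerm A y₀ m x t‖ ≤ ‖y₀‖ * ((K * |t|) ^ m / m.factorial) := by
  induction m generalizing t with
  | zero => simp [picardTerm]
  | succ m ih =>
    have hT : ∀ s ∈ Ι 0 t, s ∈ Icc (-T) T := fun s hs => by
      rw [mem_uIoc] at hs
      obtain ⟨h1, h2⟩ := ht
      rcases hs with h | h <;> constructor <;> linarith [h.1, h.2]
    have hb : ∀ s ∈ Ι 0 t, ‖A x s (picardTerm A y₀ m x s)‖ ≤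
        (K ^ (m + 1) * ‖y₀‖ / m.factorial) * |s - 0| ^ m := fun s hs => by
      calc _ ≤ ‖A x s‖ * ‖picardTerm A y₀ m x s‖ := (A x s).le_opNorm _
        _ ≤ K * (‖y₀‖ * ((K * |s|) ^ m / m.factorial)) :=
          mul_le_mul (hK s (hT s hs)) (ih (hT s hs)) (norm_nonneg _) hK0
        _ = _ := by rw [sub_zero]; ring
    have hc : Continuous fun s => A x s (picardTerm A y₀ m x s) :=
      (hA.clm_apply (continuous_picardTerm hA m)).comp (Continuous.prodMk_right x)
    calc ‖picardTerm A y₀ (m + 1) x t‖ ≤ ∫ s in Ι 0 t, ‖A x s (picardTerm A y₀ m x s)‖ :=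
          intervalIntegral.norm_integral_le_integral_norm_uIoc
      _ ≤ ∫ s in Ι 0 t, (K ^ (m + 1) * ‖y₀‖ / m.factorial) * |s - 0| ^ m := by
          refine MeasureTheory.setIntegral_mono_on ?_ ?_ measurableSet_uIoc hb
          · exact (hc.norm.intervalIntegrable 0 t).def'
          · exact ((by fun_prop : Continuous fun s : ℝ =>
              (K ^ (m + 1) * ‖y₀‖ / m.factorial) * |s - 0| ^ m).intervalIntegrable 0 t).def'
      _ = _ := by
          rw [MeasureTheory.integral_const_mul, integral_pow_abs_sub_uIoc, Nat.factorial_succ,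
            sub_zero]
          have := Nat.factorial_ne_zero m
          push_cast
          field_simp
          ring

theorem exists_local_bound (hA : Continuous fun p : X × ℝ => A p.1 p.2) (x₀ : X) (T : ℝ) :
    ∃ K, 0 ≤ K ∧ ∀ᶠ x in 𝓝 x₀, ∀ t ∈ Icc (-T) T, ‖A x t‖ ≤ K := by
  obtain ⟨K, hK⟩ := (isCompact_Icc (a := -T) (b := T)).exists_bound_of_continuousOn
    ((hA.comp (Continuous.prodMk_right x₀)).continuousOn)
  refine ⟨|K| + 1, by positivity, isCompact_Icc.eventually_forall_of_forall_eventually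
    fun t ht => ?_⟩
  have h1 : ‖A x₀ t‖ < |K| + 1 := by
    have : ‖A x₀ t‖ ≤ K := hK t ht
    linarith [le_abs_self K]
  filter_upwards [(hA.norm.continuousAt (x := (x₀, t))).eventually (gt_mem_nhds h1)] with p hp
  exact hp.le

/-- The value of the Picard series. -/
def picardSum (A : X → ℝ → F →L[ℝ] F) (y₀ : F) (x : X) (t : ℝ) : F :=
  ∑' m, picardTerm A y₀ m x t

theorem picardTerm_bound [CompleteSpace F] (hA : Continuous fun p : X × ℝ => A p.1 p.2) {x : X} {T K : ℝ}
    (hK0 : 0 ≤ K) (hK : ∀ t ∈ Icc (-T) T, ‖A x t‖ ≤ K) (m : ℕ) {t : ℝ} (ht : t ∈ Icc (-T) T) :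
    ‖picardTerm A y₀ m x t‖ ≤ ‖y₀‖ * ((K * T) ^ m / m.factorial) := by
  refine (norm_picardTerm_le hA hK0 hK m ht).trans ?_
  have : |t| ≤ T := abs_le.2 ht
  gcongr

theorem summable_bound (T K C : ℝ) :
    Summable fun m : ℕ => C * ((K * T) ^ m / m.factorial) :=
  (Real.summable_pow_div_factorial (K * T)).mul_left _

/-- The parameter space is an arbitrary topological space, later the space of opers itself.
Compactness of `[-T, T]` gives one bound on `A` for all parameters near `x₀`, hence uniform
convergence on a neighbourhood. -/
theorem continuous_picardSum [CompleteSpace F] (hA : Continuous fun p : X × ℝ => A p.1 p.2) :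
    Continuous fun p : X × ℝ => picardSum A y₀ p.1 p.2 := by
  rw [continuous_iff_continuousAt]
  rintro ⟨x₀, t₀⟩
  obtain ⟨K, hK0, hK⟩ := exists_local_bound hA x₀ (|t₀| + 1)
  have hc := continuousOn_tsum (s := {x | ∀ t ∈ Icc (-(|t₀| + 1)) (|t₀| + 1), ‖A x t‖ ≤ K} ×ˢ
    Icc (-(|t₀| + 1)) (|t₀| + 1)) (fun m => (continuous_picardTerm (y₀ := y₀) hA m).continuousOn)
    (summable_bound (|t₀| + 1) K ‖y₀‖) fun m p hp => picardTerm_bound hA hK0 hp.1 m hp.2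
  refine hc.continuousAt (prod_mem_nhds hK (Icc_mem_nhds ?_ ?_))
  · linarith [neg_abs_le t₀]
  · linarith [le_abs_self t₀]

theorem hasDerivAt_picardSum [CompleteSpace F] (hA : Continuous fun p : X × ℝ => A p.1 p.2) (x : X) (t : ℝ) :
    HasDerivAt (picardSum A y₀ x) (A x t (picardSum A y₀ x t)) t := by
  obtain ⟨K, hK0, hK⟩ := exists_local_bound hA x (|t| + 1)
  have hK := hK.self_of_nhds
  set T := |t| + 1
  have hT : 0 < T := by positivity
  have hs : ∀ s ∈ Icc (-T) T, Summable fun m => picardTerm A y₀ m x s := fun s hs =>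
    .of_norm_bounded (summable_bound T K ‖y₀‖) fun m => picardTerm_bound hA hK0 hK m hs
  have htT : t ∈ Ioo (-T) T := abs_lt.1 (by simp [T])
  -- The constant term of index 0 is left out: the derivative of the term `m + 1` is `A` applied to
  -- the term `m`.
  have hd := hasDerivAt_tsum_of_isPreconnected (𝕜 := ℝ) (t := Ioo (-T) T)
    (g := fun m => picardTerm A y₀ (m + 1) x) (g' := fun m s => A x s (picardTerm A y₀ m x s))
    ((summable_bound T K ‖y₀‖).mul_left K) isOpen_Ioo isPreconnected_Ioo
    (fun m s _ => hasDerivAt_picardTerm hA m x s)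
    (fun m s hs' => ((A x s).le_opNorm _).trans (mul_le_mul (hK s (Ioo_subset_Icc_self hs'))
      (picardTerm_bound hA hK0 hK m (Ioo_subset_Icc_self hs')) (norm_nonneg _) hK0))
    (y₀ := 0) (by constructor <;> linarith)
    ((summable_nat_add_iff 1).2 (hs 0 (by constructor <;> linarith))) htT
  have he : A x t (picardSum A y₀ x t) = ∑' m, A x t (picardTerm A y₀ m x t) :=
    (A x t).map_tsum (hs t (Ioo_subset_Icc_self htT))
  rw [he]
  refine (hd.const_add y₀).congr_of_eventuallyEq ?_
  filter_upwards [Ioo_mem_nhds htT.1 htT.2] with s hs'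
  exact (hs s (Ioo_subset_Icc_self hs')).tsum_eq_zero_add

/-- Bootstrap: if `y` has k jointly continuous derivatives, so does `A y`, which is the derivative
of `y`. -/
theorem jetSmooth_of_hasDerivAt {y : X → ℝ → F} (hA : JetSmooth A univ)
    (hy : Continuous fun p : X × ℝ => y p.1 p.2)
    (hd : ∀ x t, HasDerivAt (y x) (A x t (y x t)) t) : JetSmooth y univ := by
  intro k
  induction k with
  | zero => exact hy.continuousOn
  | succ k ih =>
    exact ⟨hy.continuousOn, fun p _ => (hd p.1 p.2).differentiableAt,
      ((hA k).bilin isOpen_univ (ContinuousLinearMap.id ℝ (F →L[ℝ] F)) ih).congr isOpen_univ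
        fun p _ => (hd p.1 p.2).deriv⟩

theorem linear_ode_unique {B : ℝ → F →L[ℝ] F} (hB : Continuous B) {y z : ℝ → F}
    (hy : ∀ t, HasDerivAt y (B t (y t)) t) (hz : ∀ t, HasDerivAt z (B t (z t)) t) {t₀ : ℝ}
    (h0 : y t₀ = z t₀) : y = z := by
  funext t
  set T := |t| + |t₀| + 1
  obtain ⟨K, hK⟩ := (isCompact_Icc (a := -T) (b := T)).exists_bound_of_continuousOn hB.continuousOn
  have hm : ∀ s, |s| < T → s ∈ Ioo (-T) T := fun s hs => abs_lt.1 hs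
  refine ODE_solution_unique_of_mem_Ioo (v := fun t y => B t y) (s := fun _ => univ)
    (K := K.toNNReal) (a := -T) (b := T) (t₀ := t₀) (fun s hs => ?_)
    (hm _ (by simp only [T]; linarith [abs_nonneg t])) (fun s _ => ⟨hy s, mem_univ _⟩)
    (fun s _ => ⟨hz s, mem_univ _⟩) h0 (hm _ (by simp only [T]; linarith [abs_nonneg t₀]))
  refine ((B s).lipschitz.weaken ?_).lipschitzOnWith
  have := hK s (Ioo_subset_Icc_self hs)
  rw [← NNReal.coe_le_coe]
  exact this.trans (Real.le_coe_toNNReal K)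

theorem picardSum_zero {X F : Type*} [NormedAddCommGroup F] [NormedSpace ℝ F]
    (A : X → ℝ → F →L[ℝ] F) (y₀ : F) (x : X) : picardSum A y₀ x 0 = y₀ := by
  rw [picardSum, tsum_eq_single 0]
  · rfl
  · rintro (_ | m) hm
    · exact absurd rfl hm
    · simp [picardTerm]

end ODE

/-! ### Wronskians -/

section Wronskian

variable {n : ℕ} {v : ℝ → E n}

/-- The matrix whose rows are the derivatives of order less than `n` of a curve. -/
def jetMatrix (v : ℝ → E n) (t : ℝ) : Matrix (Fin n) (Fin n) ℝ :=
  Matrix.of fun i j : Fin n => iteratedDeriv (i : ℕ) v t j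

theorem wronskian_eq (hv : ContDiff ℝ ∞ v) (t : ℝ) : wronskian v t = (jetMatrix v t).det := by
  simp only [wronskian, jetMatrix, iteratedDeriv_coord hv]

theorem linearIndependent_iff_det_ne_zero {x : Fin n → E n} :
    LinearIndependent ℝ x ↔ (Matrix.of fun i j : Fin n => x i j).det ≠ 0 := by
  have h1 := LinearMap.linearIndependent_iff (v := x)
    ((WithLp.linearEquiv 2 ℝ (Fin n → ℝ)).toLinearMap) (LinearEquiv.ker _)
  rw [← h1, ← isUnit_iff_ne_zero, ← Matrix.isUnit_iff_isUnit_det,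
    ← Matrix.linearIndependent_rows_iff_isUnit]
  rfl

theorem wronskian_ne_zero_iff (hv : ContDiff ℝ ∞ v) (t : ℝ) : wronskian v t ≠ 0 ↔
    LinearIndependent ℝ fun k : Fin n => iteratedDeriv (k : ℕ) v t := by
  rw [wronskian_eq hv, linearIndependent_iff_det_ne_zero, jetMatrix]

theorem hasDerivAt_det_col {ι : Type*} [Fintype ι] [DecidableEq ι] {M : ℝ → Matrix ι ι ℝ}
    {M' : Matrix ι ι ℝ} {t : ℝ} (h : ∀ i j, HasDerivAt (fun s => M s i j) (M' i j) t) :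
    HasDerivAt (fun s => (M s).det) (∑ i, ((M t).updateCol i fun k => M' k i).det) t := by
  simp only [Matrix.det_apply']
  have h1 := HasDerivAt.fun_sum (u := Finset.univ) fun (σ : Equiv.Perm ι) _ =>
    (HasDerivAt.fun_finsetProd (u := Finset.univ) fun i _ => h (σ i) i).const_mul
      ((Equiv.Perm.sign σ : ℤ) : ℝ)
  refine h1.congr_deriv ?_
  symm
  rw [Finset.sum_comm]
  refine Finset.sum_congr rfl fun σ _ => ?_
  rw [Finset.mul_sum]
  refine Finset.sum_congr rfl fun i _ => ?_
  rw [← Finset.prod_erase_mul _ _ (Finset.mem_univ i), Matrix.updateCol_self, smul_eq_mul]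
  congr 2
  exact Finset.prod_congr rfl fun j hj => Matrix.updateCol_ne (Finset.ne_of_mem_erase hj)

theorem hasDerivAt_det_row {ι : Type*} [Fintype ι] [DecidableEq ι] {M : ℝ → Matrix ι ι ℝ}
    {M' : Matrix ι ι ℝ} {t : ℝ} (h : ∀ i j, HasDerivAt (fun s => M s i j) (M' i j) t) :
    HasDerivAt (fun s => (M s).det) (∑ i, ((M t).updateRow i (M' i)).det) t := by
  have := hasDerivAt_det_col (M := fun s => (M s).transpose) (M' := M'.transpose) (t := t)
    fun i j => h j i
  simp only [Matrix.det_transpose] at this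
  refine this.congr_deriv (Finset.sum_congr rfl fun i _ => ?_)
  have e : (M t).transpose.updateCol i (fun k => M'.transpose k i) =
    ((M t).updateRow i (M' i)).transpose := Matrix.updateCol_transpose
  rw [e, Matrix.det_transpose]

/-- Differentiating any row but the last one repeats the next row, so only the last row contributes.
-/
theorem hasDerivAt_wronskian (hn : 1 ≤ n) (hv : ContDiff ℝ ∞ v) (t : ℝ) :
    HasDerivAt (wronskian v) ((jetMatrix v t).updateRow ⟨n - 1, by omega⟩
      (fun j => iteratedDeriv n v t j)).det t := by
  have h := hasDerivAt_det_row (M := jetMatrix v) (t := t)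
    (M' := Matrix.of fun i j : Fin n => iteratedDeriv ((i : ℕ) + 1) v t j) fun i j =>
      ((EuclideanSpace.proj j : E n →L[ℝ] ℝ).hasFDerivAt.comp_hasDerivAt t
        (hasDerivAt_iteratedDeriv hv i t))
  rw [Finset.sum_eq_single (⟨n - 1, by omega⟩ : Fin n)] at h
  · rw [funext (wronskian_eq hv)]
    convert h using 3
    funext j
    simp only [Matrix.of_apply, Nat.sub_add_cancel hn]
  · intro i _ hi
    have hi' : (i : ℕ) + 1 < n := by
      have := i.2
      have : (i : ℕ) ≠ n - 1 := fun h => hi (Fin.ext h)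
      omega
    have hne : i ≠ ⟨(i : ℕ) + 1, hi'⟩ := fun h => by simpa using congrArg Fin.val h
    exact Matrix.det_zero_of_row_eq hne (by
      rw [Matrix.updateRow_self, Matrix.updateRow_ne hne.symm]; rfl)
  · simp

theorem hasDerivAt_wronskian_of_eq (hn : 1 ≤ n) (hv : ContDiff ℝ ∞ v) {t : ℝ} {a : Fin n → ℝ}
    (h : iteratedDeriv n v t = ∑ j : Fin n, a j • iteratedDeriv (j : ℕ) v t) :
    HasDerivAt (wronskian v) (a ⟨n - 1, by omega⟩ * wronskian v t) t := by
  have h1 := hasDerivAt_wronskian hn hv t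
  have h2 : (fun j => iteratedDeriv n v t j) = ∑ k : Fin n, a k • jetMatrix v t k := by
    funext j
    rw [h]
    simp [jetMatrix, Finset.sum_apply]
  rw [h2, Matrix.det_updateRow_sum, smul_eq_mul, ← wronskian_eq hv] at h1
  exact h1

/-- By Leibniz' rule the jets of `φ • v` are those of `v` multiplied by a lower triangular matrix
with `φ t` on the diagonal. -/
theorem wronskian_smul {φ : ℝ → ℝ} (hφ : ContDiff ℝ ∞ φ) (hv : ContDiff ℝ ∞ v) (t : ℝ) :
    wronskian (fun s => φ s • v s) t = φ t ^ n * wronskian v t := by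
  have hs : ContDiff ℝ ∞ fun s => φ s • v s := hφ.smul hv
  set T : Matrix (Fin n) (Fin n) ℝ := Matrix.of fun i k : Fin n =>
    ((i : ℕ).choose k : ℝ) * iteratedDeriv ((i : ℕ) - k) φ t with hT
  have hT' : T.IsLowerTriangular := fun i j hij => by
    simp only [hT, Matrix.of_apply]
    rw [Nat.choose_eq_zero_of_lt (by exact_mod_cast hij)]
    simp
  have hM : jetMatrix (fun s => φ s • v s) t = T * jetMatrix v t := by
    ext i j
    rw [Matrix.mul_apply]
    have hc := iteratedDeriv_coord hs i t j
    have hvj : ContDiff ℝ ∞ fun s => v s j := (EuclideanSpace.proj j : E n →L[ℝ] ℝ).contDiff.comp hv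
    have : (fun s => (φ s • v s) j) = fun s => v s j * φ s := by
      funext s; simp [mul_comm]
    simp only [jetMatrix, Matrix.of_apply, ← hc, hT]
    rw [this, iteratedDeriv_fun_mul (hvj.of_le (by exact_mod_cast le_top)).contDiffAt
      (hφ.of_le (by exact_mod_cast le_top)).contDiffAt]
    simp only [iteratedDeriv_coord hv]
    rw [Finset.sum_subset (s₂ := Finset.range n) (Finset.range_subset_range.2 (by have := i.2; omega))
      (fun k _ hk => by
        rw [Nat.choose_eq_zero_of_lt (by simpa using hk)]; simp), ← Fin.sum_univ_eq_sum_range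
      (fun k => ((i : ℕ).choose k : ℝ) * iteratedDeriv k v t j * iteratedDeriv ((i : ℕ) - k) φ t)]
    exact Finset.sum_congr rfl fun k _ => by ring
  rw [wronskian_eq hs, wronskian_eq hv]
  rw [hM, Matrix.det_mul, Matrix.det_of_isLowerTriangular _ hT']
  simp [hT]

theorem wronskian_clm (L : E n →L[ℝ] E n) (hv : ContDiff ℝ ∞ v) (t : ℝ) :
    wronskian (fun s => L (v s)) t = LinearMap.det (L : E n →ₗ[ℝ] E n) * wronskian v t := by
  have hLv : ContDiff ℝ ∞ fun s => L (v s) := L.contDiff.comp hv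
  rw [wronskian_eq hLv, wronskian_eq hv, ← LinearMap.det_toMatrix
    (EuclideanSpace.basisFun (Fin n) ℝ).toBasis,
    ← Matrix.det_transpose (LinearMap.toMatrix _ _ _), mul_comm, ← Matrix.det_mul]
  congr 1
  ext i j
  rw [Matrix.mul_apply]
  simp only [jetMatrix, Matrix.of_apply, iteratedDeriv_clm_comp L hv]
  have : iteratedDeriv (i : ℕ) v t = ∑ k, iteratedDeriv (i : ℕ) v t k •
      EuclideanSpace.basisFun (Fin n) ℝ k := by
    conv_lhs => rw [← (EuclideanSpace.basisFun (Fin n) ℝ).sum_repr (iteratedDeriv (i : ℕ) v t)]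
    simp
  conv_lhs => rw [this]
  simp only [map_sum, map_smul, LinearMap.toMatrix_apply, Matrix.transpose_apply]
  simp

end Wronskian

/-! ### Solutions of opers -/

section Solutions

variable {n : ℕ} {V W : Type*} [NormedAddCommGroup V] [NormedSpace ℝ V] [NormedAddCommGroup W]
  [NormedSpace ℝ W]

/-- Solutions, with values in a vector space, of the equation defined by an oper. -/
def Oper.VecSol (D : Oper n) (w : ℝ → V) : Prop :=
  ContDiff ℝ ∞ w ∧ ∀ t : ℝ, iteratedDeriv n w t +
    ∑ j : Fin (n - 1), D.coeff j (t : UnitAddCircle) • iteratedDeriv (j : ℕ) w t = 0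

theorem Oper.isSolution_iff_vecSol {D : Oper n} {ψ : ℝ → ℝ} : D.IsSolution ψ ↔ D.VecSol ψ := Iff.rfl

theorem Oper.VecSol.clm {D : Oper n} {w : ℝ → V} (h : D.VecSol w) (L : V →L[ℝ] W) :
    D.VecSol fun t => L (w t) := by
  refine ⟨L.contDiff.comp h.1, fun t => ?_⟩
  have := congrArg L (h.2 t)
  simpa only [iteratedDeriv_clm_comp L h.1, map_add, map_sum, map_smul, map_zero] using this

theorem Oper.vecSol_iff_coord {D : Oper n} {v : ℝ → E n} :
    D.VecSol v ↔ ∀ i, D.IsSolution fun t => v t i := by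
  constructor
  · exact fun h i => h.clm (EuclideanSpace.proj i : E n →L[ℝ] ℝ)
  · intro h
    have hv : ContDiff ℝ ∞ v := contDiff_euclidean.2 fun i => (h i).1
    refine ⟨hv, fun t => ?_⟩
    ext i
    have := (h i).2 t
    simp only [Oper.apply, iteratedDeriv_coord hv] at this
    simpa [Finset.sum_apply] using this

/-- The constant part of the companion system. -/
def shiftCLM (n : ℕ) (V : Type*) [NormedAddCommGroup V] [NormedSpace ℝ V] :
    (Fin n → V) →L[ℝ] (Fin n → V) :=
  ContinuousLinearMap.pi fun i : Fin n => if h : (i : ℕ) + 1 < n then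
    ContinuousLinearMap.proj ⟨(i : ℕ) + 1, h⟩ else 0

/-- The part of the companion system which depends on the coefficient `j`. -/
def lastCLM (n : ℕ) (V : Type*) [NormedAddCommGroup V] [NormedSpace ℝ V] (j : Fin (n - 1)) :
    (Fin n → V) →L[ℝ] (Fin n → V) :=
  ContinuousLinearMap.pi fun i : Fin n => if (i : ℕ) + 1 < n then 0 else
    -ContinuousLinearMap.proj (⟨(j : ℕ), by omega⟩ : Fin n)

/-- The first order linear system equivalent to the equation defined by an oper. -/
def companion (V : Type*) [NormedAddCommGroup V] [NormedSpace ℝ V] (D : Oper n) (t : ℝ) :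
    (Fin n → V) →L[ℝ] (Fin n → V) :=
  shiftCLM n V + ∑ j : Fin (n - 1), D.coeff j (t : UnitAddCircle) • lastCLM n V j

theorem companion_apply_of_lt (D : Oper n) (t : ℝ) (y : Fin n → V) {i : ℕ} (hi : i + 1 < n) :
    companion V D t y ⟨i, by omega⟩ = y ⟨i + 1, hi⟩ := by
  simp [companion, shiftCLM, lastCLM, hi, Finset.sum_apply]

theorem companion_apply_last (D : Oper n) (t : ℝ) (y : Fin n → V) (hn : 1 ≤ n) :
    companion V D t y ⟨n - 1, by omega⟩ =
      -∑ j : Fin (n - 1), D.coeff j (t : UnitAddCircle) • y ⟨(j : ℕ), by omega⟩ := by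
  simp [companion, shiftCLM, lastCLM, Nat.sub_add_cancel hn, Finset.sum_apply]

theorem jetSmooth_coeff (j : Fin (n - 1)) :
    JetSmooth (fun (D : Oper n) (t : ℝ) => D.coeff j (t : UnitAddCircle)) univ :=
  continuous_oper_iff.1 continuous_id j

theorem jetSmooth_companion : JetSmooth (companion V : Oper n → _) univ := fun k =>
  (JetCont.const _ continuous_const).add isOpen_univ (JetCont.sum isOpen_univ _ fun j _ =>
    (jetSmooth_coeff j k).smul isOpen_univ (JetCont.const _ continuous_const))

theorem continuous_companion : Continuous fun p : Oper n × ℝ => companion V p.1 p.2 := by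
  simpa only [iteratedDeriv_zero] using (jetSmooth_companion (n := n) (V := V)).continuous_iteratedDeriv 0

theorem Oper.VecSol.hasDerivAt {D : Oper n} {w : ℝ → V} (h : D.VecSol w) (t : ℝ) :
    HasDerivAt (fun t => fun i : Fin n => iteratedDeriv (i : ℕ) w t)
      (companion V D t fun i : Fin n => iteratedDeriv (i : ℕ) w t) t := by
  rw [hasDerivAt_pi]
  rintro ⟨i, hi⟩
  have hd := hasDerivAt_iteratedDeriv h.1 i t
  by_cases hi' : i + 1 < n
  · rw [companion_apply_of_lt D t _ hi']
    exact hd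
  · obtain rfl : i = n - 1 := by omega
    rw [companion_apply_last D t _ (by omega), ← eq_neg_of_add_eq_zero_left (h.2 t)]
    rwa [Nat.sub_add_cancel (by omega)] at hd

theorem Oper.VecSol.ext {D : Oper n} {w z : ℝ → V} (hn : 1 ≤ n) (hw : D.VecSol w) (hz : D.VecSol z)
    {t₀ : ℝ} (h : ∀ i : Fin n, iteratedDeriv (i : ℕ) w t₀ = iteratedDeriv (i : ℕ) z t₀) :
    w = z := by
  have := linear_ode_unique (continuous_companion.comp (Continuous.prodMk_right D)) hw.hasDerivAt
    hz.hasDerivAt (t₀ := t₀) (funext h)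
  funext t
  simpa using congrFun (congrFun this t) ⟨0, hn⟩

/-- The companion system is solved with the oper itself as parameter, so that continuity in the
`C^∞` topology of the coefficients is part of the conclusion. -/
theorem exists_vecSol [CompleteSpace V] (hn : 1 ≤ n) (y₀ : Fin n → V) :
    ∃ w : Oper n → ℝ → V, JetSmooth w univ ∧ (∀ D : Oper n, D.VecSol (w D)) ∧
      ∀ (D : Oper n) (i : Fin n), iteratedDeriv (i : ℕ) (w D) 0 = y₀ i := by
  set y : Oper n → ℝ → Fin n → V := picardSum (companion V) y₀ with hy
  have hd := hasDerivAt_picardSum (y₀ := y₀) (continuous_companion (n := n) (V := V))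
  have hs : JetSmooth y univ := jetSmooth_of_hasDerivAt jetSmooth_companion
    (continuous_picardSum continuous_companion) hd
  have hi : ∀ (D : Oper n) (i : ℕ) (hi : i < n),
      iteratedDeriv i (fun t => y D t ⟨0, hn⟩) = fun t => y D t ⟨i, hi⟩ := by
    intro D i
    induction i with
    | zero => intro _; simp
    | succ i ih =>
      intro hi
      funext t
      rw [iteratedDeriv_succ, ih (by omega), ← companion_apply_of_lt D t (y D t) hi]
      exact (hasDerivAt_pi.1 (hd D t) _).deriv
  have hw : JetSmooth (fun D t => y D t ⟨0, hn⟩) univ := fun k =>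
    (hs k).clm isOpen_univ (ContinuousLinearMap.proj (⟨0, hn⟩ : Fin n))
  refine ⟨fun D t => y D t ⟨0, hn⟩, hw, fun D => ⟨hw.contDiff D, fun t => ?_⟩, fun D i => ?_⟩
  · have h1 : iteratedDeriv n (fun t => y D t ⟨0, hn⟩) t =
        companion V D t (y D t) ⟨n - 1, by omega⟩ := by
      obtain ⟨m, rfl⟩ : ∃ m, n = m + 1 := ⟨n - 1, by omega⟩
      rw [iteratedDeriv_succ, hi D m (by omega)]
      exact (hasDerivAt_pi.1 (hd D t) _).deriv
    rw [h1, companion_apply_last D t _ hn, neg_add_eq_zero]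
    exact Finset.sum_congr rfl fun j _ => by rw [hi D j (by omega)]
  · rw [hi D i i.2]
    simp only [hy, picardSum_zero]

/-- The solutions with values in `ℝⁿ` are the images, under linear maps, of a nondegenerate one. -/
theorem Oper.VecSol.exists_clm {D : Oper n} {v : ℝ → E n} {w : ℝ → V} (hn : 1 ≤ n)
    (hv : D.VecSol v) (hw : D.VecSol w) {t₀ : ℝ}
    (hi : LinearIndependent ℝ fun k : Fin n => iteratedDeriv (k : ℕ) v t₀) :
    ∃ L : E n →L[ℝ] V, ∀ t, w t = L (v t) := by
  have : Nonempty (Fin n) := ⟨⟨0, hn⟩⟩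
  set b := basisOfLinearIndependentOfCardEqFinrank hi (by simp) with hb
  set L : E n →L[ℝ] V :=
    LinearMap.toContinuousLinearMap (b.constr ℝ fun k : Fin n => iteratedDeriv (k : ℕ) w t₀) with hL
  refine ⟨L, fun t => congrFun (Oper.VecSol.ext hn hw (hv.clm L) (t₀ := t₀) fun i => ?_) t⟩
  rw [iteratedDeriv_clm_comp L hv.1]
  have : iteratedDeriv (i : ℕ) v t₀ = b i := by simp [hb]
  rw [this, hL, LinearMap.coe_toContinuousLinearMap', Module.Basis.constr_basis]

/-- Liouville's formula: the logarithmic derivative of the Wronskian is minus the coefficient of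
order n - 1, which is absent from an oper. -/
theorem Oper.VecSol.hasDerivAt_wronskian {D : Oper n} {v : ℝ → E n} (hn : 1 ≤ n) (hv : D.VecSol v)
    (t : ℝ) : HasDerivAt (wronskian v) 0 t := by
  have := hasDerivAt_wronskian_of_eq hn hv.1 (t := t)
    (a := fun j : Fin n => if h : (j : ℕ) < n - 1 then -D.coeff ⟨j, h⟩ (t : UnitAddCircle) else 0) (by
      obtain ⟨m, rfl⟩ : ∃ m, n = m + 1 := ⟨n - 1, by omega⟩
      rw [Fin.sum_univ_castSucc, eq_neg_of_add_eq_zero_left (hv.2 t)]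
      simp)
  simpa using this

theorem Oper.VecSol.wronskian_eq {D : Oper n} {v : ℝ → E n} (hn : 1 ≤ n) (hv : D.VecSol v)
    (s t : ℝ) : wronskian v s = wronskian v t :=
  is_const_of_deriv_eq_zero (fun t => (hv.hasDerivAt_wronskian hn t).differentiableAt)
    (fun t => (hv.hasDerivAt_wronskian hn t).deriv) s t

end Solutions

/-! ### The curves defined by frames -/

section Curves

variable {X : Type*} [TopologicalSpace X] {n : ℕ} {v w : ℝ → E n}

/-- The expression is the projection onto the line of `v x t`, by `lineProj_mk`. -/
theorem JetSmooth.lineProj {v : X → ℝ → E n} {U : Set (X × ℝ)} (hU : IsOpen U)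
    (hv : JetSmooth v U) (h0 : ∀ p ∈ U, v p.1 p.2 ≠ 0) :
    JetSmooth (fun x t => (‖v x t‖ ^ 2)⁻¹ • (innerSL ℝ (v x t)).smulRight (v x t)) U := by
  intro k
  have h1 : JetCont k (fun x t => ‖v x t‖ ^ 2) U :=
    ((hv k).bilin hU (innerSL ℝ) (hv k)).congr hU fun p _ => (real_inner_self_eq_norm_sq _).symm
  have h2 : JetCont k (fun x t => (‖v x t‖ ^ 2)⁻¹) U :=
    h1.comp hU (isOpen_compl_singleton (x := 0)) (contDiffOn_inv ℝ) fun p hp => by simpa using h0 p hp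
  exact h2.smul hU (((hv k).clm hU (innerSL ℝ)).bilin hU
    (ContinuousLinearMap.smulRightL ℝ (E n) (E n)) (hv k))

theorem IsFrame.ne_zero (hn : 1 ≤ n) (hv : IsFrame v) (t : ℝ) : v t ≠ 0 := by
  simpa using (hv.nondeg t).ne_zero ⟨0, hn⟩

/-- The curve in the projective space defined by a frame. -/
def frameCurve (hn : 1 ≤ n) (hv : IsFrame v) : SmoothCurve n where
  toFun := Function.Periodic.lift (c := (1 : ℝ))
    (f := fun t => Projectivization.mk ℝ (v t) (hv.ne_zero hn t)) (by
      intro t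
      rw [Projectivization.mk_eq_mk_iff']
      obtain ⟨ε, -, h⟩ := hv.period
      exact ⟨ε, (h t).symm⟩)
  smooth := by
    have h := ((jetSmooth_const (X := Unit) hv.smooth).lineProj isOpen_univ
      fun p _ => hv.ne_zero hn p.2).contDiff ()
    convert h using 2 with t
    exact lineProj_mk _ _

theorem frameCurve_coe (hn : 1 ≤ n) (hv : IsFrame v) (t : ℝ) :
    (frameCurve hn hv).toFun (t : UnitAddCircle) = Projectivization.mk ℝ (v t) (hv.ne_zero hn t) :=
  rfl

theorem isLift_frameCurve (hn : 1 ≤ n) (hv : IsFrame v) : IsLift (frameCurve hn hv).toFun v :=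
  ⟨hv.smooth, fun t => ⟨hv.ne_zero hn t, rfl⟩⟩

theorem continuous_frameCurve (hn : 1 ≤ n) {v : X → ℝ → E n} (hv : ∀ x, IsFrame (v x))
    (hs : JetSmooth v univ) : Continuous fun x => frameCurve hn (hv x) := by
  rw [continuous_smoothCurve_iff]
  refine fun k => (hs.lineProj isOpen_univ (fun p _ => (hv p.1).ne_zero hn p.2) k).congr
    isOpen_univ fun p _ => ?_
  rw [frameCurve_coe, lineProj_mk]

theorem SmoothCurve.ext_coe {ξ ζ : SmoothCurve n}
    (h : ∀ t : ℝ, ξ.toFun (t : UnitAddCircle) = ζ.toFun (t : UnitAddCircle)) : ξ = ζ := by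
  obtain ⟨f, hf⟩ := ξ
  obtain ⟨g, hg⟩ := ζ
  congr
  funext x
  induction x using QuotientAddGroup.induction_on with
  | H t => exact h t

theorem eq_frameCurve (hn : 1 ≤ n) (hv : IsFrame v) {ξ : SmoothCurve n} (h : IsLift ξ.toFun v) :
    ξ = frameCurve hn hv :=
  SmoothCurve.ext_coe fun t => (h.2 t).2

theorem IsFrame.clm (hv : IsFrame v) (L : E n ≃L[ℝ] E n) : IsFrame fun t => L (v t) := by
  refine ⟨L.contDiff.comp hv.smooth, fun t => ?_, ?_⟩
  · have h := (hv.nondeg t).map' (L : E n →ₗ[ℝ] E n) (LinearEquiv.ker L.toLinearEquiv)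
    have he := fun k : ℕ => iteratedDeriv_clm_comp (L : E n →L[ℝ] E n) hv.smooth k t
    simp only [ContinuousLinearEquiv.coe_coe] at he
    simp only [he]
    exact h
  · obtain ⟨ε, hε, h⟩ := hv.period
    exact ⟨ε, hε, fun t => by rw [h, map_smul]⟩

theorem Alternates.of_clm {L : E n →L[ℝ] E n} (h : Alternates fun t => L (v t)) : Alternates v := by
  obtain ⟨l, t, ht, h1, h2⟩ := h
  refine ⟨ContinuousLinearMap.adjoint L l, t, ht, h1, fun i => ?_⟩
  rw [ContinuousLinearMap.adjoint_inner_left]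
  exact h2 i

/-- Two lifts of the same curve differ by a smooth function without zeros. -/
theorem IsLift.exists_smul {ξ : UnitAddCircle → Projectivization ℝ (E n)} (hv : IsLift ξ v)
    (hw : IsLift ξ w) : ∃ c : ℝ → ℝ, ContDiff ℝ ∞ c ∧ (∀ t, c t ≠ 0) ∧ ∀ t, w t = c t • v t := by
  have h0 : ∀ t, inner ℝ (v t) (v t) ≠ 0 := fun t => inner_self_ne_zero.2 (hv.2 t).1
  have hc : ∀ t, ∃ a : ℝ, a • v t = w t := fun t => by
    obtain ⟨h1, h2⟩ := hv.2 t
    obtain ⟨h3, h4⟩ := hw.2 t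
    rw [h2, eq_comm, Projectivization.mk_eq_mk_iff'] at h4
    exact h4
  have he : ∀ t, w t = (inner ℝ (v t) (w t) / inner ℝ (v t) (v t)) • v t := fun t => by
    obtain ⟨a, ha⟩ := hc t
    rw [← ha, inner_smul_right, mul_div_cancel_right₀ _ (h0 t)]
  refine ⟨fun t => inner ℝ (v t) (w t) / inner ℝ (v t) (v t),
    (hv.1.inner ℝ hw.1).div (hv.1.inner ℝ hv.1) h0, fun t h => (hw.2 t).1 ?_, he⟩
  rw [he t]
  simp only at h
  rw [h, zero_smul]

theorem eq_const_of_pow {c : ℝ → ℝ} (hc : ContDiff ℝ ∞ c) (h0 : ∀ t, c t ≠ 0) (hn : 1 ≤ n) {a : ℝ}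
    (h : ∀ t, c t ^ n = a) (t : ℝ) : c t = c 0 := by
  have hd : Differentiable ℝ c := hc.differentiable (by simp)
  refine is_const_of_deriv_eq_zero hd (fun s => ?_) t 0
  have h1 := (hd s).hasDerivAt.fun_pow n
  rw [funext h] at h1
  have h2 := h1.unique (hasDerivAt_const s a)
  have : (n : ℝ) * c s ^ (n - 1) ≠ 0 :=
    mul_ne_zero (by exact_mod_cast (by omega)) (pow_ne_zero _ (h0 s))
  exact (mul_eq_zero.1 h2).resolve_left this

/-- An oper is determined by one nondegenerate solution. -/
theorem Oper.VecSol.oper_eq {D D' : Oper n} (h : D.VecSol v) (h' : D'.VecSol v)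
    (hi : ∀ t, LinearIndependent ℝ fun k : Fin n => iteratedDeriv (k : ℕ) v t) : D = D' := by
  have key : ∀ (j : Fin (n - 1)) (t : ℝ), D.coeff j t = D'.coeff j t := by
    intro j t
    have h1 : ∑ j : Fin (n - 1), (D.coeff j t - D'.coeff j t) • iteratedDeriv (j : ℕ) v t = 0 := by
      simp only [sub_smul, Finset.sum_sub_distrib, sub_eq_zero]
      exact add_left_cancel ((h.2 t).trans (h'.2 t).symm)
    have hli := (hi t).comp (fun j : Fin (n - 1) => (⟨(j : ℕ), by omega⟩ : Fin n))
      fun a b hab => Fin.ext (by simpa using hab)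
    exact sub_eq_zero.1 (Fintype.linearIndependent_iff.1 hli _ h1 j)
  obtain ⟨f, hf⟩ := D
  obtain ⟨g, hg⟩ := D'
  congr
  funext j x
  induction x using QuotientAddGroup.induction_on with
  | H t => exact key j t

/-- An oper is determined by the curve of a nondegenerate solution. -/
theorem Oper.VecSol.oper_eq_of_isLift (hn : 1 ≤ n) {D D' : Oper n}
    {ξ : UnitAddCircle → Projectivization ℝ (E n)} (h : D.VecSol v) (h' : D'.VecSol w)
    (hv : wronskian v 0 ≠ 0) (hξ : IsLift ξ v) (hξ' : IsLift ξ w) : D = D' := by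
  obtain ⟨c, hc, hc0, hcw⟩ := hξ.exists_smul hξ'
  have h1 : ∀ t, c t ^ n = wronskian w 0 / wronskian v 0 := fun t => by
    rw [eq_div_iff hv, ← h.wronskian_eq hn t 0, ← wronskian_smul hc h.1, ← funext hcw,
      h'.wronskian_eq hn]
  have h2 := eq_const_of_pow hc hc0 hn h1
  have h3 : v = fun t => ((c 0)⁻¹ • ContinuousLinearMap.id ℝ (E n)) (w t) := by
    funext t
    simp [hcw t, h2 t, smul_smul, mul_inv_cancel₀ (hc0 0)]
  refine h.oper_eq (h3 ▸ h'.clm _) fun t => (wronskian_ne_zero_iff h.1 t).1 ?_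
  rwa [h.wronskian_eq hn t 0]

theorem Oper.HasTrivialHolonomy.isFrame {D : Oper n} (hn : 1 ≤ n) (hD : D.HasTrivialHolonomy)
    (hv : D.VecSol v) (h0 : wronskian v 0 ≠ 0) : IsFrame v := by
  refine ⟨hv.1, fun t => (wronskian_ne_zero_iff hv.1 t).1 (by rwa [hv.wronskian_eq hn t 0]), ?_⟩
  obtain ⟨ε, hε, h⟩ := hD
  refine ⟨ε, hε, fun t => ?_⟩
  ext i
  exact h _ (Oper.vecSol_iff_coord.1 hv i) t

theorem Oper.isAssociated_iff {D : Oper n} (hn : 1 ≤ n)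
    {ξ : UnitAddCircle → Projectivization ℝ (E n)} :
    D.IsAssociated ξ ↔ ∃ v, D.VecSol v ∧ 0 < wronskian v 0 ∧ IsLift ξ v := by
  constructor
  · rintro ⟨v, h1, h2, h3⟩
    exact ⟨v, Oper.vecSol_iff_coord.2 h1, h2 0, h3⟩
  · rintro ⟨v, h1, h2, h3⟩
    exact ⟨v, Oper.vecSol_iff_coord.1 h1, fun t => by rwa [h1.wronskian_eq hn t 0], h3⟩

/-- The curves associated to an oper differ by a linear map with determinant one. -/
theorem Oper.IsAssociated.exists_equiv {D : Oper n} (hn : 1 ≤ n)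
    {ξ ζ : UnitAddCircle → Projectivization ℝ (E n)} (hξ : D.IsAssociated ξ)
    (hζ : D.IsAssociated ζ) : ∃ g : E n ≃ₗ[ℝ] E n, LinearMap.det (g : E n →ₗ[ℝ] E n) = 1 ∧
      ∀ x, ζ x = Projectivization.map (g : E n →ₗ[ℝ] E n) g.injective (ξ x) := by
  obtain ⟨v, hv, hv0, hvξ⟩ := (Oper.isAssociated_iff hn).1 hξ
  obtain ⟨w, hw, hw0, hwζ⟩ := (Oper.isAssociated_iff hn).1 hζ
  obtain ⟨L, hL⟩ := hv.exists_clm hn hw ((wronskian_ne_zero_iff hv.1 0).1 hv0.ne')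
  have hdet : 0 < LinearMap.det (L : E n →ₗ[ℝ] E n) := by
    rw [funext hL, wronskian_clm L hv.1] at hw0
    exact pos_of_mul_pos_left hw0 hv0.le
  set d := LinearMap.det (L : E n →ₗ[ℝ] E n) with hd
  -- The positive scalar `d ^ (-1 / n)` brings the determinant to 1 and acts trivially on the
  -- projective space.
  set a : ℝ := (d ^ (n⁻¹ : ℝ))⁻¹ with ha
  have hapos : 0 < a := inv_pos.2 (Real.rpow_pos_of_pos hdet _)
  have han : a ^ n * d = 1 := by
    rw [ha, inv_pow, Real.rpow_inv_natCast_pow hdet.le (by omega), inv_mul_cancel₀ hdet.ne']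
  have hdet' : LinearMap.det (a • (L : E n →ₗ[ℝ] E n)) = 1 := by
    rw [LinearMap.det_smul, ← hd]
    simpa using han
  set g := LinearMap.equivOfDetNeZero (a • (L : E n →ₗ[ℝ] E n)) (by rw [hdet']; exact one_ne_zero)
  have hgL : (g : E n →ₗ[ℝ] E n) = a • (L : E n →ₗ[ℝ] E n) := by
    ext1 x; rfl
  refine ⟨g, by rw [hgL, hdet'], fun x => ?_⟩
  induction x using QuotientAddGroup.induction_on with
  | H t =>
    obtain ⟨h1, h2⟩ := hvξ.2 t
    obtain ⟨h3, h4⟩ := hwζ.2 t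
    have e1 : ξ (QuotientAddGroup.mk t) = Projectivization.mk ℝ (v t) h1 := h2
    have e2 : ζ (QuotientAddGroup.mk t) = Projectivization.mk ℝ (w t) h3 := h4
    rw [e1, e2, Projectivization.map_mk, Projectivization.mk_eq_mk_iff']
    refine ⟨a⁻¹, ?_⟩
    rw [hL t, hgL, LinearMap.smul_apply, smul_smul, inv_mul_cancel₀ hapos.ne', one_smul]
    rfl

/-- Opers with equivalent associated curves are equal. -/
theorem Oper.IsAssociated.oper_eq {D D' : Oper n} (hn : 1 ≤ n)
    {ξ ζ : UnitAddCircle → Projectivization ℝ (E n)} (hξ : D.IsAssociated ξ)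
    (hζ : D'.IsAssociated ζ) (g : E n ≃ₗ[ℝ] E n)
    (hg : ∀ x, ζ x = Projectivization.map (g : E n →ₗ[ℝ] E n) g.injective (ξ x)) : D = D' := by
  obtain ⟨v, hv, hv0, hvξ⟩ := (Oper.isAssociated_iff hn).1 hξ
  obtain ⟨w, hw, hw0, hwζ⟩ := (Oper.isAssociated_iff hn).1 hζ
  set L : E n →L[ℝ] E n := LinearMap.toContinuousLinearMap (g : E n →ₗ[ℝ] E n) with hL
  refine (hv.clm L).oper_eq_of_isLift hn hw ?_ (ξ := ζ) ⟨(hv.clm L).1, fun t => ?_⟩ hwζ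
  · rw [wronskian_clm L hv.1]
    exact mul_ne_zero (LinearEquiv.isUnit_det' g).ne_zero hv0.ne'
  · obtain ⟨h1, h2⟩ := hvξ.2 t
    exact ⟨fun h => h1 (g.injective (by simpa [hL] using h)), by rw [hg, h2]; rfl⟩

/-- A solution of the equation of an oper whose derivatives at `0` are the standard basis. -/
def fundSol (hn : 1 ≤ n) : Oper n → ℝ → E n :=
  (exists_vecSol hn fun i : Fin n => EuclideanSpace.single i (1 : ℝ)).choose

theorem jetSmooth_fundSol (hn : 1 ≤ n) : JetSmooth (fundSol hn) univ :=
  (exists_vecSol hn fun i : Fin n => EuclideanSpace.single i (1 : ℝ)).choose_spec.1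

theorem vecSol_fundSol (hn : 1 ≤ n) (D : Oper n) : D.VecSol (fundSol hn D) :=
  (exists_vecSol hn fun i : Fin n => EuclideanSpace.single i (1 : ℝ)).choose_spec.2.1 D

theorem wronskian_fundSol (hn : 1 ≤ n) (D : Oper n) : wronskian (fundSol hn D) 0 = 1 := by
  have h := (exists_vecSol hn fun i : Fin n => EuclideanSpace.single i (1 : ℝ)).choose_spec.2.2 D
  rw [wronskian_eq (vecSol_fundSol hn D).1, ← Matrix.det_one (n := Fin n)]
  congr 1
  ext i j
  rw [jetMatrix, Matrix.of_apply]
  refine (congrArg (fun x : E n => x j) (h i)).trans ?_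
  simp [Matrix.one_apply, eq_comm]

theorem Oper.HasTrivialHolonomy.isFrame_fundSol {D : Oper n} (hn : 1 ≤ n)
    (hD : D.HasTrivialHolonomy) : IsFrame (fundSol hn D) :=
  hD.isFrame hn (vecSol_fundSol hn D) (by simp [wronskian_fundSol])

theorem Oper.HasTrivialHolonomy.isAssociated {D : Oper n} (hn : 1 ≤ n)
    (hD : D.HasTrivialHolonomy) :
    D.IsAssociated (frameCurve hn (hD.isFrame_fundSol hn)).toFun :=
  (Oper.isAssociated_iff hn).2 ⟨_, vecSol_fundSol hn D, by simp [wronskian_fundSol],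
    isLift_frameCurve hn _⟩

end Curves

/-! ### The oper of a nondegenerate curve -/

section CurveToOper

variable {X : Type*} [TopologicalSpace X] {n : ℕ} {v w : ℝ → E n}

theorem jetSmooth_det {M : X → ℝ → Matrix (Fin n) (Fin n) ℝ} {U : Set (X × ℝ)} (hU : IsOpen U)
    (h : ∀ i j, JetSmooth (fun x t => M x t i j) U) : JetSmooth (fun x t => (M x t).det) U := by
  intro k
  simp only [Matrix.det_apply']
  exact JetCont.sum hU _ fun σ _ => (JetCont.const _ continuous_const).mul hU
    (JetCont.prod hU _ fun i _ => h _ _ k)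

theorem JetSmooth.entry {v : X → ℝ → E n} {U : Set (X × ℝ)} (hU : IsOpen U) (hv : JetSmooth v U)
    (i : ℕ) (j : Fin n) : JetSmooth (fun x t => _root_.iteratedDeriv i (v x) t j) U :=
  fun k => (hv.iteratedDeriv i k).clm hU (EuclideanSpace.proj j : E n →L[ℝ] ℝ)

theorem JetSmooth.det_jetMatrix {v : X → ℝ → E n} {U : Set (X × ℝ)} (hU : IsOpen U)
    (hv : JetSmooth v U) : JetSmooth (fun x t => (jetMatrix (v x) t).det) U :=
  jetSmooth_det hU fun i j => hv.entry hU i j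

theorem JetSmooth.wronskian {v : X → ℝ → E n} (hv : JetSmooth v univ) :
    JetSmooth (fun x => wronskian (v x)) univ := fun k =>
  (hv.det_jetMatrix isOpen_univ k).congr isOpen_univ fun p _ => wronskian_eq (hv.contDiff p.1) p.2

/-- The matrix of derivatives, with one row replaced by the derivative of order `n`. -/
def cramerMatrix (v : ℝ → E n) (j : Fin n) (t : ℝ) : Matrix (Fin n) (Fin n) ℝ :=
  (jetMatrix v t).updateRow j fun i => iteratedDeriv n v t i

/-- The coefficients of the equation satisfied by a nondegenerate curve. -/
def cramerCoeff (v : ℝ → E n) (j : Fin n) (t : ℝ) : ℝ :=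
  -((cramerMatrix v j t).det * ((jetMatrix v t).det)⁻¹)

theorem JetSmooth.cramerCoeff {v : X → ℝ → E n} {U : Set (X × ℝ)} (hU : IsOpen U)
    (hv : JetSmooth v U) (h0 : ∀ p ∈ U, (jetMatrix (v p.1) p.2).det ≠ 0) (j : Fin n) :
    JetSmooth (fun x => cramerCoeff (v x) j) U := by
  have h1 : JetSmooth (fun x t => (cramerMatrix (v x) j t).det) U := by
    refine jetSmooth_det hU fun i k => ?_
    by_cases hij : i = j
    · subst hij
      simpa only [cramerMatrix, Matrix.updateRow_self] using hv.entry hU n k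
    · simp only [cramerMatrix, Matrix.updateRow_ne hij]
      exact hv.entry hU i k
  intro k
  exact (((h1 k).mul hU ((hv.det_jetMatrix hU k).comp hU (isOpen_compl_singleton (x := 0))
    (contDiffOn_inv ℝ) h0)).clm hU (-ContinuousLinearMap.id ℝ ℝ))

/-- Both determinants scale by the same power of `a`. The coefficients are thus insensitive to the
sign of the lift, which makes them periodic and computable from local lifts. -/
theorem cramerCoeff_congr {a : ℝ} (ha : a ≠ 0) {t : ℝ} (h : w =ᶠ[𝓝 t] fun s => a • v s)
    (j : Fin n) : cramerCoeff w j t = cramerCoeff v j t := by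
  have hd : ∀ k, iteratedDeriv k w t = a • iteratedDeriv k v t := fun k => by
    rw [h.iteratedDeriv_eq k]
    exact iteratedDeriv_const_smul_field a v
  have h1 : jetMatrix w t = a • jetMatrix v t := by
    ext i k; simp [jetMatrix, hd]
  have h2 : cramerMatrix w j t = a • cramerMatrix v j t := by
    ext i k
    by_cases hij : i = j
    · subst hij
      simp [cramerMatrix, hd]
    · simp [cramerMatrix, Matrix.updateRow_ne hij, h1]
  rw [cramerCoeff, cramerCoeff, h1, h2, Matrix.det_smul, Matrix.det_smul]
  have : a ^ Fintype.card (Fin n) ≠ 0 := pow_ne_zero _ ha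
  rw [mul_inv]
  field_simp

theorem iteratedDeriv_eq_cramerCoeff {t : ℝ}
    (hi : LinearIndependent ℝ fun k : Fin n => iteratedDeriv (k : ℕ) v t) (hn : 1 ≤ n) :
    iteratedDeriv n v t = ∑ j : Fin n, (-cramerCoeff v j t) • iteratedDeriv (j : ℕ) v t := by
  have : Nonempty (Fin n) := ⟨⟨0, hn⟩⟩
  set b := basisOfLinearIndependentOfCardEqFinrank hi (by simp) with hb
  have hdet : (jetMatrix v t).det ≠ 0 := linearIndependent_iff_det_ne_zero.1 hi
  have hsum : iteratedDeriv n v t = ∑ j : Fin n, b.repr (iteratedDeriv n v t) j •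
      iteratedDeriv (j : ℕ) v t := by
    conv_lhs => rw [← b.sum_repr (iteratedDeriv n v t)]
    simp [hb]
  have hc : ∀ j, -cramerCoeff v j t = b.repr (iteratedDeriv n v t) j := fun j => by
    have h2 : (fun i => iteratedDeriv n v t i) =
        ∑ k : Fin n, b.repr (iteratedDeriv n v t) k • jetMatrix v t k := by
      funext i
      conv_lhs => rw [hsum]
      simp [jetMatrix, Finset.sum_apply]
    rw [cramerCoeff, neg_neg, cramerMatrix, h2, Matrix.det_updateRow_sum, smul_eq_mul, mul_assoc,
      mul_inv_cancel₀ hdet, mul_one]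
  simp only [hc]
  exact hsum

/-- A normalized frame satisfies the equation of an oper. -/
theorem exists_oper (hn : 1 ≤ n) (hv : IsFrame v) (hW : ∀ t, wronskian v t ^ 2 = 1) :
    ∃ D : Oper n, D.VecSol v ∧ D.HasTrivialHolonomy ∧ ∀ (j : Fin (n - 1)) (t : ℝ),
      D.coeff j (t : UnitAddCircle) = cramerCoeff v ⟨(j : ℕ), by omega⟩ t := by
  have hdet : ∀ t, (jetMatrix v t).det ≠ 0 := fun t =>
    linearIndependent_iff_det_ne_zero.1 (hv.nondeg t)
  obtain ⟨ε, hε, hper⟩ := hv.period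
  have hε0 : ε ≠ 0 := by rcases hε with rfl | rfl <;> norm_num
  have hp : ∀ j : Fin n, Function.Periodic (cramerCoeff v j) 1 := fun j t => by
    rw [← cramerCoeff_congr (w := fun s => v (s + 1)) (t := t) hε0
      (Eventually.of_forall fun s => hper s) j]
    simp only [cramerCoeff, cramerMatrix, jetMatrix, iteratedDeriv_comp_add]
  set D : Oper n := ⟨fun j => (hp ⟨(j : ℕ), by omega⟩).lift, fun j =>
    ((jetSmooth_const (X := Unit) hv.smooth).cramerCoeff isOpen_univ
      (fun p _ => hdet p.2) ⟨(j : ℕ), by omega⟩).contDiff ()⟩ with hD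
  -- The Wronskian is ±1, so its square has zero derivative, and Liouville's formula kills the
  -- coefficient of order n - 1.
  have hlast : ∀ t, cramerCoeff v ⟨n - 1, by omega⟩ t = 0 := fun t => by
    have h1 := hasDerivAt_wronskian_of_eq hn hv.smooth
      (iteratedDeriv_eq_cramerCoeff (hv.nondeg t) hn)
    have h2 := h1.fun_pow 2
    rw [funext hW] at h2
    have h3 := h2.unique (hasDerivAt_const t 1)
    have h4 : wronskian v t ≠ 0 := fun h => by simpa [h] using hW t
    simpa [h4] using h3
  have hsol : D.VecSol v := by
    refine ⟨hv.smooth, fun t => ?_⟩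
    rw [iteratedDeriv_eq_cramerCoeff (hv.nondeg t) hn]
    have hl := hlast t
    have hco : ∀ j : Fin (n - 1), D.coeff j (t : UnitAddCircle) =
      cramerCoeff v ⟨(j : ℕ), by omega⟩ t := fun j => rfl
    simp only [hco]
    clear_value D
    clear hco hD hp
    obtain ⟨m, rfl⟩ : ∃ m, n = m + 1 := ⟨n - 1, by omega⟩
    rw [Fin.sum_univ_castSucc]
    have hl' : cramerCoeff v (Fin.last m) t = 0 := hl
    rw [hl', neg_zero, zero_smul, add_zero]
    change (∑ j : Fin m, _) + ∑ j : Fin m, _ = _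
    rw [← Finset.sum_add_distrib]
    refine Finset.sum_eq_zero fun j _ => ?_
    change -cramerCoeff v j.castSucc t • iteratedDeriv (j : ℕ) v t +
      cramerCoeff v j.castSucc t • iteratedDeriv (j : ℕ) v t = 0
    rw [neg_smul, neg_add_cancel]
  refine ⟨D, hsol, ⟨ε, hε, fun ψ hψ t => ?_⟩, fun j t => rfl⟩
  -- Every scalar solution is a linear form of `v`, so it inherits the sign `ε`.
  obtain ⟨L, hL⟩ := hsol.exists_clm hn (Oper.isSolution_iff_vecSol.1 hψ) (hv.nondeg 0)
  rw [hL, hL, hper, map_smul, smul_eq_mul]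

/-- The factor which normalizes a vector whose Wronskian is `x`. -/
def normFactor (n : ℕ) (x : ℝ) : ℝ := (x ^ 2) ^ (-(2 * n : ℝ)⁻¹)

theorem contDiffOn_normFactor : ContDiffOn ℝ ∞ (normFactor n) {0}ᶜ := by
  refine ContDiffOn.rpow_const_of_ne (contDiff_id.pow 2).contDiffOn fun x hx => ?_
  exact pow_ne_zero 2 hx

theorem normFactor_pow (hn : 1 ≤ n) {x : ℝ} (hx : x ≠ 0) :
    (normFactor n x ^ n * x) ^ 2 = 1 := by
  have h2 : (normFactor n x) ^ (2 * n) = (x ^ 2)⁻¹ := by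
    rw [normFactor, Real.rpow_neg (sq_nonneg x), inv_pow]
    have := Real.rpow_inv_natCast_pow (sq_nonneg x) (n := 2 * n) (by omega)
    push_cast at this
    rw [this]
  rw [mul_pow, ← pow_mul, mul_comm n 2, h2, inv_mul_cancel₀ (pow_ne_zero 2 hx)]

theorem normFactor_pow_mul (hn : 1 ≤ n) {c x : ℝ} (hx : x ^ 2 = 1) :
    normFactor n (c ^ n * x) = |c|⁻¹ := by
  rw [normFactor, mul_pow, hx, mul_one, Real.rpow_neg (sq_nonneg _), ← pow_mul, mul_comm n 2,
    pow_mul, ← sq_abs, ← pow_mul]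
  congr 1
  have := Real.pow_rpow_inv_natCast (abs_nonneg c) (n := 2 * n) (by omega)
  push_cast at this
  exact this

theorem normFactor_pos {x : ℝ} (hx : x ≠ 0) : 0 < normFactor n x :=
  Real.rpow_pos_of_pos (by positivity) _

/-- A nondegenerate curve has a lift whose Wronskian is `1` or `-1`. -/
theorem exists_normalized_lift (hn : 1 ≤ n) {ξ : UnitAddCircle → Projectivization ℝ (E n)}
    (h : IsNondegenerate ξ) : ∃ v, IsLift ξ v ∧ ∀ t, wronskian v t ^ 2 = 1 := by
  obtain ⟨η, hη, hi⟩ := h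
  have hW : ∀ t, wronskian η t ≠ 0 := fun t => (wronskian_ne_zero_iff hη.1 t).2 (hi t)
  have hWs : ContDiff ℝ ∞ (wronskian η) :=
    (jetSmooth_const (X := Unit) hη.1).wronskian.contDiff ()
  have hφ : ContDiff ℝ ∞ fun t => normFactor n (wronskian η t) :=
    contDiffOn_normFactor.comp_contDiff hWs hW
  refine ⟨fun t => normFactor n (wronskian η t) • η t, ⟨hφ.smul hη.1, fun t => ?_⟩, fun t => ?_⟩
  · obtain ⟨h1, h2⟩ := hη.2 t
    refine ⟨smul_ne_zero (normFactor_pos (hW t)).ne' h1, ?_⟩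
    rw [h2, eq_comm, Projectivization.mk_eq_mk_iff']
    exact ⟨_, rfl⟩
  · rw [wronskian_smul hφ hη.1, normFactor_pow hn (hW t)]

/-- The translate of `v` by the period lifts the same closed curve, so it is `c • v`. Comparing
Wronskians gives `c ^ (2 * n) = 1`, and `c` is a constant sign. -/
theorem isFrame_of_normalized (hn : 1 ≤ n) {ξ : UnitAddCircle → Projectivization ℝ (E n)}
    (hv : IsLift ξ v) (hW : ∀ t, wronskian v t ^ 2 = 1) : IsFrame v := by
  have hi := fun t => (wronskian_ne_zero_iff hv.1 t).1 fun h => by simpa [h] using hW t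
  refine ⟨hv.1, hi, ?_⟩
  have hv' : IsLift ξ fun t => v (t + 1) := by
    refine ⟨hv.1.comp (contDiff_id.add contDiff_const), fun t => ?_⟩
    obtain ⟨h1, h2⟩ := hv.2 (t + 1)
    refine ⟨h1, ?_⟩
    rw [← h2]
    congr 1
    simp
  obtain ⟨c, hc, hc0, hcv⟩ := hv.exists_smul hv'
  have hpow : ∀ t, c t ^ (2 * n) = 1 := fun t => by
    have h1 := wronskian_smul hc hv.1 t
    rw [← funext hcv] at h1
    have h2 : wronskian (fun t => v (t + 1)) t = wronskian v (t + 1) := by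
      rw [wronskian_eq hv'.1, wronskian_eq hv.1]
      simp only [jetMatrix, iteratedDeriv_comp_add]
    have h3 := hW (t + 1)
    rw [← h2, h1, mul_pow, hW t, mul_one, ← pow_mul, mul_comm n 2] at h3
    exact h3
  have hconst := eq_const_of_pow hc hc0 (n := 2 * n) (by omega) hpow
  refine ⟨c 0, ?_, fun t => by rw [hcv t, hconst t]⟩
  have h4 := hpow 0
  rw [pow_mul] at h4
  have h5 := (pow_eq_one_iff_of_nonneg (sq_nonneg _) (by omega)).1 h4
  exact sq_eq_sq_iff_eq_or_eq_neg.1 (by rw [h5, one_pow])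

end CurveToOper

/-! ### Continuous dependence of the oper on the curve -/

section CurveToOper

variable {X : Type*} [TopologicalSpace X] {n : ℕ} {v w : ℝ → E n}

theorem exists_oper_of_isNondegenerate (hn : 1 ≤ n)
    {ξ : UnitAddCircle → Projectivization ℝ (E n)} (h : IsNondegenerate ξ) :
    ∃ (D : Oper n) (v : ℝ → E n), D.VecSol v ∧ IsLift ξ v ∧ (∀ t, wronskian v t ^ 2 = 1) ∧
      D.HasTrivialHolonomy ∧ ∀ (j : Fin (n - 1)) (t : ℝ),
        D.coeff j (t : UnitAddCircle) = cramerCoeff v ⟨(j : ℕ), by omega⟩ t := by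
  obtain ⟨v, hv, hW⟩ := exists_normalized_lift hn h
  obtain ⟨D, h1, h2, h3⟩ := exists_oper hn (isFrame_of_normalized hn hv hW) hW
  exact ⟨D, v, h1, hv, hW, h2, h3⟩

/-- The oper of a nondegenerate curve. -/
def curveOper (hn : 1 ≤ n) {ξ : UnitAddCircle → Projectivization ℝ (E n)}
    (h : IsNondegenerate ξ) : Oper n := (exists_oper_of_isNondegenerate hn h).choose

theorem curveOper_spec (hn : 1 ≤ n) {ξ : UnitAddCircle → Projectivization ℝ (E n)}
    (h : IsNondegenerate ξ) :
    ∃ v : ℝ → E n, (curveOper hn h).VecSol v ∧ IsLift ξ v ∧ (∀ t, wronskian v t ^ 2 = 1) ∧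
      (curveOper hn h).HasTrivialHolonomy ∧ ∀ (j : Fin (n - 1)) (t : ℝ),
        (curveOper hn h).coeff j (t : UnitAddCircle) = cramerCoeff v ⟨(j : ℕ), by omega⟩ t :=
  (exists_oper_of_isNondegenerate hn h).choose_spec

theorem lineProj_apply_of_isLift {ξ : UnitAddCircle → Projectivization ℝ (E n)} (hv : IsLift ξ v)
    (u : E n) (t : ℝ) : lineProj (ξ (t : UnitAddCircle)) u = ((‖v t‖ ^ 2)⁻¹ * inner ℝ (v t) u) • v t := by
  obtain ⟨h1, h2⟩ := hv.2 t
  rw [h2, lineProj_mk]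
  simp [smul_smul]

theorem contDiff_lineProj_factor {ξ : UnitAddCircle → Projectivization ℝ (E n)} (hv : IsLift ξ v)
    (u : E n) : ContDiff ℝ ∞ fun t => (‖v t‖ ^ 2)⁻¹ * inner ℝ (v t) u :=
  ((hv.1.norm_sq ℝ).inv fun t => pow_ne_zero 2 (norm_ne_zero_iff.2 (hv.2 t).1)).mul
    (hv.1.inner ℝ contDiff_const)

theorem jetSmooth_lineProj_apply {Φ : X → SmoothCurve n} (hΦ : Continuous Φ) (u : E n) :
    JetSmooth (fun x (t : ℝ) => lineProj ((Φ x).toFun (t : UnitAddCircle)) u) univ := fun k =>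
  (continuous_smoothCurve_iff.1 hΦ k).clm isOpen_univ (ContinuousLinearMap.apply ℝ (E n) u)

theorem wronskian_lineProj_apply {ξ : UnitAddCircle → Projectivization ℝ (E n)} (hv : IsLift ξ v)
    (u : E n) (t : ℝ) : wronskian (fun t : ℝ => lineProj (ξ (t : UnitAddCircle)) u) t =
      ((‖v t‖ ^ 2)⁻¹ * inner ℝ (v t) u) ^ n * wronskian v t := by
  simp only [lineProj_apply_of_isLift hv]
  exact wronskian_smul (contDiff_lineProj_factor hv u) hv.1 t

/-- The lifts in `curveOper_spec` are chosen without continuity in `x`. Near a given point,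
projecting a fixed vector `u` to the line of the curve gives a lift that depends on `x` as well as
the curve does. Once normalized it agrees locally, up to sign, with the chosen lift, and the sign
does not affect the coefficients. -/
theorem continuous_curveOper (hn : 1 ≤ n) {Φ : X → SmoothCurve n} (hΦ : Continuous Φ)
    (h : ∀ x, IsNondegenerate (Φ x).toFun) : Continuous fun x => curveOper hn (h x) := by
  rw [continuous_oper_iff]
  intro j k
  refine JetCont.of_locally fun p₀ => ?_
  obtain ⟨v₀, -, hv₀, hW₀, -, -⟩ := curveOper_spec hn (h p₀.1)
  set u := v₀ p₀.2 with hu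
  set η : X → ℝ → E n := fun x t => lineProj ((Φ x).toFun (t : UnitAddCircle)) u with hη
  have hηs : JetSmooth η univ := jetSmooth_lineProj_apply hΦ u
  -- On `U` the projection of `u` is a nonzero vector of the line and the Wronskian can be
  -- normalized.
  set U : Set (X × ℝ) := {p | wronskian (η p.1) p.2 ≠ 0} with hUdef
  have hWc : Continuous fun p : X × ℝ => wronskian (η p.1) p.2 :=
    continuousOn_univ.1 (hηs.wronskian 0).continuousOn
  have hU : IsOpen U := isOpen_ne_fun hWc continuous_const
  have hp₀ : p₀ ∈ U := by
    have h0 : u ≠ 0 := (hv₀.2 p₀.2).1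
    change wronskian (η p₀.1) p₀.2 ≠ 0
    rw [wronskian_lineProj_apply hv₀, ← hu, real_inner_self_eq_norm_sq,
      inv_mul_cancel₀ (pow_ne_zero 2 (norm_ne_zero_iff.2 h0)), one_pow, one_mul]
    intro h'
    simpa [h'] using hW₀ p₀.2
  have hn0 : n ≠ 0 := by omega
  set ω' : X → ℝ → E n := fun x t => normFactor n (wronskian (η x) t) • η x t with hω
  have hωs : JetSmooth ω' U := fun k =>
    (((hηs.wronskian k).mono_set (subset_univ U)).comp hU (isOpen_compl_singleton (x := 0))
      contDiffOn_normFactor fun p hp => hp).smul hU ((hηs k).mono_set (subset_univ U))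
  have key : ∀ p ∈ U, ∃ v : ℝ → E n, IsLift (Φ p.1).toFun v ∧ (∀ t, wronskian v t ^ 2 = 1) ∧
      (∀ t : ℝ, (curveOper hn (h p.1)).coeff j (t : UnitAddCircle) =
        cramerCoeff v ⟨(j : ℕ), by omega⟩ t) ∧
      ∃ a : ℝ, a ≠ 0 ∧ ω' p.1 =ᶠ[𝓝 p.2] fun t => a • v t := by
    intro p hp
    obtain ⟨v, -, hv, hW, -, hco⟩ := curveOper_spec hn (h p.1)
    set c : ℝ → ℝ := fun t => (‖v t‖ ^ 2)⁻¹ * inner ℝ (v t) u with hc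
    have hcc : Continuous c := (contDiff_lineProj_factor hv u).continuous
    have hWη : ∀ t, wronskian (η p.1) t = c t ^ n * wronskian v t := fun t =>
      wronskian_lineProj_apply hv u t
    have hcp : c p.2 ≠ 0 := fun h0 => hp (by rw [hWη, h0, zero_pow hn0, zero_mul])
    have hω' : ∀ t, ω' p.1 t = (|c t|⁻¹ * c t) • v t := fun t => by
      change normFactor n (wronskian (η p.1) t) • lineProj ((Φ p.1).toFun (t : UnitAddCircle)) u = _
      rw [hWη, normFactor_pow_mul hn (hW t), lineProj_apply_of_isLift hv, smul_smul]
    refine ⟨v, hv, hW, hco j, ?_⟩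
    rcases lt_or_gt_of_ne hcp with hneg | hpos
    · refine ⟨-1, by norm_num, ?_⟩
      filter_upwards [hcc.continuousAt.eventually (gt_mem_nhds hneg)] with t ht
      rw [hω', abs_of_neg ht, inv_neg, neg_mul, inv_mul_cancel₀ ht.ne]
    · refine ⟨1, by norm_num, ?_⟩
      filter_upwards [hcc.continuousAt.eventually (lt_mem_nhds hpos)] with t ht
      rw [hω', abs_of_pos ht, inv_mul_cancel₀ ht.ne']
  have hdet : ∀ p ∈ U, (jetMatrix (ω' p.1) p.2).det ≠ 0 := by
    intro p hp
    obtain ⟨v, hv, hW, -, a, ha, he⟩ := key p hp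
    have h1 : jetMatrix (ω' p.1) p.2 = a • jetMatrix v p.2 := by
      ext i k
      have : iteratedDeriv (i : ℕ) (ω' p.1) p.2 = a • iteratedDeriv (i : ℕ) v p.2 := by
        rw [he.iteratedDeriv_eq i]
        exact iteratedDeriv_const_smul_field a v
      simp [jetMatrix, this]
    rw [h1, Matrix.det_smul, ← wronskian_eq hv.1]
    exact mul_ne_zero (pow_ne_zero _ ha) fun h' => by simpa [h'] using hW p.2
  refine ⟨U, hU, hp₀, (hωs.cramerCoeff hU hdet ⟨(j : ℕ), by omega⟩ k).congr hU fun p hp => ?_⟩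
  obtain ⟨v, -, -, hco, a, ha, he⟩ := key p hp
  rw [hco, cramerCoeff_congr ha he]

/-! ### Orientation of nondegenerate curves -/

theorem IsLift.const_smul {ξ : UnitAddCircle → Projectivization ℝ (E n)} (hv : IsLift ξ v) {a : ℝ}
    (ha : a ≠ 0) : IsLift ξ fun t => a • v t := by
  refine ⟨hv.1.const_smul a, fun t => ?_⟩
  obtain ⟨h3, h4⟩ := hv.2 t
  refine ⟨smul_ne_zero ha h3, ?_⟩
  rw [h4, eq_comm, Projectivization.mk_eq_mk_iff']
  exact ⟨_, rfl⟩

/-- The curve has a lift whose Wronskian is positive. -/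
def IsPositive (ξ : UnitAddCircle → Projectivization ℝ (E n)) : Prop :=
  ∃ η, IsLift ξ η ∧ 0 < wronskian η 0

/-- Two lifts have Wronskians in the ratio `c ^ n`. For even n the sign does not depend on the lift;
for odd n it can be corrected by replacing `v` with `-v`. -/
theorem isAssociated_curveOper (hn : 1 ≤ n) {ξ : UnitAddCircle → Projectivization ℝ (E n)}
    (h : IsNondegenerate ξ) (hp : IsPositive ξ) : (curveOper hn h).IsAssociated ξ := by
  obtain ⟨v, hsol, hv, hW, -, -⟩ := curveOper_spec hn h
  obtain ⟨η, hη, hpos⟩ := hp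
  obtain ⟨c, hc, hc0, hcη⟩ := hv.exists_smul hη
  rw [Oper.isAssociated_iff hn]
  have h1 := wronskian_smul hc hv.1 0
  rw [← funext hcη] at h1
  rcases Nat.even_or_odd n with he | ho
  · exact ⟨v, hsol, pos_of_mul_pos_right (h1 ▸ hpos) (he.pow_nonneg _), hv⟩
  · have h2 : wronskian v 0 ≠ 0 := fun h => by simpa [h] using hW 0
    rcases lt_or_gt_of_ne h2 with hneg | hpos'
    · refine ⟨fun t => (-1 : ℝ) • v t, hsol.clm ((-1 : ℝ) • ContinuousLinearMap.id ℝ (E n)), ?_,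
        hv.const_smul (by norm_num)⟩
      rw [wronskian_smul contDiff_const hv.1, ho.neg_one_pow]
      linarith
    · exact ⟨v, hsol, hpos', hv⟩

theorem isPositive_iff_of_even (he : Even n) {ξ : UnitAddCircle → Projectivization ℝ (E n)}
    (hv : IsLift ξ v) : IsPositive ξ ↔ 0 < wronskian v 0 := by
  refine ⟨?_, fun h => ⟨v, hv, h⟩⟩
  rintro ⟨η, hη, hpos⟩
  obtain ⟨c, hc, hc0, hcη⟩ := hv.exists_smul hη
  rw [funext hcη, wronskian_smul hc hv.1] at hpos
  exact pos_of_mul_pos_right hpos (he.pow_nonneg _)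

theorem isPositive_of_odd (ho : Odd n) {ξ : UnitAddCircle → Projectivization ℝ (E n)}
    (h : IsNondegenerate ξ) : IsPositive ξ := by
  obtain ⟨v, hv, hi⟩ := h
  have h2 : wronskian v 0 ≠ 0 := (wronskian_ne_zero_iff hv.1 0).2 (hi 0)
  rcases lt_or_gt_of_ne h2 with hneg | hpos
  · refine ⟨fun t => (-1 : ℝ) • v t, hv.const_smul (by norm_num), ?_⟩
    rw [wronskian_smul contDiff_const hv.1, ho.neg_one_pow]
    linarith
  · exact ⟨v, hv, hpos⟩

/-- For odd n every nondegenerate curve is positive. For even n the sign is read off the local lift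
by projection of a fixed vector, whose Wronskian at 0 is a continuous function of the parameter,
nonzero at the chosen curve. -/
theorem isClopen_isPositive {Φ : X → SmoothCurve n} (hΦ : Continuous Φ)
    (h : ∀ x, IsNondegenerate (Φ x).toFun) : IsClopen {x | IsPositive (Φ x).toFun} := by
  rcases Nat.even_or_odd n with he | ho
  swap
  · convert isClopen_univ
    exact eq_univ_of_forall fun x => isPositive_of_odd ho (h x)
  have key : ∀ x₀, ∃ σ : X → ℝ, Continuous σ ∧ σ x₀ ≠ 0 ∧
      ∀ x, σ x ≠ 0 → (IsPositive (Φ x).toFun ↔ 0 < σ x) := by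
    intro x₀
    obtain ⟨v₀, hv₀, hi₀⟩ := h x₀
    have hc : Continuous fun p : X × ℝ => wronskian
        (fun t : ℝ => lineProj ((Φ p.1).toFun (t : UnitAddCircle)) (v₀ 0)) p.2 :=
      continuousOn_univ.1 ((jetSmooth_lineProj_apply hΦ (v₀ 0)).wronskian 0).continuousOn
    obtain ⟨F, hF⟩ : ∃ F : X × ℝ → ℝ, ∀ p, F p = wronskian
        (fun t : ℝ => lineProj ((Φ p.1).toFun (t : UnitAddCircle)) (v₀ 0)) p.2 := ⟨_, fun _ => rfl⟩
    rw [← funext hF] at hc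
    refine ⟨fun x => F (x, 0), hc.comp (Continuous.prodMk_left 0), ?_, fun x hx => ?_⟩
    · beta_reduce
      rw [hF, wronskian_lineProj_apply hv₀, real_inner_self_eq_norm_sq,
        inv_mul_cancel₀ (pow_ne_zero 2 (norm_ne_zero_iff.2 (hv₀.2 0).1)), one_pow, one_mul]
      exact (wronskian_ne_zero_iff hv₀.1 0).2 (hi₀ 0)
    · obtain ⟨v, hv, hi⟩ := h x
      beta_reduce at hx ⊢
      rw [hF, wronskian_lineProj_apply hv] at hx
      rw [hF, wronskian_lineProj_apply hv, isPositive_iff_of_even he hv,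
        mul_pos_iff_of_pos_left ((he.pow_nonneg _).lt_of_ne' (left_ne_zero_of_mul hx))]
  constructor
  · rw [← isOpen_compl_iff, isOpen_iff_mem_nhds]
    intro x₀ hx₀
    obtain ⟨σ, hσ, h0, hi⟩ := key x₀
    have hneg : σ x₀ < 0 := lt_of_le_of_ne (not_lt.1 fun hlt => hx₀ ((hi x₀ h0).2 hlt)) h0
    filter_upwards [hσ.continuousAt.eventually (gt_mem_nhds hneg)] with x hx hpos
    exact absurd ((hi x hx.ne).1 hpos) (not_lt.2 hx.le)
  · rw [isOpen_iff_mem_nhds]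
    intro x₀ hx₀
    obtain ⟨σ, hσ, h0, hi⟩ := key x₀
    filter_upwards [hσ.continuousAt.eventually (lt_mem_nhds ((hi x₀ h0).1 hx₀))] with x hx
    exact (hi x hx.ne').2 hx

end CurveToOper

/-! ### Deformations of frames without sign changes -/

section Clopen

variable {X : Type*} [TopologicalSpace X] {n : ℕ} {v : ℝ → E n}

theorem IsFrame.inner_eq_zero_of_add_int (hv : IsFrame v) {l : E n} {t : ℝ} (m : ℤ)
    (h : inner ℝ l (v t) = 0) : inner ℝ l (v (t + m)) = 0 := by
  obtain ⟨ε, hε, hper⟩ := hv.period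
  induction m using Int.induction_on with
  | zero => simpa using h
  | succ k ih =>
    have := hper (t + (k : ℤ))
    push_cast at this ih ⊢
    rw [← add_assoc, this, inner_smul_right, ih, mul_zero]
  | pred k ih =>
    have := hper (t + ((-k - 1 : ℤ) : ℝ))
    push_cast at this ih ⊢
    rw [show t + (-(k : ℝ) - 1) + 1 = t + -(k : ℝ) by ring] at this
    rw [this, inner_smul_right] at ih
    exact (mul_eq_zero.1 ih).resolve_left (by rcases hε with rfl | rfl <;> norm_num)

/-- The intermediate value theorem gives a zero in each gap. The zeros lie within less than a
period, so reducing them modulo 1 keeps them distinct, and `v` being periodic up to sign keeps them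
zeros. Forms of norm 1 and points in a bounded interval are the data to which compactness applies.
-/
theorem Alternates.exists_zeros (hn : 1 ≤ n) (hv : IsFrame v) (h : Alternates v) :
    ∃ (l : E n) (y : Fin n → ℝ), ‖l‖ = 1 ∧ Function.Injective y ∧ (∀ i, y i ∈ Ico (0 : ℝ) 1) ∧
      ∀ i, inner ℝ l (v (y i)) = 0 := by
  obtain ⟨l, t, ht, ht1, hs⟩ := h
  have hl : l ≠ 0 := fun h0 => by simpa [h0] using hs 0
  have hz : ∀ i : Fin n, ∃ z ∈ Ioo (t i.castSucc) (t i.succ), inner ℝ l (v z) = 0 := by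
    intro i
    have hlt : t i.castSucc < t i.succ := ht i.castSucc_lt_succ
    have hc : ContinuousOn (fun s => (-1 : ℝ) ^ (i : ℕ) * inner ℝ l (v s))
        (Icc (t i.castSucc) (t i.succ)) :=
      (continuous_const.mul (continuous_const.inner hv.smooth.continuous)).continuousOn
    have h1 := hs i.castSucc
    have h2 := hs i.succ
    rw [Fin.val_castSucc] at h1
    rw [Fin.val_succ, pow_succ] at h2
    obtain ⟨z, hz, hz0⟩ := intermediate_value_Ioo' hlt.le hc (show (0 : ℝ) ∈ _ from
      ⟨by linarith, h1⟩)
    exact ⟨z, hz, (mul_eq_zero.1 hz0).resolve_left (pow_ne_zero _ (by norm_num))⟩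
  choose z hz hz0 using hz
  have hzm : StrictMono z := by
    obtain ⟨m, rfl⟩ : ∃ m, n = m + 1 := ⟨n - 1, by omega⟩
    refine Fin.strictMono_iff_lt_succ.2 fun i => (hz i.castSucc).2.trans_le ?_
    rw [Fin.succ_castSucc]
    exact (hz i.succ).1.le
  have hclose : ∀ i j, z i < z j + 1 := fun i j => by
    have h1 : t i.succ ≤ t (Fin.last n) := ht.monotone (Fin.le_last _)
    have h2 : t 0 ≤ t j.castSucc := ht.monotone (Fin.zero_le _)
    linarith [(hz i).2, (hz j).1]
  refine ⟨‖l‖⁻¹ • l, fun i => Int.fract (z i), ?_, fun i j hij => ?_, fun i =>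
    ⟨Int.fract_nonneg _, Int.fract_lt_one _⟩, fun i => ?_⟩
  · rw [norm_smul, norm_inv, norm_norm, inv_mul_cancel₀ (norm_ne_zero_iff.2 hl)]
  · obtain ⟨k, hk⟩ := Int.fract_eq_fract.1 hij
    have h1 : (k : ℝ) < 1 := by linarith [hclose i j]
    have h2 : (-1 : ℝ) < k := by linarith [hclose j i]
    have hk0 : k = 0 := by
      have : k < 1 := by exact_mod_cast h1
      have : -1 < k := by exact_mod_cast h2
      omega
    rw [hk0, Int.cast_zero, sub_eq_zero] at hk
    exact hzm.injective hk
  · have := hv.inner_eq_zero_of_add_int (-⌊z i⌋) (hz0 i)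
    rw [Int.cast_neg, ← sub_eq_add_neg, Int.self_sub_floor] at this
    rw [real_inner_smul_left, this, mul_zero]

theorem isOpen_alternates {v : X → ℝ → E n} (hs : JetSmooth v univ) :
    IsOpen {x | Alternates (v x)} := by
  rw [isOpen_iff_mem_nhds]
  rintro x₀ ⟨l, t, ht, ht1, hpos⟩
  have hc : Continuous fun p : X × ℝ => v p.1 p.2 := continuousOn_univ.1 (hs 0).continuousOn
  have : ∀ᶠ x in 𝓝 x₀, ∀ i : Fin (n + 1), 0 < (-1) ^ (i : ℕ) * inner ℝ l (v x (t i)) := by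
    rw [eventually_all]
    intro i
    have hci : Continuous fun x => (-1 : ℝ) ^ (i : ℕ) * inner ℝ l (v x (t i)) :=
      continuous_const.mul (continuous_const.inner (hc.comp (Continuous.prodMk_left (t i))))
    exact hci.continuousAt.eventually (lt_mem_nhds (hpos i))
  filter_upwards [this] with x hx using ⟨l, t, ht, ht1, hx⟩

/-- Unit forms `l x` with n zeros `y x` converge along an ultrafilter. Zeros that collide at a point
`r` produce, by Rolle's theorem, as many vanishing derivatives of the limit form at `r`. If the
limit frame did not alternate, `IsFrame.eq_zero_of_zeros` would make this unit form zero. -/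
theorem isClosed_alternates (hn : 1 ≤ n) {v : X → ℝ → E n} (hv : ∀ x, IsFrame (v x))
    (hs : JetSmooth v univ) : IsClosed {x | Alternates (v x)} := by
  rw [isClosed_iff_ultrafilter]
  intro x₀ u hu hS
  by_contra hx₀
  have hex : ∀ x, ∃ (l : E n) (y : Fin n → ℝ), Alternates (v x) → ‖l‖ = 1 ∧ Function.Injective y ∧
      (∀ i, y i ∈ Ico (0 : ℝ) 1) ∧ ∀ i, inner ℝ l (v x (y i)) = 0 := fun x => by
    by_cases h : Alternates (v x)
    · obtain ⟨l, y, h'⟩ := h.exists_zeros hn (hv x)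
      exact ⟨l, y, fun _ => h'⟩
    · exact ⟨0, 0, fun h' => absurd h' h⟩
  choose l y hly using hex
  have hev : ∀ᶠ x in (u : Filter X), Alternates (v x) := hS
  have hK : IsCompact (Metric.sphere (0 : E n) 1 ×ˢ Set.pi univ fun _ : Fin n => Icc (0 : ℝ) 1) :=
    (isCompact_sphere _ _).prod (isCompact_univ_pi fun _ => isCompact_Icc)
  obtain ⟨⟨l₀, ρ⟩, ⟨hl₀, hρ⟩, hlim⟩ := isCompact_iff_ultrafilter_le_nhds.1 hK
    (u.map fun x => (l x, y x)) (by
      rw [le_principal_iff]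
      refine Ultrafilter.mem_map.2 (mem_of_superset hev fun x hx => ?_)
      obtain ⟨h1, -, h3, -⟩ := hly x hx
      exact ⟨by simpa using h1, fun i _ => ⟨(h3 i).1, (h3 i).2.le⟩⟩)
  have hlim' : Tendsto (fun x => (l x, y x)) u (𝓝 (l₀, ρ)) := hlim
  rw [nhds_prod_eq] at hlim'
  have hl : Tendsto l u (𝓝 l₀) := tendsto_fst.comp hlim'
  have hy : ∀ i, Tendsto (fun x => y x i) u (𝓝 (ρ i)) :=
    tendsto_pi_nhds.1 (tendsto_snd.comp hlim')
  -- Limits of points of `[0, 1)` may equal 1. The corresponding zeros are translated by -1, so that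
  -- they approach 0 from the left and collide with those approaching it from the right.
  set δ : Fin n → ℤ := fun i => if ρ i = 1 then -1 else 0 with hδ
  set σ : Fin n → ℝ := fun i => ρ i + δ i with hσ
  have hσ1 : ∀ i, σ i ∈ Ico (0 : ℝ) 1 := fun i => by
    have h1 := hρ i (mem_univ i)
    by_cases h : ρ i = 1
    · simp [hσ, hδ, h]
    · simpa [hσ, hδ, h] using ⟨h1.1, lt_of_le_of_ne h1.2 h⟩
  have hyσ : ∀ i, Tendsto (fun x => y x i + δ i) u (𝓝 (σ i)) := fun i =>
    (hy i).add tendsto_const_nhds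
  have hinj : ∀ x, Alternates (v x) → Function.Injective fun i => y x i + δ i := by
    intro x hx i j hij
    obtain ⟨-, h2, h3, -⟩ := hly x hx
    refine h2 ?_
    have e : ∀ i, Int.fract (y x i + δ i) = y x i := fun i => by
      rw [Int.fract_add_intCast, Int.fract_eq_self.2 (h3 i)]
    rw [← e i, ← e j]
    exact congrArg _ hij
  set μ : ℝ → ℕ := fun r => (Finset.univ.filter fun i => σ i = r).card with hμ
  have hzero : ∀ r ∈ Finset.univ.image σ, ∀ k < μ r,
      inner ℝ l₀ (iteratedDeriv k (v x₀) r) = 0 := by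
    intro r _ k hk
    by_contra hne
    have hc : Continuous fun p : (X × ℝ) × E n =>
        inner ℝ p.2 (iteratedDeriv k (v p.1.1) p.1.2) :=
      continuous_snd.inner ((hs.continuous_iteratedDeriv k).comp continuous_fst)
    have hnb := (hc.continuousAt (x := ((x₀, r), l₀))).eventually_ne hne
    rw [nhds_prod_eq, nhds_prod_eq] at hnb
    obtain ⟨P, hP, Q, hQ, hPQ⟩ := eventually_prod_iff.1 hnb
    obtain ⟨P₁, hP₁, P₂, hP₂, hP₁₂⟩ := eventually_prod_iff.1 hP
    obtain ⟨ε, hε, hball⟩ := Metric.eventually_nhds_iff.1 hP₂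
    have h1 : ∀ᶠ x in (u : Filter X), ∀ i, σ i = r → y x i + δ i ∈ Icc (r - ε / 2) (r + ε / 2) := by
      rw [eventually_all]
      intro i
      by_cases hi : σ i = r
      · have := hyσ i
        rw [hi] at this
        filter_upwards [this.eventually (Icc_mem_nhds (by linarith : r - ε / 2 < r)
          (by linarith : r < r + ε / 2))] with x hx _ using hx
      · exact Eventually.of_forall fun x h => absurd h hi
    obtain ⟨x, hxA, hxσ, hx1, hx2⟩ :=
      (hev.and (h1.and ((Filter.Eventually.filter_mono hu hP₁).and (hl.eventually hQ)))).exists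
    obtain ⟨-, -, -, hz⟩ := hly x hxA
    obtain ⟨ζ, hζ, hζ0⟩ := exists_iteratedDeriv_eq_zero (α := r - ε / 2) (β := r + ε / 2) k
      (f := fun t => inner ℝ (l x) (v x t)) (contDiff_const.inner ℝ (hv x).smooth)
      (S := (Finset.univ.filter fun i => σ i = r).image fun i => y x i + δ i) (μ := fun _ => 1)
      (fun s hs' => by
        obtain ⟨i, hi, rfl⟩ := Finset.mem_image.1 hs'
        exact hxσ i (Finset.mem_filter.1 hi).2)
      (fun s hs' j hj => by
        obtain ⟨i, hi, rfl⟩ := Finset.mem_image.1 hs'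
        obtain rfl : j = 0 := by omega
        rw [iteratedDeriv_zero]
        exact (hv x).inner_eq_zero_of_add_int _ (hz i))
      (by
        rw [Finset.sum_const, smul_eq_mul, mul_one,
          Finset.card_image_of_injective _ (hinj x hxA)]
        exact hk)
    rw [iteratedDeriv_inner _ (hv x).smooth] at hζ0
    refine hPQ (hP₁₂ hx1 (hball (y := ζ) ?_)) hx2 hζ0
    rw [Real.dist_eq, abs_lt]
    constructor <;> linarith [hζ.1, hζ.2]
  have hl0 : l₀ = 0 := (hv x₀).eq_zero_of_zeros hn hx₀ (S := Finset.univ.image σ) (μ := μ)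
    (fun r hr => by
      obtain ⟨i, -, rfl⟩ := Finset.mem_image.1 hr
      exact hσ1 i) hzero (by
    rw [← Finset.card_eq_sum_card_image, Finset.card_univ, Fintype.card_fin])
  simp [hl0] at hl₀

theorem isClopen_alternates (hn : 1 ≤ n) {v : X → ℝ → E n} (hv : ∀ x, IsFrame (v x))
    (hs : JetSmooth v univ) : IsClopen {x | Alternates (v x)} :=
  ⟨isClosed_alternates hn hv hs, isOpen_alternates hs⟩

end Clopen

/-! ### The trivial oper -/

section Veronese

variable {n : ℕ}

/-- The matrix of the linear system satisfied by the coordinates of the Veronese embedding. -/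
def veroneseMatrix (n : ℕ) : Matrix (Fin n) (Fin n) ℝ :=
  Matrix.of fun j k : Fin n => Real.pi * ((if (k : ℕ) + 1 = j then (j : ℝ) else 0) -
    if (j : ℕ) + 1 = k then (n : ℝ) - 1 - j else 0)

/-- The linear map given by `veroneseMatrix`. -/
def veroneseCLM (n : ℕ) : E n →L[ℝ] E n := Matrix.toEuclideanCLM (𝕜 := ℝ) (veroneseMatrix n)

theorem veroneseCLM_apply (w : E n) (j : Fin n) : veroneseCLM n w j =
    Real.pi * ((j : ℝ) * (if h : 1 ≤ (j : ℕ) then w ⟨j - 1, by omega⟩ else 0) -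
      ((n : ℝ) - 1 - j) * (if h : (j : ℕ) + 1 < n then w ⟨j + 1, h⟩ else 0)) := by
  have h0 : veroneseCLM n w j = (veroneseMatrix n).mulVec w.ofLp j := by
    rw [veroneseCLM, Matrix.ofLp_toEuclideanCLM]
  have h1 : ∀ k : Fin n, veroneseMatrix n j k * w k =
      Real.pi * ((if (k : ℕ) + 1 = j then (j : ℝ) * w k else 0) -
        if (j : ℕ) + 1 = k then ((n : ℝ) - 1 - j) * w k else 0) := fun k => by
    simp only [veroneseMatrix, Matrix.of_apply]
    split_ifs <;> ring
  rw [h0, Matrix.mulVec, dotProduct, Finset.sum_congr rfl fun k _ => h1 k, ← Finset.mul_sum,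
    Finset.sum_sub_distrib]
  congr 2
  · by_cases h : 1 ≤ (j : ℕ)
    · rw [dif_pos h, Finset.sum_eq_single (⟨j - 1, by omega⟩ : Fin n)]
      · rw [if_pos (Nat.sub_add_cancel h)]
      · intro k _ hk
        exact if_neg fun h' => hk (Fin.ext (by simp only; omega))
      · simp
    · rw [dif_neg h, mul_zero]
      exact Finset.sum_eq_zero fun k _ => if_neg (by omega)
  · by_cases h : (j : ℕ) + 1 < n
    · rw [dif_pos h, Finset.sum_eq_single (⟨j + 1, h⟩ : Fin n)]
      · rw [if_pos rfl]
      · intro k _ hk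
        exact if_neg fun h' => hk (Fin.ext h'.symm)
      · simp
    · rw [dif_neg h, mul_zero]
      exact Finset.sum_eq_zero fun (k : Fin n) _ => if_neg (by have := k.2; omega)

theorem hasDerivAt_veroneseLift (t : ℝ) :
    HasDerivAt (veroneseLift n) (veroneseCLM n (veroneseLift n t)) t := by
  suffices h : HasDerivAt (fun t => (veroneseLift n t).ofLp)
      (veroneseCLM n (veroneseLift n t)).ofLp t from
    ((PiLp.continuousLinearEquiv 2 ℝ fun _ : Fin n => ℝ).symm :
      (Fin n → ℝ) →L[ℝ] E n).hasFDerivAt.comp_hasDerivAt t h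
  rw [hasDerivAt_pi]
  intro j
  have hlin : HasDerivAt (fun t : ℝ => Real.pi * t) Real.pi t := by
    simpa using (hasDerivAt_id t).const_mul Real.pi
  have h := (hlin.cos.fun_pow (n - 1 - (j : ℕ))).mul (hlin.sin.fun_pow (j : ℕ))
  refine h.congr_deriv ?_
  rw [veroneseCLM_apply]
  simp only [veroneseLift]
  have hj := j.2
  obtain ⟨j, hj'⟩ := j
  simp only at hj ⊢
  obtain ⟨a, rfl⟩ : ∃ a, n = a + j + 1 := ⟨n - 1 - j, by omega⟩
  have e1 : a + j + 1 - 1 - j = a := by omega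
  rw [e1]
  have e2 : ((a + j + 1 : ℕ) : ℝ) - 1 - j = a := by push_cast; ring
  rw [e2]
  rcases Nat.eq_zero_or_pos a with rfl | ha <;> rcases Nat.eq_zero_or_pos j with rfl | hj0
  · simp
  · have e3 : 0 + j + 1 - 1 - (j - 1) = 1 := by omega
    have h5 : 1 ≤ j := hj0
    rw [dif_pos h5, e3, Nat.cast_zero]
    ring
  · simp [ha]
    ring
  · have e3 : a + j + 1 - 1 - (j - 1) = a + 1 := by omega
    have e4 : a + j + 1 - 1 - (j + 1) = a - 1 := by omega
    have h5 : 1 ≤ j := hj0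
    have h6 : j + 1 < a + j + 1 := by omega
    rw [dif_pos h5, dif_pos h6, e3, e4]
    ring

theorem iteratedDeriv_veroneseLift (k : ℕ) (t : ℝ) :
    iteratedDeriv k (veroneseLift n) t = (veroneseCLM n ^ k) (veroneseLift n t) := by
  induction k generalizing t with
  | zero => simp
  | succ k ih =>
    rw [iteratedDeriv_succ, funext ih, pow_succ]
    exact ((veroneseCLM n ^ k).hasFDerivAt.comp_hasDerivAt t (hasDerivAt_veroneseLift t)).deriv

/-- The lift satisfies a linear system with constant matrix, so by the Cayley–Hamilton theorem it
solves the equation given by the characteristic polynomial. The matrix has trace zero, hence there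
is no term of order n - 1. -/
theorem exists_vecSol_veroneseLift (hn : 1 ≤ n) : ∃ D : Oper n, D.VecSol (veroneseLift n) := by
  set p := (veroneseMatrix n).charpoly with hp
  have : Nonempty (Fin n) := ⟨⟨0, hn⟩⟩
  have hdeg : p.natDegree = n := by
    rw [hp, Matrix.charpoly_natDegree_eq_dim, Fintype.card_fin]
  have hmon : p.coeff n = 1 := by
    have := (veroneseMatrix n).charpoly_monic
    rw [Polynomial.Monic, Polynomial.leadingCoeff, ← hp, hdeg] at this
    exact this
  have htr : p.coeff (n - 1) = 0 := by
    have := Matrix.trace_eq_neg_charpoly_coeff (veroneseMatrix n)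
    rw [Fintype.card_fin, ← hp] at this
    have h0 : (veroneseMatrix n).trace = 0 := by simp [Matrix.trace, veroneseMatrix]
    linarith
  have hae : Polynomial.aeval (veroneseCLM n) p = 0 := by
    have := Polynomial.aeval_algHom_apply
      (Matrix.toEuclideanCLM (n := Fin n) (𝕜 := ℝ)).toAlgEquiv.toAlgHom (veroneseMatrix n) p
    rw [hp, Matrix.aeval_self_charpoly, map_zero] at this
    exact this
  refine ⟨⟨fun j _ => p.coeff j, fun j => contDiff_const⟩, veroneseLift_contDiff n, fun t => ?_⟩
  have h1 := congrArg (fun L : E n →L[ℝ] E n => L (veroneseLift n t)) hae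
  simp only [Polynomial.aeval_eq_sum_range, hdeg, _root_.sum_apply,
    _root_.smul_apply, _root_.zero_apply,
    ← iteratedDeriv_veroneseLift] at h1
  rw [Finset.sum_range_succ, hmon, one_smul, ← Nat.sub_add_cancel hn, Finset.sum_range_succ,
    Nat.sub_add_cancel hn, htr, zero_smul, add_zero, add_comm] at h1
  rw [← h1]
  congr 1
  exact Fin.sum_univ_eq_sum_range (fun j => p.coeff j • iteratedDeriv j (veroneseLift n) t) (n - 1)

/-- At time 0 the lift is the first basis vector, and each application of the matrix reaches one
coordinate further, with the positive factor `π (i + 1)`. The jet matrix at 0 is therefore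
triangular with positive diagonal. -/
theorem veroneseCLM_pow_apply (i : ℕ) (hi : i < n) :
    (∀ j : Fin n, i < j → (veroneseCLM n ^ i) (veroneseLift n 0) j = 0) ∧
      0 < (veroneseCLM n ^ i) (veroneseLift n 0) ⟨i, hi⟩ := by
  induction i with
  | zero =>
    constructor
    · intro j hj
      simp [veroneseLift, hj.ne']
    · simp [veroneseLift]
  | succ i ih =>
    obtain ⟨h1, h2⟩ := ih (by omega)
    have hs : ∀ x, (veroneseCLM n ^ (i + 1)) x = veroneseCLM n ((veroneseCLM n ^ i) x) := fun x => by
      rw [pow_succ']; rfl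
    constructor
    · intro j hj
      rw [hs, veroneseCLM_apply]
      have e1 : (veroneseCLM n ^ i) (veroneseLift n 0) ⟨j - 1, by omega⟩ = 0 :=
        h1 _ (by simp only; omega)
      have e2 : ∀ h : (j : ℕ) + 1 < n, (veroneseCLM n ^ i) (veroneseLift n 0) ⟨j + 1, h⟩ = 0 :=
        fun h => h1 _ (by simp only; omega)
      simp only [e1, e2, dite_eq_ite, ite_self, mul_zero, sub_zero]
    · rw [hs, veroneseCLM_apply]
      have e2 : ∀ h : i + 1 + 1 < n,
          (veroneseCLM n ^ i) (veroneseLift n 0) ⟨i + 1 + 1, h⟩ = 0 :=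
        fun h => h1 _ (by simp only; omega)
      simp only [e2, dite_eq_ite, ite_self, mul_zero, sub_zero, Nat.add_sub_cancel,
        le_add_iff_nonneg_left, zero_le, dite_true]
      have := Real.pi_pos
      positivity

theorem wronskian_veroneseLift_pos : 0 < wronskian (veroneseLift n) 0 := by
  have hT : (jetMatrix (veroneseLift n) 0).IsLowerTriangular := fun i j hij => by
    rw [jetMatrix, Matrix.of_apply, iteratedDeriv_veroneseLift]
    exact (veroneseCLM_pow_apply i i.2).1 j (by exact_mod_cast hij)
  rw [wronskian_eq (veroneseLift_contDiff n), Matrix.det_of_isLowerTriangular _ hT]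
  refine Finset.prod_pos fun i _ => ?_
  rw [jetMatrix, Matrix.of_apply, iteratedDeriv_veroneseLift]
  exact (veroneseCLM_pow_apply i i.2).2

theorem isFrame_veroneseLift (hn : 1 ≤ n) : IsFrame (veroneseLift n) := by
  obtain ⟨D, hD⟩ := exists_vecSol_veroneseLift hn
  refine ⟨hD.1, fun t => (wronskian_ne_zero_iff hD.1 t).1 ?_, (-1) ^ (n - 1),
    neg_one_pow_eq_or ℝ _, veroneseLift_add_one n⟩
  rw [hD.wronskian_eq hn t 0]
  exact wronskian_veroneseLift_pos.ne'

/-- A form on this curve is a homogeneous polynomial of degree n - 1 in cosine and sine. If it has n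
zeros in `[0, 1)`, it is in the kernel of a projective Vandermonde matrix, whose determinant is a
product of the nonzero numbers `sin (π (y j - y i))`. -/
theorem not_alternates_veroneseLift (hn : 1 ≤ n) : ¬ Alternates (veroneseLift n) := by
  intro h
  obtain ⟨l, y, hl, hy, hy1, hz⟩ := h.exists_zeros hn (isFrame_veroneseLift hn)
  set M := Matrix.projVandermonde (fun i => Real.sin (Real.pi * y i))
    (fun i => Real.cos (Real.pi * y i)) with hM
  have hdet : M.det ≠ 0 := by
    rw [hM, Matrix.det_projVandermonde]
    refine Finset.prod_ne_zero_iff.2 fun i _ => Finset.prod_ne_zero_iff.2 fun j hj => ?_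
    have hij : i ≠ j := (Finset.mem_Ioi.1 hj).ne
    rw [show Real.sin (Real.pi * y j) * Real.cos (Real.pi * y i) -
        Real.sin (Real.pi * y i) * Real.cos (Real.pi * y j) =
        Real.sin (Real.pi * (y j - y i)) by rw [mul_sub, Real.sin_sub]; ring]
    intro h0
    obtain ⟨k, hk⟩ := Real.sin_eq_zero_iff.1 h0
    rw [mul_comm] at hk
    have hk' : (k : ℝ) = y j - y i := mul_left_cancel₀ Real.pi_ne_zero hk
    have h1 : (k : ℝ) < 1 := by linarith [(hy1 i).1, (hy1 j).2]
    have h2 : (-1 : ℝ) < k := by linarith [(hy1 i).2, (hy1 j).1]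
    have hk0 : k = 0 := by
      have : k < 1 := by exact_mod_cast h1
      have : -1 < k := by exact_mod_cast h2
      omega
    rw [hk0, Int.cast_zero, eq_comm, sub_eq_zero] at hk'
    exact hij (hy hk').symm
  have hmul : M.mulVec l.ofLp = 0 := by
    funext i
    have := hz i
    rw [PiLp.inner_apply] at this
    rw [Pi.zero_apply, ← this, Matrix.mulVec, dotProduct]
    refine Finset.sum_congr rfl fun j _ => ?_
    have e : (j.rev : ℕ) = n - 1 - j := by rw [Fin.val_rev]; omega
    simp only [hM, Matrix.projVandermonde_apply, e, veroneseLift, RCLike.inner_apply, conj_trivial]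
    ring
  have := Matrix.eq_zero_of_mulVec_eq_zero hdet hmul
  have hl0 : l = 0 := by ext i; exact congrFun this i
  simp [hl0] at hl

theorem isPositive_veronese (hn : 1 ≤ n) : IsPositive (veronese n hn).toFun :=
  ⟨veroneseLift n, ⟨veroneseLift_contDiff n, fun t => ⟨veroneseLift_ne_zero hn t, rfl⟩⟩,
    wronskian_veroneseLift_pos⟩

end Veronese

/-! ### Connectedness of the group of matrices with positive determinant -/

section GLPos

variable {n : ℕ}

/-- The set of invertible matrices. -/
def invMatrices (n : ℕ) : Set (Matrix (Fin n) (Fin n) ℝ) := {M | M.det ≠ 0}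

theorem joinedIn_invMatrices_mul {A B C D : Matrix (Fin n) (Fin n) ℝ}
    (h : JoinedIn (invMatrices n) A B) (h' : JoinedIn (invMatrices n) C D) :
    JoinedIn (invMatrices n) (A * C) (B * D) := by
  refine (JoinedIn.mul h h').mono ?_
  rintro _ ⟨M, hM, N, hN, rfl⟩
  simp only [invMatrices, mem_ofPred_eq, Matrix.det_mul] at *
  exact mul_ne_zero hM hN

/-- The matrix of the reflection along a vector. -/
def reflMatrix (w : Fin n → ℝ) : Matrix (Fin n) (Fin n) ℝ :=
  1 - (2 / (w ⬝ᵥ w)) • Matrix.vecMulVec w w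

theorem reflMatrix_mul_self {w : Fin n → ℝ} (hw : w ≠ 0) : reflMatrix w * reflMatrix w = 1 := by
  have h : w ⬝ᵥ w ≠ 0 := fun h => hw (dotProduct_self_eq_zero.1 h)
  rw [reflMatrix, sub_mul, mul_sub, mul_sub, one_mul, mul_one, one_mul, Matrix.smul_mul,
    Matrix.mul_smul, Matrix.vecMulVec_mul_vecMulVec, Matrix.vecMulVec_smul, smul_smul, smul_smul]
  have e : 2 / (w ⬝ᵥ w) * (2 / (w ⬝ᵥ w)) * (w ⬝ᵥ w) = 2 / (w ⬝ᵥ w) + 2 / (w ⬝ᵥ w) := by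
    field_simp; norm_num
  rw [e, add_smul]
  abel

theorem reflMatrix_mem {w : Fin n → ℝ} (hw : w ≠ 0) : reflMatrix w ∈ invMatrices n := fun h => by
  have := congrArg Matrix.det (reflMatrix_mul_self hw)
  rw [Matrix.det_mul, h, Matrix.det_one, mul_zero] at this
  exact zero_ne_one this

theorem det_reflMatrix {w : Fin n → ℝ} (hw : w ≠ 0) : (reflMatrix w).det = -1 := by
  have h : w ⬝ᵥ w ≠ 0 := fun h => hw (dotProduct_self_eq_zero.1 h)
  have e : reflMatrix w = 1 + Matrix.replicateCol Unit (-(2 / (w ⬝ᵥ w)) • w) *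
      Matrix.replicateRow Unit w := by
    rw [reflMatrix, sub_eq_add_neg, ← neg_smul, ← Matrix.vecMulVec_eq, Matrix.smul_vecMulVec]
  rw [e, Matrix.det_one_add_replicateCol_mul_replicateRow, dotProduct_smul, smul_eq_mul, neg_mul,
    div_mul_cancel₀ _ h]
  norm_num

/-- The space ℝⁿ without the origin is path-connected for n ≥ 2. Together with
`reflMatrix_mul_self`, this shows that a product of two reflections can be joined to the identity.
-/
theorem joinedIn_reflMatrix (hn : 2 ≤ n) {u w : Fin n → ℝ} (hu : u ≠ 0) (hw : w ≠ 0) :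
    JoinedIn (invMatrices n) (reflMatrix u) (reflMatrix w) := by
  have hp : IsPathConnected ({0}ᶜ : Set (Fin n → ℝ)) :=
    isPathConnected_compl_singleton_of_one_lt_rank (by
      rw [rank_fin_fun]; exact_mod_cast hn) 0
  have hc : ContinuousOn (reflMatrix (n := n)) {0}ᶜ := by
    have h1 : ContinuousOn (fun w : Fin n → ℝ => 2 / (w ⬝ᵥ w)) {0}ᶜ :=
      continuousOn_const.div (Continuous.continuousOn (by fun_prop)) fun x hx h =>
        hx (dotProduct_self_eq_zero.1 h)
    have h2 : ContinuousOn (fun w : Fin n → ℝ => Matrix.vecMulVec w w) {0}ᶜ :=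
      (Continuous.matrix_vecMulVec continuous_id continuous_id).continuousOn
    exact continuousOn_const.sub (h1.smul h2)
  refine ((hp.joinedIn u hu w hw).map_continuousOn hc).mono ?_
  rintro _ ⟨x, hx, rfl⟩
  exact reflMatrix_mem hx

theorem det_diagonal_update (a : Fin n) (d : ℝ) :
    (Matrix.diagonal (Function.update (1 : Fin n → ℝ) a d)).det = d := by
  rw [Matrix.det_diagonal, Finset.prod_update_of_mem (Finset.mem_univ a)]
  simp

theorem joinedIn_diagonal_update (a : Fin n) {d e : ℝ} (h : 0 < d * e) :
    JoinedIn (invMatrices n) (Matrix.diagonal (Function.update (1 : Fin n → ℝ) a d))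
      (Matrix.diagonal (Function.update (1 : Fin n → ℝ) a e)) := by
  refine JoinedIn.ofLine (f := fun t : ℝ => Matrix.diagonal
    (Function.update (1 : Fin n → ℝ) a ((1 - t) * d + t * e))) ?_ (by simp) (by simp) ?_
  · refine (Continuous.matrix_diagonal ?_).continuousOn
    exact continuous_const.update a (by fun_prop)
  · rintro _ ⟨t, ht, rfl⟩
    simp only [invMatrices, mem_ofPred_eq, det_diagonal_update]
    obtain ⟨h0, h1⟩ := ht
    rcases pos_and_pos_or_neg_and_neg_of_mul_pos h with ⟨hd, he⟩ | ⟨hd, he⟩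
    · rcases eq_or_lt_of_le h0 with rfl | h0
      · simpa using hd.ne'
      · nlinarith [mul_pos h0 he, mul_nonneg (sub_nonneg.2 h1) hd.le]
    · rcases eq_or_lt_of_le h0 with rfl | h0
      · simpa using hd.ne
      · nlinarith [mul_pos h0 (neg_pos.2 he), mul_nonneg (sub_nonneg.2 h1) (neg_pos.2 hd).le]

/-- Invertible matrices can be joined to the identity or to a reflection. -/
theorem joinedIn_one_or_reflMatrix (hn : 2 ≤ n) {M : Matrix (Fin n) (Fin n) ℝ} (hM : M.det ≠ 0) :
    JoinedIn (invMatrices n) M 1 ∨ ∃ u ≠ 0, JoinedIn (invMatrices n) M (reflMatrix u) := by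
  set P : Matrix (Fin n) (Fin n) ℝ → Prop := fun M =>
    JoinedIn (invMatrices n) M 1 ∨ ∃ u ≠ 0, JoinedIn (invMatrices n) M (reflMatrix u) with hP
  have hmul : ∀ A B, P A → P B → P (A * B) := by
    rintro A B (hA | ⟨u, hu, hA⟩) (hB | ⟨w, hw, hB⟩)
    · exact Or.inl (by simpa using joinedIn_invMatrices_mul hA hB)
    · exact Or.inr ⟨w, hw, by simpa using joinedIn_invMatrices_mul hA hB⟩
    · exact Or.inr ⟨u, hu, by simpa using joinedIn_invMatrices_mul hA hB⟩
    · refine Or.inl ?_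
      rw [← reflMatrix_mul_self hu]
      exact joinedIn_invMatrices_mul hA (hB.trans (joinedIn_reflMatrix hn hw hu))
  have hsingle : ∀ (a : Fin n) (d : ℝ), d ≠ 0 →
      P (Matrix.diagonal (Function.update (1 : Fin n → ℝ) a d)) := by
    intro a d hd
    rcases lt_or_gt_of_ne hd with hneg | hpos
    · refine Or.inr ⟨Pi.single a 1, by simp, ?_⟩
      have e : reflMatrix (Pi.single a 1) =
          Matrix.diagonal (Function.update (1 : Fin n → ℝ) a (-1)) := by
        ext i j
        by_cases hi : i = a <;> by_cases hj : j = a <;> by_cases hij : i = j <;>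
          simp_all [reflMatrix, Matrix.vecMulVec_apply]
        norm_num
      rw [e]
      exact joinedIn_diagonal_update a (by linarith)
    · refine Or.inl ?_
      have e : (1 : Matrix (Fin n) (Fin n) ℝ) =
          Matrix.diagonal (Function.update (1 : Fin n → ℝ) a 1) := by
        rw [Function.update_eq_self_iff.2 (Pi.one_apply a).symm]
        exact Matrix.diagonal_one.symm
      rw [e]
      exact joinedIn_diagonal_update a (by linarith)
  have hdiag : ∀ D : Fin n → ℝ, (∀ i, D i ≠ 0) → P (Matrix.diagonal D) := by
    intro D hD
    have : ∀ s : Finset (Fin n), P (Matrix.diagonal fun i => if i ∈ s then D i else 1) := by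
      intro s
      induction s using Finset.induction_on with
      | empty =>
        simp only [Finset.notMem_empty, if_false]
        have e : (Matrix.diagonal fun _ : Fin n => (1 : ℝ)) = 1 := Matrix.diagonal_one
        rw [e]
        exact Or.inl (JoinedIn.refl (by simp [invMatrices]))
      | insert a s ha ih =>
        have e : (Matrix.diagonal fun i => if i ∈ insert a s then D i else 1) =
            Matrix.diagonal (Function.update (1 : Fin n → ℝ) a (D a)) *
              Matrix.diagonal fun i => if i ∈ s then D i else 1 := by
          rw [Matrix.diagonal_mul_diagonal]
          congr 1
          funext i
          by_cases hi : i = a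
          · subst hi; simp [ha]
          · simp [hi]
        rw [e]
        exact hmul _ _ (hsingle a _ (hD a)) ih
    simpa using this Finset.univ
  refine Matrix.diagonal_transvection_induction_of_det_ne_zero P M hM (fun D hD => hdiag D ?_) ?_
    fun A B _ _ hA hB => hmul A B hA hB
  · rw [Matrix.det_diagonal, Finset.prod_ne_zero_iff] at hD
    exact fun i => hD i (Finset.mem_univ i)
  · rintro ⟨i, j, hij, c⟩
    refine Or.inl (JoinedIn.ofLine (f := fun t : ℝ => Matrix.transvection i j ((1 - t) * c))
      (Continuous.continuousOn ?_) (by simp [Matrix.TransvectionStruct.toMatrix])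
      (by simp [Matrix.transvection]) ?_)
    · refine continuous_const.add (continuous_matrix fun k l => ?_)
      simp only [Matrix.single_apply]
      split_ifs <;> fun_prop
    · rintro _ ⟨t, -, rfl⟩
      simp [invMatrices, Matrix.det_transvection_of_ne _ _ hij]

theorem joinedIn_det_pos {A B : Matrix (Fin n) (Fin n) ℝ} (h : JoinedIn (invMatrices n) A B)
    (hA : 0 < A.det) : JoinedIn {M : Matrix (Fin n) (Fin n) ℝ | 0 < M.det} A B := by
  obtain ⟨γ, hγ⟩ := h
  have hc : Continuous fun t => (γ t).det := γ.continuous.matrix_det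
  refine ⟨γ, fun t => ?_⟩
  by_contra hle
  have hle' : (γ t).det ≤ 0 := not_lt.1 hle
  obtain ⟨s, hs⟩ := mem_range_of_exists_le_of_exists_ge hc ⟨t, hle'⟩
    ⟨0, by rw [γ.source]; exact hA.le⟩
  exact hγ s hs

/-- The group of matrices with positive determinant is path-connected. -/
theorem joinedIn_one_of_det_pos {M : Matrix (Fin n) (Fin n) ℝ} (hM : 0 < M.det) :
    JoinedIn {M : Matrix (Fin n) (Fin n) ℝ | 0 < M.det} M 1 := by
  -- For n ≤ 1 a segment suffices. For larger n the alternative of a reflection is excluded by the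
  -- sign of its determinant.
  rcases Nat.lt_or_ge n 2 with hn | hn
  · refine JoinedIn.ofLine (f := fun t : ℝ => (1 - t) • M + t • 1)
      (Continuous.continuousOn (by fun_prop)) (by simp) (by simp) ?_
    rintro _ ⟨t, ⟨h0, h1⟩, rfl⟩
    interval_cases n
    · simp
    · simp only [mem_ofPred_eq, Matrix.det_fin_one, Matrix.add_apply, Matrix.smul_apply,
        Matrix.one_apply_eq, smul_eq_mul, mul_one] at hM ⊢
      rcases eq_or_lt_of_le h0 with rfl | h0
      · simpa using hM
      · nlinarith [mul_nonneg (sub_nonneg.2 h1) hM.le]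
  · rcases joinedIn_one_or_reflMatrix hn hM.ne' with h | ⟨u, hu, h⟩
    · exact joinedIn_det_pos h hM
    · have := (joinedIn_det_pos h hM).target_mem
      rw [mem_ofPred_eq, det_reflMatrix hu] at this
      linarith

end GLPos

/-! ### Hitchin opers and Hitchin Frenet curves -/

section Hitchin

variable {n : ℕ} {v : ℝ → E n}

theorem det_toEuclideanCLM (M : Matrix (Fin n) (Fin n) ℝ) :
    LinearMap.det ((Matrix.toEuclideanCLM (𝕜 := ℝ) M : E n →L[ℝ] E n) : E n →ₗ[ℝ] E n) = M.det := by
  rw [← LinearMap.det_toMatrix (EuclideanSpace.basisFun (Fin n) ℝ).toBasis]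
  congr 1
  ext i j
  simp [LinearMap.toMatrix_apply]

theorem IsFrame.toEuclideanCLM (hv : IsFrame v) {M : Matrix (Fin n) (Fin n) ℝ} (hM : M.det ≠ 0) :
    IsFrame fun t => Matrix.toEuclideanCLM (𝕜 := ℝ) M (v t) :=
  hv.clm (ContinuousLinearMap.toContinuousLinearEquivOfDetNeZero
    (Matrix.toEuclideanCLM (𝕜 := ℝ) M : E n →L[ℝ] E n) (by
      rw [ContinuousLinearMap.det, det_toEuclideanCLM]; exact hM))

theorem isSmoothFrenet_frameCurve (hn : 1 ≤ n) (hv : IsFrame v) (ha : ¬ Alternates v) :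
    (frameCurve hn hv).IsSmoothFrenet :=
  ⟨hv.isFrenet hn ha (isLift_frameCurve hn hv), v, isLift_frameCurve hn hv, hv.nondeg⟩

theorem Oper.VecSol.exists_matrix {D : Oper n} (hn : 1 ≤ n) (hv : D.VecSol v)
    (h0 : 0 < wronskian v 0) : ∃ M : Matrix (Fin n) (Fin n) ℝ, 0 < M.det ∧
      ∀ t, v t = Matrix.toEuclideanCLM (𝕜 := ℝ) M (fundSol hn D t) := by
  have hs := vecSol_fundSol hn D
  obtain ⟨L, hL⟩ := hs.exists_clm hn hv (t₀ := 0)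
    ((wronskian_ne_zero_iff hs.1 0).1 (by simp [wronskian_fundSol]))
  obtain ⟨M, rfl⟩ : ∃ M, Matrix.toEuclideanCLM (n := Fin n) (𝕜 := ℝ) M = L :=
    (Matrix.toEuclideanCLM (n := Fin n) (𝕜 := ℝ)).surjective L
  refine ⟨M, ?_, hL⟩
  rw [funext hL, wronskian_clm _ hs.1, wronskian_fundSol, mul_one, det_toEuclideanCLM] at h0
  exact h0

theorem Oper.IsTrivial.vecSol {D : Oper n} (hD : D.IsTrivial) : D.VecSol (veroneseLift n) :=
  Oper.vecSol_iff_coord.2 hD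

theorem Oper.IsTrivial.not_alternates (hn : 1 ≤ n) {D : Oper n} (hD : D.IsTrivial) :
    ¬ Alternates (fundSol hn D) := by
  intro h
  obtain ⟨L, hL⟩ := hD.vecSol.exists_clm hn (vecSol_fundSol hn D)
    ((isFrame_veroneseLift hn).nondeg 0)
  rw [funext hL] at h
  exact not_alternates_veroneseLift hn h.of_clm

theorem Oper.IsHitchin.hasTrivialHolonomy {D : Oper n} (hD : D.IsHitchin) :
    D.HasTrivialHolonomy := by
  obtain ⟨D₀, -, h⟩ := hD
  exact h.source_mem

/-- The curves associated to a Hitchin oper are Hitchin Frenet curves. -/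
theorem Oper.IsHitchin.isHitchinFrenet (hn : 1 ≤ n) {D : Oper n} (hD : D.IsHitchin)
    {ξ : SmoothCurve n} (hξ : D.IsAssociated ξ.toFun) : ξ.IsHitchinFrenet hn := by
  obtain ⟨D₀, hD₀, γ, hγ⟩ := hD
  obtain ⟨w, hw, hw0, hwξ⟩ := (Oper.isAssociated_iff hn).1 hξ
  obtain ⟨M, hM, hwM⟩ := hw.exists_matrix hn hw0
  obtain ⟨M₀, hM₀, hwM₀⟩ := hD₀.vecSol.exists_matrix hn wronskian_veroneseLift_pos
  -- The fundamental solutions along `γ` give some path of curves. Multiplying by the path `g` of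
  -- matrices, from `M` to `M₀`, makes it start at `ξ` and end at the Veronese embedding.
  obtain ⟨g, hg⟩ := (joinedIn_one_of_det_pos hM).trans (joinedIn_one_of_det_pos hM₀).symm
  have hs : JetSmooth (fun s => fundSol hn (γ s)) univ :=
    (jetSmooth_fundSol hn).comp_continuous γ.continuous
  have hfr : ∀ s, IsFrame (fundSol hn (γ s)) := fun s =>
    Oper.HasTrivialHolonomy.isFrame_fundSol hn (hγ s)
  -- Alternation is open and closed on the unit interval and fails at its end, the trivial oper.
  have hna : ∀ s, ¬ Alternates (fundSol hn (γ s)) := by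
    rcases isClopen_iff.1 (isClopen_alternates hn hfr hs) with h | h
    · exact fun s hs' => by simpa [h] using (show s ∈ {s | Alternates (fundSol hn (γ s))} from hs')
    · have h1 : (1 : unitInterval) ∈ {s | Alternates (fundSol hn (γ s))} := by
        rw [h]; exact mem_univ _
      have h2 : Alternates (fundSol hn (γ 1)) := h1
      rw [γ.target] at h2
      exact absurd h2 (hD₀.not_alternates hn)
  have hfr' : ∀ s, IsFrame fun t => Matrix.toEuclideanCLM (𝕜 := ℝ) (g s) (fundSol hn (γ s) t) :=
    fun s => (hfr s).toEuclideanCLM (ne_of_gt (hg s))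
  have hs' : JetSmooth (fun s t => Matrix.toEuclideanCLM (𝕜 := ℝ) (g s) (fundSol hn (γ s) t))
      univ := by
    have hc : Continuous fun M : Matrix (Fin n) (Fin n) ℝ =>
        (Matrix.toEuclideanCLM (𝕜 := ℝ) M : E n →L[ℝ] E n) :=
      LinearMap.continuous_of_finiteDimensional
        ((Matrix.toEuclideanCLM (n := Fin n) (𝕜 := ℝ)).toAlgEquiv.toLinearMap)
    exact fun k => (JetCont.const _ (hc.comp g.continuous)).bilin isOpen_univ
      (ContinuousLinearMap.id ℝ (E n →L[ℝ] E n)) (hs k)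
  refine ⟨⟨⟨fun s => frameCurve hn (hfr' s), continuous_frameCurve hn hfr' hs'⟩, ?_, ?_⟩,
    fun s => isSmoothFrenet_frameCurve hn (hfr' s) fun h => hna s h.of_clm⟩
  · refine (eq_frameCurve hn (hfr' 0) ?_).symm
    simp only [γ.source, g.source, ← hwM]
    exact hwξ
  · refine (eq_frameCurve hn (hfr' 1) ?_).symm
    simp only [γ.target, g.target, ← hwM₀]
    exact ⟨veroneseLift_contDiff n, fun t => ⟨veroneseLift_ne_zero hn t, rfl⟩⟩

theorem isAssociated_veronese (hn : 1 ≤ n) {D : Oper n} (hD : D.VecSol (veroneseLift n)) :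
    D.IsAssociated (veronese n hn).toFun :=
  (Oper.isAssociated_iff hn).2 ⟨_, hD, wronskian_veroneseLift_pos, veroneseLift_contDiff n,
    fun t => ⟨veroneseLift_ne_zero hn t, rfl⟩⟩

theorem Oper.IsAssociated.unique (hn : 1 ≤ n) {D D' : Oper n}
    {ξ : UnitAddCircle → Projectivization ℝ (E n)} (h : D.IsAssociated ξ)
    (h' : D'.IsAssociated ξ) : D = D' :=
  h.oper_eq hn h' (LinearEquiv.refl ℝ _) fun _ => (congrFun Projectivization.map_id _).symm

theorem SmoothCurve.IsHitchinFrenet.isNondegenerate {hn : 1 ≤ n} {ξ : SmoothCurve n}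
    (h : ξ.IsHitchinFrenet hn) : IsNondegenerate ξ.toFun := h.source_mem.2

theorem SmoothCurve.IsHitchinFrenet.isPositive {hn : 1 ≤ n} {ξ : SmoothCurve n}
    (h : ξ.IsHitchinFrenet hn) : IsPositive ξ.toFun := by
  obtain ⟨γ, hγ⟩ := h
  have hc := isClopen_isPositive γ.continuous fun s => (hγ s).2
  have h1 : (1 : unitInterval) ∈ {s | IsPositive (γ s).toFun} := by
    change IsPositive (γ 1).toFun
    rw [γ.target]
    exact isPositive_veronese hn
  rcases isClopen_iff.1 hc with h | h
  · rw [h] at h1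
    exact absurd h1 (notMem_empty _)
  · have h0 : (0 : unitInterval) ∈ {s | IsPositive (γ s).toFun} := by rw [h]; exact mem_univ _
    have h0' : IsPositive (γ 0).toFun := h0
    rwa [γ.source] at h0'

theorem SmoothCurve.IsHitchinFrenet.isAssociated {hn : 1 ≤ n} {ξ : SmoothCurve n}
    (h : ξ.IsHitchinFrenet hn) : (curveOper hn h.isNondegenerate).IsAssociated ξ.toFun :=
  isAssociated_curveOper hn _ h.isPositive

/-- The oper of a Hitchin Frenet curve is Hitchin. -/
theorem SmoothCurve.IsHitchinFrenet.isHitchin_curveOper {hn : 1 ≤ n} {ξ : SmoothCurve n}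
    (h : ξ.IsHitchinFrenet hn) : (curveOper hn h.isNondegenerate).IsHitchin := by
  have hnd := h.isNondegenerate
  have hndv : IsNondegenerate (veronese n hn).toFun := h.target_mem.2
  obtain ⟨D₀, hD₀⟩ := exists_vecSol_veroneseLift hn
  -- An oper is determined by its associated curve, so the path of opers does end at the trivial
  -- oper.
  have hv : curveOper hn hndv = D₀ :=
    (isAssociated_curveOper hn hndv (isPositive_veronese hn)).unique hn (isAssociated_veronese hn hD₀)
  obtain ⟨γ, hγ⟩ := h
  refine ⟨D₀, Oper.vecSol_iff_coord.1 hD₀, ⟨⟨fun s => curveOper hn (hγ s).2,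
    continuous_curveOper hn γ.continuous fun s => (hγ s).2⟩, ?_, ?_⟩, fun s => ?_⟩
  · change curveOper hn (hγ 0).2 = curveOper hn hnd
    congr 1
    rw [γ.source]
  · change curveOper hn (hγ 1).2 = _
    rw [← hv]
    congr 1
    rw [γ.target]
  · obtain ⟨w, -, -, -, hhol, -⟩ := curveOper_spec hn (hγ s).2
    exact hhol

/-- The class of the associated curves of a Hitchin oper. -/
def hitchinHomeomorph (n : ℕ) (hn : 1 ≤ n) : HitchinOper n ≃ₜ HitchinFrenetSpace n hn where
  toFun D := Quotient.mk (pslSetoid n hn)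
    ⟨frameCurve hn (D.2.hasTrivialHolonomy.isFrame_fundSol hn),
      D.2.isHitchinFrenet hn (D.2.hasTrivialHolonomy.isAssociated hn)⟩
  invFun := Quotient.lift (fun ξ : HitchinFrenetCurve n hn =>
    (⟨curveOper hn ξ.2.isNondegenerate, ξ.2.isHitchin_curveOper⟩ : HitchinOper n)) (by
      rintro ξ ζ ⟨g, -, hg⟩
      exact Subtype.ext (ξ.2.isAssociated.oper_eq hn ζ.2.isAssociated g hg))
  left_inv D := Subtype.ext
    ((D.2.isHitchinFrenet hn (D.2.hasTrivialHolonomy.isAssociated hn)).isAssociated.unique hn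
      (D.2.hasTrivialHolonomy.isAssociated hn))
  right_inv x := by
    induction x using Quotient.inductionOn with
    | h ξ =>
      exact Quotient.sound ((ξ.2.isHitchin_curveOper.hasTrivialHolonomy.isAssociated
        hn).exists_equiv hn ξ.2.isAssociated)
  continuous_toFun := continuous_quotient_mk'.comp (Continuous.subtype_mk
    (continuous_frameCurve hn (fun D : HitchinOper n => D.2.hasTrivialHolonomy.isFrame_fundSol hn)
      ((jetSmooth_fundSol hn).comp_continuous continuous_subtype_val)) _)
  continuous_invFun := Continuous.quotient_lift (Continuous.subtype_mk
    (continuous_curveOper hn continuous_subtype_val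
      fun ξ : HitchinFrenetCurve n hn => ξ.2.isNondegenerate) _) _

end Hitchin

end OperCurve

end

/-! ### The main theorem -/

theorem mainTheorem7 (n : ℕ) (hn : 1 ≤ n) :
    ∃ Φ : OperCurve.HitchinOper n ≃ₜ OperCurve.HitchinFrenetSpace n hn,
      ∀ D : OperCurve.HitchinOper n,
        (∃ ξ : OperCurve.SmoothCurve n, D.1.IsAssociated ξ.toFun) ∧
        ∀ ξ : OperCurve.SmoothCurve n, D.1.IsAssociated ξ.toFun →
          ∃ hξ : ξ.IsHitchinFrenet hn,
            Φ D = Quotient.mk (OperCurve.pslSetoid n hn) ⟨ξ, hξ⟩ := by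
  refine ⟨OperCurve.hitchinHomeomorph n hn, fun D =>
    ⟨⟨_, D.2.hasTrivialHolonomy.isAssociated hn⟩, fun ξ hξ => ⟨D.2.isHitchinFrenet hn hξ, ?_⟩⟩⟩
  exact Quotient.sound ((D.2.hasTrivialHolonomy.isAssociated hn).exists_equiv hn hξ)
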